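/- **Setting.** Let $X$ be a countable set (the feature space) with the discrete $\sigma$-algebra, so that every distribution on $X\times\{0,1\}$ is discrete. A predictor is a map $h:X\to[0,1]$; groups are arbitrary subsets $g\subseteq X$. For a probability distribution $D$ on $X\times\{0,1\}$ and a group $g$ with $D(g):=\Pr_{(x,y)\sim D}[x\in g]>0$, let $D_g$ be $D$ conditioned on $x\in g$. A loss $L$ assigns to every distribution $D$ on $X\times\{0,1\}$ and every predictor $h$ a number $L_D(h)\in[0,1]$ that depends on $h$ only through its values on the support of the marginal of $D$ on $X$. For a nonempty sample $S$, $L_S(h)$ denotes $L_{\hat D}(h)$, where $\hat D$ is the empirical distribution of $S$. For a class $H$ of predictors, $L_D(H):=\inf_{h\in H}L_D(h)$, with $\inf\emptyset=+\infty$. By convention $\log 0=0$. * $L$ is *unambiguous* if for every $D$ whose marginal on $X$ is supported on a single point $x$, there is exactly one $v\in[0,1]$ that is the value $h(x)$ of a minimizer $h$ of $L_D(\cdot)$ over all predictors. * $L$ has the *uniform convergence property* if there are a function $m^{UC}:(0,1)^2\times\mathbb N\to\mathbb N$ and a real polynomial $f$ in three variables with $m^{UC}(\varepsilon,\delta,k)\le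 f(1/\varepsilon,1/\delta,\log k)$ for all $\varepsilon,\delta\in(0,1)$ and $k\in\mathbb N$, such that for every finite class $H$ of predictors, all $\varepsilon,\delta\in(0,1)$, every $D$ and every $m\ge \max(1,m^{UC}(\varepsilon,\delta,|H|))$, with probability at least $1-\delta$ over a sample $S$ of $m$ i.i.d. examples from $D$, $|L_S(h)-L_D(h)|\le\varepsilon$ for all $h\in H$. * $L$ is *multi-PAC compatible* if for every $D$, every finite class $H$, every finite collection $G$ of groups and every $\varepsilon>0$ there is a predictor $h$ such that $L_{D_g}(h)\le L_{D_g}(H)+\varepsilon$ for every $g\in G$ with $D(g)>0$. * $L$ is *multi-PAC learnable* if there are a (randomized) learning algorithm, which receives $\varepsilon,\delta,\gamma,H,G$, a sample and random coins and returns a predictor, a function $m^{gPAC}:(0,1)^3\times\mathbb N^2\to\mathbb N$, and a real polynomial $f$ in five variables with $m^{gPAC}(\varepsilon,\delta,\gamma,k,l)\le f(1/\varepsilon,1/\delta,1/\gamma,\log k,\log l)$ for all arguments, such that for all $\varepsilon,\delta,\gamma\in(0,1)$, every finite class $H$ of predictors, every finite collection $G$ of groups, every $D$ and every $m\ge m^{gPAC}(\varepsilon,\delta,\gamma,|H|,|G|)$,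 when run on $m$ i.i.d. examples from $D$ the algorithm returns, with probability at least $1-\delta$ over the examples and the coins, a predictor $h$ with $L_{D_g}(h)\le L_{D_g}(H)+\varepsilon$ for every $g\in G$ with $D(g)\ge\gamma$. **Theorem.** Let $\mathcal L$ be the class of losses that are unambiguous and have the uniform convergence property. If $L\in\mathcal L$ is multi-PAC compatible, then $L$ is multi-PAC learnable. -/

import Mathlib

open MeasureTheory ProbabilityTheory

noncomputable section

namespace MultiGroup

variable {X : Type*} [MeasurableSpace X]

/-- A predictor `h : X → [0,1]`; `h x` is an estimate of the probability that the label of `x` is 1. -/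
abbrev Predictor (X : Type*) : Type _ := X → unitInterval

/-- A distribution over labelled examples `X × {0,1}`. -/
abbrev LabelledDist (X : Type*) [MeasurableSpace X] : Type _ := ProbabilityMeasure (X × Bool)

/-- The event that the feature vector of an example lies in the group `g ⊆ X`. -/
def inGroup (g : Set X) : Set (X × Bool) := Prod.fst ⁻¹' g

/-- The mass `Pr_D[x ∈ g]` of a group. -/
def groupMass (D : LabelledDist X) (g : Set X) : ℝ := (D : Measure (X × Bool)).real (inGroup g)

/-- The support of (the `X`-marginal of) a distribution on a discrete feature space: its atoms. -/
def supp (D : LabelledDist X) : Set X := {x | groupMass D {x} ≠ 0}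

/-- The distribution `D_g` obtained by restricting `D` to `x ∈ g`, for a group of positive mass. -/
def restrictTo (D : LabelledDist X) (g : Set X) (hg : 0 < groupMass D g) : LabelledDist X :=
  ⟨(D : Measure (X × Bool))[|inGroup g], by
    refine cond_isProbabilityMeasure fun h0 => ?_
    simp [groupMass, Measure.real, h0] at hg⟩

/-- The empirical distribution of a nonempty sample `S = ((x₁, y₁), …, (xₘ, yₘ))`, which puts
mass `1 / m` on each of the `m` examples (with multiplicity). -/
def empirical {m : ℕ} [NeZero m] (S : Fin m → X × Bool) : LabelledDist X :=
  ⟨(m : ENNReal)⁻¹ • ∑ i, Measure.dirac (S i), ⟨by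
    simp [ENNReal.inv_mul_cancel, NeZero.ne m]⟩⟩

/-- The law of `m` i.i.d. examples drawn from `D`. -/
def iidSample (D : LabelledDist X) (m : ℕ) : Measure (Fin m → X × Bool) :=
  Measure.pi fun _ => (D : Measure (X × Bool))

/-- A loss function: an arbitrary map from a distribution and a predictor to `[0,1]` that depends
on the predictor only through its restriction to the support of the distribution. -/
structure Loss (X : Type*) [MeasurableSpace X] where
  /-- `toFun D h` is the loss `L_D(h)` -/
  toFun : LabelledDist X → Predictor X → unitInterval
  congr_supp : ∀ (D : LabelledDist X) (h h' : Predictor X),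
    (∀ x ∈ supp D, h x = h' x) → toFun D h = toFun D h'

/-- The loss `L_D(h)` as a real number. -/
def Loss.risk (L : Loss X) (D : LabelledDist X) (h : Predictor X) : ℝ := L.toFun D h

/-- `h` minimizes `L_D` over all predictors. -/
def Loss.IsMinimizer (L : Loss X) (D : LabelledDist X) (h : Predictor X) : Prop :=
  ∀ h' : Predictor X, L.risk D h ≤ L.risk D h'

/-- Unambiguity: for every distribution supported on a single `x`, exactly one
prediction at `x` minimizes the loss. -/
def Loss.Unambiguous (L : Loss X) : Prop :=
  ∀ (D : LabelledDist X) (x : X), groupMass D {x} = 1 →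
    ∃! v : unitInterval, ∃ h : Predictor X, h x = v ∧ L.IsMinimizer D h

/-- The finite class `H` has the uniform convergence property with respect to `L`, with sample
complexity `mH`. (Empty samples have no empirical distribution, so `m` is positive.) -/
def Loss.UniformConvergenceOn (L : Loss X) (H : Finset (Predictor X)) (mH : ℝ → ℝ → ℕ) : Prop :=
  ∀ ε ∈ Set.Ioo (0 : ℝ) 1, ∀ δ ∈ Set.Ioo (0 : ℝ) 1, ∀ D : LabelledDist X,
    ∀ (m : ℕ) [NeZero m], mH ε δ ≤ m →
      iidSample D m {S | ¬ ∀ h ∈ H, |L.risk (empirical S) h - L.risk D h| ≤ ε}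
        ≤ ENNReal.ofReal δ

/-- The loss `L` has the uniform convergence property with respect to finite classes, with a sample
complexity bounded by a polynomial in `1/ε`, `1/δ` and `log |H|`. -/
def Loss.UniformConvergence (L : Loss X) : Prop :=
  ∃ mUC : ℝ → ℝ → ℕ → ℕ,
    (∀ H : Finset (Predictor X), L.UniformConvergenceOn H fun ε δ => mUC ε δ H.card) ∧
    ∃ f : MvPolynomial (Fin 3) ℝ, ∀ ε ∈ Set.Ioo (0 : ℝ) 1, ∀ δ ∈ Set.Ioo (0 : ℝ) 1, ∀ k : ℕ,
      (mUC ε δ k : ℝ) ≤ f.eval ![1 / ε, 1 / δ, Real.log k]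

/-- The class of losses that are unambiguous and have the uniform convergence property. -/
def lossClass (X : Type*) [MeasurableSpace X] : Set (Loss X) :=
  {L | L.Unambiguous ∧ L.UniformConvergence}

/-- `L_D(h) ≤ L_D(H) + ε`, where `L_D(H)` is the infimum of `L_D` over `H`
(no requirement if `H` is empty). -/
def Loss.Competitive (L : Loss X) (D : LabelledDist X) (H : Finset (Predictor X)) (ε : ℝ)
    (h : Predictor X) : Prop :=
  ∀ h' ∈ H, L.risk D h ≤ L.risk D h' + ε

/-- Multi-PAC compatibility. (`D_g` only makes sense for groups of positive mass.) -/
def Loss.MultiPACCompatible (L : Loss X) : Prop :=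
  ∀ (D : LabelledDist X) (H : Finset (Predictor X)) (G : Finset (Set X)) (ε : ℝ), 0 < ε →
    ∃ h : Predictor X, ∀ g ∈ G, ∀ hg : 0 < groupMass D g,
      L.Competitive (restrictTo D g hg) H ε h

/-- The coins of a randomized algorithm: an infinite sequence of bits. -/
abbrev Coins : Type := ℕ → Bool

/-- The law of independent fair coins. -/
def fairCoins : Measure Coins :=
  Measure.infinitePi fun _ : ℕ => (PMF.uniformOfFintype Bool).toMeasure

/-- A (randomized) multi-group learner: given `ε`, `δ`, `γ`, a finite class `H`, a finite collection
`G` of groups, a sample of any size `m` and its coins, it returns a predictor. -/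
abbrev Learner (X : Type*) : Type _ :=
  (ε δ γ : ℝ) → (H : Finset (Predictor X)) → (G : Finset (Set X)) →
    (m : ℕ) → (Fin m → X × Bool) → Coins → Predictor X

/-- Multi-PAC learnability: some learner, on `m ≥ mL ε δ γ |H| |G|` i.i.d. examples, returns with
probability at least `1 - δ` (over examples and coins) a predictor that is `ε`-competitive with `H`
on every group of mass at least `γ`, and `mL` is bounded by a polynomial in `1/ε`, `1/δ`, `1/γ`,
`log |H|`, `log |G|`. The failure event is bounded in outer measure. -/
def Loss.MultiPACLearnable (L : Loss X) : Prop :=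
  ∃ (A : Learner X) (mL : ℝ → ℝ → ℝ → ℕ → ℕ → ℕ),
    (∀ ε ∈ Set.Ioo (0 : ℝ) 1, ∀ δ ∈ Set.Ioo (0 : ℝ) 1, ∀ γ ∈ Set.Ioo (0 : ℝ) 1,
      ∀ (H : Finset (Predictor X)) (G : Finset (Set X)) (D : LabelledDist X) (m : ℕ),
        mL ε δ γ H.card G.card ≤ m →
          ((iidSample D m).prod fairCoins)
            {p | ¬ ∀ g ∈ G, ∀ hg : 0 < groupMass D g, γ ≤ groupMass D g →
              L.Competitive (restrictTo D g hg) H ε (A ε δ γ H G m p.1 p.2)}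
            ≤ ENNReal.ofReal δ) ∧
    ∃ f : MvPolynomial (Fin 5) ℝ,
      ∀ ε ∈ Set.Ioo (0 : ℝ) 1, ∀ δ ∈ Set.Ioo (0 : ℝ) 1, ∀ γ ∈ Set.Ioo (0 : ℝ) 1, ∀ k l : ℕ,
        (mL ε δ γ k l : ℝ) ≤ f.eval ![1 / ε, 1 / δ, 1 / γ, Real.log k, Real.log l]

end MultiGroup

end

/-! The learner searches for a label model `p` that the relevant tests cannot tell from the true
labels, and returns a predictor that competes for the model. A risk is an arbitrary functional of
the distribution, so it is replaced by `avgRisk`, the expected empirical risk on `k + 1` i.i.d.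
examples. Uniform convergence on singleton classes keeps it within `2 * e` of the risk, and it is
the mean of a bounded test on finitely many examples.

Descent: suppose that on a large group the test for some predictor in `H`, or for the competitor
attached to `p`, separates true labels from labels drawn according to `p`. A hybrid argument then
finds one slot where the influence of the label on the test correlates with the residual `y - p x`,
and a gradient step along this influence lowers the expected squared error (`exists_gradStep_le`).
That error lies in `[0,1]`, so polynomially many steps suffice (`measure_forall_runPath_notMem_le`).

Competitor: compatibility applies to a known distribution, but the marginal on `X` is unknown.
Points of noticeable mass all occur in the sample, and their weights can be guessed. The other
points are so light that `k + 1` examples rarely repeat one, so the group looks like a mixture, over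
random sets of light points, of distributions that weight these points equally. Compatibility is
applied once, to a synthetic distribution on a finite window with constant weight off the sample,
and with all subsets of the window as groups. The resulting predictor competes on each component of
the mixture, hence on the mixture, although its choice ignores which light points carry the mass
(`avgRisk_relabel_le_of_competitive_synth`).

Selection: whatever the learner cannot see (the weights, and the group, test, slot, sign and labels
of each step) is advice. The logarithm of the number of advice strings is polynomial, so all of them
are tried, and fresh data select one whose estimated risks compete (`measure_select_fails_le`). The
budget is `8 * e` for the synthetic distributions, `2 * e` for relabelling, `8 * e` for estimating
risks in the selection, and `4 * e` for returning from `avgRisk` to the risk, in all `22 * e = ε`.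
-/

noncomputable section

namespace MultiGroup

/-! ### Product measures and Hoeffding's inequality. -/

section Product

variable {ι κ α : Type*} [Fintype ι] [Fintype κ] [MeasurableSpace α]

theorem pi_map_comp_injective (μ : Measure α) [IsProbabilityMeasure μ] (e : κ → ι)
    (he : Function.Injective e) :
    (Measure.pi fun _ : ι => μ).map (fun S j => S (e j)) = Measure.pi fun _ : κ => μ := by
  classical
  refine (Measure.pi_eq fun s hs => ?_).symm
  rw [Measure.map_apply (by fun_prop) (.univ_pi hs)]
  have : (fun (S : ι → α) j => S (e j)) ⁻¹' Set.univ.pi s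
      = Set.univ.pi (Function.extend e s fun _ => Set.univ) := by
    ext S
    simp only [Set.mem_preimage, Set.mem_pi, Set.mem_univ, true_imp_iff]
    refine ⟨fun h i => ?_, fun h j => by simpa [he.extend_apply] using h (e j)⟩
    by_cases hi : ∃ j, e j = i
    · obtain ⟨j, rfl⟩ := hi
      simpa [he.extend_apply] using h j
    · simp [Function.extend_apply' _ _ _ hi]
  rw [this, Measure.pi_pi]
  refine (Fintype.prod_of_injective e he _ _ (fun i hi => ?_) fun j => ?_).symm
  · rw [Function.extend_apply' _ _ _ (by simpa using hi)]; simp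
  · rw [he.extend_apply]

/-- Used to integrate out one example while the others stay frozen, in the hybrid argument and in
the collision bound. -/
theorem pi_map_update [DecidableEq ι] (μ : Measure α) [IsProbabilityMeasure μ] (i : ι) :
    ((Measure.pi fun _ : ι => μ).prod μ).map (fun p => Function.update p.1 i p.2)
      = Measure.pi fun _ : ι => μ := by
  have hm : Measurable fun p : (ι → α) × α => Function.update p.1 i p.2 := by
    refine measurable_pi_lambda _ fun j => ?_
    by_cases hj : j = i
    · subst hj; simpa using measurable_snd
    · simp only [Function.update_of_ne hj]; fun_prop
  refine (Measure.pi_eq fun s hs => ?_).symm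
  rw [Measure.map_apply hm (.univ_pi hs)]
  have : (fun p : (ι → α) × α => Function.update p.1 i p.2) ⁻¹' Set.univ.pi s
      = (Set.univ.pi (Function.update s i Set.univ)) ×ˢ s i := by
    ext ⟨S, z⟩
    simp only [Set.mem_preimage, Set.mem_pi, Set.mem_univ, true_imp_iff, Set.mem_prod]
    constructor
    · intro h
      refine ⟨fun j => ?_, by simpa using h i⟩
      by_cases hj : j = i
      · subst hj; simp
      · simpa [Function.update_of_ne hj] using h j
    · rintro ⟨h, hz⟩ j
      by_cases hj : j = i
      · subst hj; simpa using hz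
      · simpa [Function.update_of_ne hj] using h j
  rw [this, Measure.prod_prod, Measure.pi_pi, ← Finset.prod_erase_mul _ _ (Finset.mem_univ i),
    ← Finset.prod_erase_mul Finset.univ (fun i => μ (s i)) (Finset.mem_univ i)]
  simp only [Function.update_self, measure_univ, mul_one]
  congr 1
  exact Finset.prod_congr rfl fun j hj => by rw [Function.update_of_ne (Finset.ne_of_mem_erase hj)]

/-- Splitting an i.i.d. sample into a plain sample and two samples of blocks. -/
theorem pi_map_split [Countable α] [MeasurableSingletonClass α] {a b c : Type*} [Fintype a]
    [Fintype b] [Fintype c] (μ : Measure α) [IsProbabilityMeasure μ] :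
    (Measure.pi fun _ : a ⊕ (b × ι × κ) ⊕ (c × ι × κ) => μ).map
      (fun S => ((fun i => S (.inl i), fun i j l => S (.inr (.inl (i, j, l))),
        fun i j l => S (.inr (.inr (i, j, l)))) :
          (a → α) × (b → ι → κ → α) × (c → ι → κ → α)))
    = (Measure.pi fun _ => μ).prod ((Measure.pi fun _ => Measure.pi fun _ => Measure.pi fun _ => μ).prod
        (Measure.pi fun _ => Measure.pi fun _ => Measure.pi fun _ => μ)) := by
  refine Measure.ext_of_singleton fun ⟨x, y, z⟩ => ?_
  rw [Measure.map_apply (.of_discrete) (.of_discrete)]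
  have : (fun S : a ⊕ (b × ι × κ) ⊕ (c × ι × κ) → α =>
      ((fun i => S (.inl i), fun i j l => S (.inr (.inl (i, j, l))),
        fun i j l => S (.inr (.inr (i, j, l)))) :
          (a → α) × (b → ι → κ → α) × (c → ι → κ → α))) ⁻¹' {(x, y, z)}
      = {Sum.elim x (Sum.elim (fun p => y p.1 p.2.1 p.2.2) fun p => z p.1 p.2.1 p.2.2)} := by
    ext S
    simp only [Set.mem_preimage, Set.mem_singleton_iff, Prod.mk.injEq, funext_iff]
    constructor
    · rintro ⟨h1, h2, h3⟩ (i | ⟨i, j, l⟩ | ⟨i, j, l⟩)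
      · exact h1 i
      · exact h2 i j l
      · exact h3 i j l
    · intro h
      exact ⟨fun i => h (.inl i), fun i j l => h (.inr (.inl (i, j, l))),
        fun i j l => h (.inr (.inr (i, j, l)))⟩
  rw [this, ← Set.singleton_prod_singleton, ← Set.singleton_prod_singleton, Measure.prod_prod,
    Measure.prod_prod]
  simp only [Measure.pi_singleton, Fintype.prod_sum_type, Fintype.prod_prod_type, Sum.elim_inl,
    Sum.elim_inr]

/-- Hoeffding's inequality for the empirical mean of a `[0,1]`-valued function. -/
theorem hoeffding_mean (μ : Measure α) [IsProbabilityMeasure μ] (U : α → ℝ) (hU : Measurable U)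
    (h01 : ∀ w, U w ∈ Set.Icc (0 : ℝ) 1) {r : ℕ} (hr : 0 < r) {β : ℝ} (hβ : 0 ≤ β) :
    (Measure.pi fun _ : Fin r => μ).real {w | β ≤ |(∑ i, U (w i)) / r - ∫ x, U x ∂μ|}
      ≤ 2 * Real.exp (-2 * r * β ^ 2) := by
  have hint : ∀ i : Fin r, ∫ w, U (w i) ∂(Measure.pi fun _ : Fin r => μ) = ∫ x, U x ∂μ := fun i => by
    have h := (measurePreserving_eval (fun _ : Fin r => μ) i)
    have h' := integral_map (μ := Measure.pi fun _ : Fin r => μ) h.measurable.aemeasurable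
      (hU.aestronglyMeasurable (μ := Measure.map (Function.eval i) (Measure.pi fun _ : Fin r => μ)))
    rw [h.map_eq] at h'
    exact h'.symm
  have hsub : ∀ i : Fin r, HasSubgaussianMGF (fun w : Fin r → α => U (w i) - ∫ x, U x ∂μ)
      ((‖(1 : ℝ) - 0‖₊ / 2) ^ 2) (Measure.pi fun _ : Fin r => μ) := fun i => by
    have := hasSubgaussianMGF_of_mem_Icc (μ := Measure.pi fun _ : Fin r => μ)
      (X := fun w => U (w i)) (a := 0) (b := 1) (hU.comp (measurable_pi_apply i)).aemeasurable (.of_forall fun w => h01 _)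
    simpa only [hint] using this
  have hind : iIndepFun (fun (i : Fin r) (w : Fin r → α) => U (w i) - ∫ x, U x ∂μ)
      (Measure.pi fun _ : Fin r => μ) :=
    iIndepFun_pi (X := fun _ x => U x - ∫ x, U x ∂μ) fun _ => by fun_prop
  have hr' : (0 : ℝ) < r := by exact_mod_cast hr
  have h1 := HasSubgaussianMGF.measure_sum_ge_le_of_iIndepFun hind (s := Finset.univ)
    (fun i _ => hsub i) (ε := r * β) (by positivity)
  have h2 := HasSubgaussianMGF.measure_sum_ge_le_of_iIndepFun
    (X := fun (i : Fin r) (w : Fin r → α) => -(U (w i) - ∫ x, U x ∂μ))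
    (hind.comp (fun _ x => -x) fun _ => measurable_neg) (s := Finset.univ)
    (fun i _ => (hsub i).neg) (ε := r * β) (by positivity)
  -- A `[0,1]`-valued variable has sub-Gaussian parameter `1 / 4`, so the sum of `r` of them has
  -- parameter `r / 4`.
  have e1 : Real.exp (-(r * β) ^ 2 / (2 * ∑ i : Fin r, (((‖(1 : ℝ) - 0‖₊ / 2) ^ 2 : NNReal) : ℝ)))
      = Real.exp (-2 * r * β ^ 2) := by
    congr 1
    simp
    field_simp
  push_cast at h1 h2 e1
  rw [e1] at h1 h2
  refine (measureReal_mono (s₂ := {w | r * β ≤ ∑ i, (U (w i) - ∫ x, U x ∂μ)} ∪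
    {w | r * β ≤ ∑ i, -(U (w i) - ∫ x, U x ∂μ)}) fun w hw => ?_).trans
    ((measureReal_union_le _ _).trans (by linarith))
  have e2 : ∑ i, (U (w i) - ∫ x, U x ∂μ) = r * ((∑ i, U (w i)) / r - ∫ x, U x ∂μ) := by
    rw [Finset.sum_sub_distrib]; simp; field_simp
  simp only [Set.mem_union, Set.mem_ofPred_eq, Finset.sum_neg_distrib, e2] at hw ⊢
  rcases le_abs.1 hw with h | h
  · left; gcongr
  · right; rw [← mul_neg]; gcongr

end Product

end MultiGroup

namespace MultiGroup

/-! ### Rejection sampling from a group. -/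

section Rejection

variable {α : Type*}

open Classical in
/-- The first entry of a nonempty list that lies in `s`; the last entry if there is none. -/
def firstIn (s : Set α) : (n : ℕ) → (Fin (n + 1) → α) → α
  | 0, u => u 0
  | n + 1, u => if u 0 ∈ s then u 0 else firstIn s n (Fin.tail u)

variable [MeasurableSpace α] [Countable α] [MeasurableSingletonClass α]

/-- First-step recursion: the row returns `z` at its first entry, or passes over an entry outside
`s` and starts again. The default value of `firstIn` is harmless, because a returned `z ∈ s` is
always a genuine hit. -/
theorem mul_firstIn_law (μ : Measure α) [IsProbabilityMeasure μ] (s : Set α) {z : α} (hz : z ∈ s)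
    (n : ℕ) :
    μ.real s * (Measure.pi fun _ : Fin (n + 1) => μ).real {u | firstIn s n u = z}
      = (1 - (1 - μ.real s) ^ (n + 1)) * μ.real {z} := by
  induction n with
  | zero =>
    have : {u : Fin (0 + 1) → α | firstIn s 0 u = z} = Set.univ.pi fun _ => {z} := by
      ext u; simp [firstIn, Fin.forall_fin_one]
    rw [this, measureReal_def (Measure.pi _), Measure.pi_pi]
    simp [measureReal_def]
  | succ n ih =>
    have hp := measurePreserving_piFinSuccAbove (fun _ : Fin (n + 2) => μ) 0
    have e : {u | firstIn s (n + 1) u = z}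
        = (MeasurableEquiv.piFinSuccAbove (fun _ : Fin (n + 2) => α) 0) ⁻¹'
          ({z} ×ˢ Set.univ ∪ sᶜ ×ˢ {u | firstIn s n u = z}) := by
      ext u
      have ht : (MeasurableEquiv.piFinSuccAbove (fun _ : Fin (n + 2) => α) 0) u
          = (u 0, Fin.tail u) := rfl
      simp only [Set.mem_preimage, ht, Set.mem_union, Set.mem_prod, Set.mem_singleton_iff,
        Set.mem_univ, and_true, Set.mem_compl_iff, Set.mem_ofPred_eq, firstIn]
      split_ifs with h
      · simp [h]
      · have : u 0 ≠ z := fun h' => h (h' ▸ hz)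
        simp [h, this]
    have hd : Disjoint ({z} ×ˢ (Set.univ : Set (Fin (n + 1) → α)))
        (sᶜ ×ˢ {u | firstIn s n u = z}) := by
      rw [Set.disjoint_left]
      rintro ⟨a, u⟩ h1 h2
      simp only [Set.mem_prod, Set.mem_singleton_iff] at h1 h2
      exact h2.1 (h1.1 ▸ hz)
    have hpre := hp.measure_preimage (s := {z} ×ˢ Set.univ ∪ sᶜ ×ˢ {u | firstIn s n u = z})
      (MeasurableSet.of_discrete).nullMeasurableSet
    rw [measureReal_def (Measure.pi _), e, hpre, measure_union hd .of_discrete, Measure.prod_prod,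
      Measure.prod_prod, measure_univ, mul_one, ENNReal.toReal_add (by finiteness) (by finiteness),
      ENNReal.toReal_mul]
    change μ.real s * (μ.real {z} + μ.real sᶜ *
      (Measure.pi fun _ : Fin (n + 1) => μ).real {u | firstIn s n u = z}) = _
    rw [probReal_compl_eq_one_sub .of_discrete]
    linear_combination (1 - μ.real s) * ih

variable {κ : Type*} [Fintype κ]

/-- Rejection sampling: from each row, the first entry in `s`. -/
def pick (s : Set α) {n : ℕ} (w : κ → Fin (n + 1) → α) (j : κ) : α := firstIn s n (w j)

/-- Rejection sampling succeeds in each row. -/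
def found (s : Set α) {n : ℕ} : Set (κ → Fin (n + 1) → α) := {w | ∀ j, pick s w j ∈ s}

/-- The probability that a row of length `n + 1` meets a set of probability `q`. -/
def hitProb (q : ℝ) (n : ℕ) : ℝ := 1 - (1 - q) ^ (n + 1)

/-- Whether a row succeeds is independent of which point of `s` it returns, so restricting to
success merely rescales the law of an i.i.d. sample from `μ[|s]`. -/
theorem map_pick_restrict_found (μ : Measure α) [IsProbabilityMeasure μ] (s : Set α)
    (hs : 0 < μ.real s) (n : ℕ) :
    ((Measure.pi fun _ : κ => Measure.pi fun _ : Fin (n + 1) => μ).restrict (found s)).map (pick s)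
      = ENNReal.ofReal (hitProb (μ.real s) n ^ Fintype.card κ) • Measure.pi fun _ : κ => μ[|s] := by
  have hq1 : μ.real s ≤ 1 := measureReal_le_one
  have hc : 0 ≤ hitProb (μ.real s) n := by
    rw [hitProb, sub_nonneg]; exact pow_le_one₀ (by linarith) (by linarith)
  have : IsProbabilityMeasure (μ[|s]) := cond_isProbabilityMeasure fun h0 => by
    simp [measureReal_def, h0] at hs
  refine Measure.ext_of_singleton fun z => ?_
  rw [Measure.map_apply .of_discrete .of_discrete, Measure.restrict_apply .of_discrete,
    Measure.smul_apply, Measure.pi_singleton]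
  by_cases hz : ∀ j, z j ∈ s
  · have e : pick s ⁻¹' {z} ∩ found s
        = Set.univ.pi fun j : κ => {u : Fin (n + 1) → α | firstIn s n u = z j} := by
      ext w
      simp only [Set.mem_inter_iff, Set.mem_preimage, Set.mem_singleton_iff, funext_iff, found,
        Set.mem_ofPred_eq, Set.mem_pi, Set.mem_univ, true_imp_iff, pick]
      exact ⟨fun h => h.1, fun h => ⟨h, fun j => h j ▸ hz j⟩⟩
    rw [e, Measure.pi_pi, ENNReal.ofReal_pow hc, smul_eq_mul, ← Finset.card_univ,
      ← Finset.prod_const, ← Finset.prod_mul_distrib]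
    refine Finset.prod_congr rfl fun j _ => ?_
    have h := mul_firstIn_law μ s (hz j) n
    have h' : (Measure.pi fun _ : Fin (n + 1) => μ).real {u | firstIn s n u = z j}
        = hitProb (μ.real s) n * ((μ.real s)⁻¹ * μ.real {z j}) := by
      rw [hitProb]; field_simp; linarith
    rw [cond_apply .of_discrete, Set.inter_eq_right.2 (Set.singleton_subset_iff.2 (hz j)),
      ← ENNReal.ofReal_toReal (a := (Measure.pi fun _ : Fin (n + 1) => μ) _) (by finiteness),
      ← measureReal_def, h', ENNReal.ofReal_mul hc, ENNReal.ofReal_mul (by positivity),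
      ENNReal.ofReal_inv_of_pos hs, measureReal_def, ENNReal.ofReal_toReal (by finiteness),
      measureReal_def, ENNReal.ofReal_toReal (by finiteness)]
  · push Not at hz
    obtain ⟨j, hj⟩ := hz
    have e : pick s ⁻¹' {z} ∩ found (κ := κ) (n := n) s = ∅ := by
      ext w
      simp only [Set.mem_inter_iff, Set.mem_preimage, Set.mem_singleton_iff, Set.mem_empty_iff_false,
        iff_false, not_and]
      rintro rfl h
      exact hj (h j)
    rw [e, measure_empty, Finset.prod_eq_zero (Finset.mem_univ j), smul_zero]
    rw [cond_apply .of_discrete, Set.inter_singleton_eq_empty.2 hj, measure_empty, mul_zero]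

theorem setIntegral_found (μ : Measure α) [IsProbabilityMeasure μ] (s : Set α)
    (hs : 0 < μ.real s) (n : ℕ) (f : (κ → α) → ℝ) :
    ∫ w in found s, f (pick s w) ∂(Measure.pi fun _ : κ => Measure.pi fun _ : Fin (n + 1) => μ)
      = hitProb (μ.real s) n ^ Fintype.card κ * ∫ z, f z ∂(Measure.pi fun _ : κ => μ[|s]) := by
  have hq1 : μ.real s ≤ 1 := measureReal_le_one
  have hc : 0 ≤ hitProb (μ.real s) n := by
    rw [hitProb, sub_nonneg]; exact pow_le_one₀ (by linarith) (by linarith)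
  rw [← integral_map (f := f) (φ := pick s)
    (Measurable.of_discrete).aemeasurable (Measurable.of_discrete).aestronglyMeasurable,
    map_pick_restrict_found μ s hs n, integral_smul_measure, ENNReal.toReal_ofReal (by positivity),
    smul_eq_mul]

theorem measureReal_found (μ : Measure α) [IsProbabilityMeasure μ] (s : Set α)
    (hs : 0 < μ.real s) (n : ℕ) :
    (Measure.pi fun _ : κ => Measure.pi fun _ : Fin (n + 1) => μ).real (found s)
      = hitProb (μ.real s) n ^ Fintype.card κ := by
  have : IsProbabilityMeasure (μ[|s]) := cond_isProbabilityMeasure fun h0 => by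
    simp [measureReal_def, h0] at hs
  simpa using setIntegral_found (κ := κ) μ s hs n fun _ => 1

/-- Combine `(1 - q) ^ n * (1 + q) ^ n ≤ 1` with Bernoulli's inequality. Exponential decay is not
needed where only polynomial sample complexity is at stake. -/
theorem one_sub_pow_le {q : ℝ} (hq : 0 < q) (hq1 : q ≤ 1) {n : ℕ} (hn : 0 < n) :
    (1 - q) ^ n ≤ 1 / (n * q) := by
  have hn' : (0 : ℝ) < n := by exact_mod_cast hn
  have h1 : 1 + n * q ≤ (1 + q) ^ n := one_add_mul_le_pow (by linarith) n
  have h2 : (1 - q) ^ n * (1 + q) ^ n ≤ 1 := by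
    rw [← mul_pow]; exact pow_le_one₀ (by nlinarith) (by nlinarith)
  have h3 : 0 ≤ (1 - q) ^ n := pow_nonneg (by linarith) n
  rw [le_div_iff₀ (by positivity)]
  nlinarith

theorem one_sub_le_hitProb_pow {q : ℝ} (hq : 0 < q) (hq1 : q ≤ 1) (n k : ℕ) :
    1 - k * (1 / ((n + 1 : ℕ) * q)) ≤ hitProb q n ^ k := by
  have h := one_sub_pow_le hq hq1 n.succ_pos
  have h0 : (1 - q) ^ (n + 1) ≤ 1 := pow_le_one₀ (by linarith) (by linarith)
  have h1 : 1 + (k : ℝ) * (-(1 - q) ^ (n + 1)) ≤ (1 + -(1 - q) ^ (n + 1)) ^ k :=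
    one_add_mul_le_pow (by linarith) k
  rw [hitProb, sub_eq_add_neg 1 ((1 - q) ^ (n + 1))]
  refine le_trans ?_ h1
  have : (k : ℝ) * (1 - q) ^ (n + 1) ≤ k * (1 / ((n + 1 : ℕ) * q)) := by gcongr
  linarith

theorem hitProb_pow_le_one {q : ℝ} (hq : 0 ≤ q) (hq1 : q ≤ 1) (n k : ℕ) : hitProb q n ^ k ≤ 1 :=
  pow_le_one₀ (by rw [hitProb, sub_nonneg]; exact pow_le_one₀ (by linarith) (by linarith))
    (by rw [hitProb]; linarith [pow_nonneg (sub_nonneg.2 hq1) (n + 1)])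

end Rejection

/-! ### Potential descent guided by advice. -/

section Descent

variable {P W Q : Type*}

/-- The state reached from `p` by the updates that the data `b` and the advice `q` prescribe. -/
def runPath (upd : P → W → Q → P) : (T : ℕ) → P → (Fin T → W) → (Fin T → Q) → P
  | 0, p, _, _ => p
  | T + 1, p, b, q => runPath upd T (upd p (b 0) (q 0)) (Fin.tail b) (Fin.tail q)

theorem runPath_const (upd : P → W → Q → P) (q₀ : Q) (hq₀ : ∀ p w, upd p w q₀ = p) (T : ℕ) (p : P)
    (b : Fin T → W) : runPath upd T p b (fun _ => q₀) = p := by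
  induction T generalizing p with
  | zero => rfl
  | succ T ih => rw [runPath, hq₀]; exact ih p _

/-- If, outside of `good`, some advice decreases the potential by `c` on average, then it is likely
that some sequence of `T` pieces of advice leads to `good`. -/
theorem measure_forall_runPath_notMem_le [MeasurableSpace W] [Countable W]
    [MeasurableSingletonClass W] (ω : Measure W) [IsProbabilityMeasure ω] (upd : P → W → Q → P)
    (q₀ : Q) (hq₀ : ∀ p w, upd p w q₀ = p) (Φ : P → ℝ) (hΦ : ∀ p, Φ p ∈ Set.Icc (0 : ℝ) 1)
    (good : Set P) {c : ℝ} (hc : 0 ≤ c)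
    (hprog : ∀ p ∉ good, ∃ q : W → Q, ∫ w, Φ (upd p w (q w)) ∂ω ≤ Φ p - c) (T : ℕ) (p : P) :
    c * T * (Measure.pi fun _ : Fin T => ω).real {b | ∀ q, runPath upd T p b q ∉ good} ≤ Φ p := by
  induction T generalizing p with
  | zero => simpa using (hΦ p).1
  | succ T ih =>
    by_cases hp : p ∈ good
    · have : {b : Fin (T + 1) → W | ∀ q, runPath upd (T + 1) p b q ∉ good} = ∅ := by
        ext b
        simp only [Set.mem_ofPred_eq, Set.mem_empty_iff_false, iff_false, not_forall, not_not]
        exact ⟨fun _ => q₀, by rwa [runPath_const upd q₀ hq₀]⟩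
      rw [this]
      simpa using (hΦ p).1
    obtain ⟨q, hq⟩ := hprog p hp
    set E : P → Set (Fin T → W) := fun p => {b | ∀ q, runPath upd T p b q ∉ good} with hE
    have hmp := measurePreserving_piFinSuccAbove (fun _ : Fin (T + 1) => ω) 0
    -- If all advice fails, so does advice that begins with the improving `q (b 0)`; hence every
    -- continuation fails from the updated state.
    have hsub : {b : Fin (T + 1) → W | ∀ q, runPath upd (T + 1) p b q ∉ good}
        ⊆ (MeasurableEquiv.piFinSuccAbove (fun _ : Fin (T + 1) => W) 0) ⁻¹'
          {x | x.2 ∈ E (upd p x.1 (q x.1))} := by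
      intro b hb path
      have := hb (Fin.cons (q (b 0)) path)
      simpa [runPath] using this
    have hF : (Measure.pi fun _ : Fin (T + 1) => ω).real
        {b | ∀ q, runPath upd (T + 1) p b q ∉ good}
        ≤ ∫ w, (Measure.pi fun _ : Fin T => ω).real (E (upd p w (q w))) ∂ω := by
      refine (measureReal_mono hsub).trans ?_
      rw [measureReal_def, hmp.measure_preimage (MeasurableSet.of_discrete).nullMeasurableSet,
        Measure.prod_apply .of_discrete, ← integral_toReal (Measurable.of_discrete).aemeasurable
          (.of_forall fun _ => measure_lt_top _ _)]
      rfl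
    have hint : ∀ f : W → ℝ, (∀ w, f w ∈ Set.Icc (0 : ℝ) 1) → Integrable f ω := fun f hf =>
      Integrable.of_mem_Icc 0 1 (Measurable.of_discrete).aemeasurable (.of_forall hf)
    have h1 : c * T * ∫ w, (Measure.pi fun _ : Fin T => ω).real (E (upd p w (q w))) ∂ω
        ≤ Φ p - c := by
      rw [← integral_const_mul]
      refine (integral_mono ((hint _ fun w => ⟨measureReal_nonneg, measureReal_le_one⟩).const_mul _)
        (hint _ fun w => hΦ _) fun w => ih _).trans hq
    have h2 : (Measure.pi fun _ : Fin (T + 1) => ω).real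
        {b | ∀ q, runPath upd (T + 1) p b q ∉ good} ≤ 1 := measureReal_le_one
    -- The failure probability is multiplied by `c * (T + 1)`: the part `c * T` is at most `Φ p - c`
    -- by `h1`, and the remaining `c` is covered since a probability is at most `1`.
    have h3 := mul_le_mul_of_nonneg_left hF (show 0 ≤ c * T by positivity)
    have h4 := mul_le_mul_of_nonneg_left h2 hc
    push_cast
    linarith

end Descent

/-! ### What a large sample sees: heavy values and all but a small tail. -/

section Coverage

variable {α : Type*} [MeasurableSpace α] [Countable α] [MeasurableSingletonClass α]

theorem measureReal_forall_notMem_le (μ : Measure α) [IsProbabilityMeasure μ] {n : ℕ} (hn : 0 < n)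
    (s : Set α) {θ : ℝ} (hθ : 0 < θ) (hs : θ ≤ μ.real s) :
    (Measure.pi fun _ : Fin n => μ).real {S | ∀ j, S j ∉ s} ≤ 1 / (n * θ) := by
  have e : {S : Fin n → α | ∀ j, S j ∉ s} = Set.univ.pi fun _ => sᶜ := by ext; simp
  have hn' : (0 : ℝ) < n := by exact_mod_cast hn
  rw [e, measureReal_def, Measure.pi_pi, Finset.prod_const, ENNReal.toReal_pow, ← measureReal_def,
    probReal_compl_eq_one_sub .of_discrete, Finset.card_univ, Fintype.card_fin]
  exact (one_sub_pow_le (hθ.trans_le hs) measureReal_le_one hn).trans (by gcongr)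

/-- All likely values of `f` occur in a large sample. -/
theorem measureReal_exists_missed_le {β : Type*} [Countable β] (f : α → β) (μ : Measure α)
    [IsProbabilityMeasure μ] {n : ℕ} (hn : 0 < n) {θ : ℝ} (hθ : 0 < θ) :
    (Measure.pi fun _ : Fin n => μ).real
      {S | ∃ x, θ < μ.real (f ⁻¹' {x}) ∧ ∀ j, f (S j) ≠ x} ≤ 1 / (n * θ ^ 2) := by
  have hn' : (0 : ℝ) < n := by exact_mod_cast hn
  set B : β → Set (Fin n → α) := fun x => {S | θ < μ.real (f ⁻¹' {x}) ∧ ∀ j, f (S j) ≠ x}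
  -- A heavy value has mass above `θ`, so `1 / (n * θ)` is at most `1 / (n * θ ^ 2)` times its mass.
  -- In this form the union bound over infinitely many values sums to the total mass.
  have hB : ∀ x, (Measure.pi fun _ : Fin n => μ) (B x)
      ≤ ENNReal.ofReal (1 / (n * θ ^ 2)) * μ (f ⁻¹' {x}) := fun x => by
    by_cases hx : θ < μ.real (f ⁻¹' {x})
    · have h := measureReal_forall_notMem_le μ hn (f ⁻¹' {x}) hθ hx.le
      have e : B x = {S | ∀ j, S j ∉ f ⁻¹' {x}} := by ext S; simp [B, hx]
      rw [e, ← ENNReal.ofReal_toReal (a := (Measure.pi fun _ : Fin n => μ) _) (by finiteness),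
        ← ENNReal.ofReal_toReal (a := μ _) (by finiteness), ← ENNReal.ofReal_mul (by positivity)]
      refine ENNReal.ofReal_le_ofReal (h.trans ?_)
      have : 1 / (n * θ ^ 2) * θ = 1 / (n * θ) := by field_simp
      rw [← this]
      exact mul_le_mul_of_nonneg_left hx.le (by positivity)
    · have e : B x = ∅ := by ext S; simp [B, hx]
      simp [e]
  have e : {S : Fin n → α | ∃ x, θ < μ.real (f ⁻¹' {x}) ∧ ∀ j, f (S j) ≠ x} = ⋃ x, B x := by
    ext S; simp [B]
  have htot : ∑' x, μ (f ⁻¹' {x}) = 1 := by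
    rw [← measure_iUnion (fun x y hxy => ?_) fun _ => .of_discrete, ← Set.preimage_iUnion]
    · rw [show (⋃ i, {i} : Set β) = Set.univ by ext; simp, Set.preimage_univ, measure_univ]
    · exact Disjoint.preimage _ (by simpa using hxy)
  rw [e, measureReal_def]
  refine ENNReal.toReal_le_of_le_ofReal (by positivity)
    ((measure_iUnion_le _).trans ((ENNReal.tsum_le_tsum hB).trans ?_))
  rw [ENNReal.tsum_mul_left, htot, mul_one]

/-- Little mass lies beyond the largest value in a large sample. -/
theorem measureReal_tail_le (f : α → ℕ) (μ : Measure α) [IsProbabilityMeasure μ] {n : ℕ}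
    (hn : 0 < n) {τ : ℝ} (hτ : 0 < τ) :
    (Measure.pi fun _ : Fin n => μ).real {S | τ < μ.real {z | ∀ j, f (S j) < f z}}
      ≤ 1 / (n * τ) := by
  classical
  have hex : ∃ M, μ.real {z | M ≤ f z} ≤ τ := by
    have h := tendsto_measure_iInter_atTop (μ := μ) (s := fun M => {z | M ≤ f z})
      (fun _ => (MeasurableSet.of_discrete).nullMeasurableSet)
      (fun a b hab z (hz : b ≤ f z) => hab.trans hz) ⟨0, by finiteness⟩
    have e : ⋂ M, {z | M ≤ f z} = ∅ := by
      ext z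
      simp only [Set.mem_iInter, Set.mem_ofPred_eq, Set.mem_empty_iff_false, iff_false, not_forall]
      exact ⟨f z + 1, by omega⟩
    rw [e, measure_empty] at h
    have h' := (ENNReal.tendsto_toReal (by simp)).comp h
    obtain ⟨M, hM⟩ := (h'.eventually (ge_mem_nhds (by simpa using hτ))).exists
    exact ⟨M, hM⟩
  -- With `M` least, the set from `M - 1` on is still heavier than `τ`, so the sample likely hits
  -- it; whatever exceeds that hit is at least `M` and has mass at most `τ`.
  obtain ⟨M, hM, hmin⟩ : ∃ M, μ.real {z | M ≤ f z} ≤ τ ∧ ∀ m < M, τ < μ.real {z | m ≤ f z} :=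
    ⟨Nat.find hex, Nat.find_spec hex, fun m hm => not_le.1 (Nat.find_min hex hm)⟩
  rcases Nat.eq_zero_or_pos M with rfl | hM0
  · have e : {S : Fin n → α | τ < μ.real {z | ∀ j, f (S j) < f z}} = ∅ := by
      ext S
      simp only [Set.mem_ofPred_eq, Set.mem_empty_iff_false, iff_false, not_lt]
      exact (measureReal_mono fun z _ => Nat.zero_le _).trans hM
    rw [e]; simp; positivity
  · refine (measureReal_mono fun S hS j hj => ?_).trans
      (measureReal_forall_notMem_le μ hn {z | M - 1 ≤ f z} hτ (hmin _ (by omega)).le)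
    refine absurd (hS : τ < _) (not_lt.2 ((measureReal_mono fun z hz => ?_).trans hM))
    have h1 : M - 1 ≤ f (S j) := hj
    have h2 : f (S j) < f z := hz j
    show M ≤ f z
    omega

end Coverage

end MultiGroup

namespace MultiGroup

variable {X : Type*} [MeasurableSpace X]

/-! ### Expected empirical risk as a proxy for the risk. -/

section AverageRisk

/-- The expected empirical risk of `h` on `k + 1` i.i.d. examples. -/
def avgRisk (L : Loss X) (h : Predictor X) (k : ℕ) (μ : Measure (X × Bool)) : ℝ :=
  ∫ S, L.risk (empirical S) h ∂(Measure.pi fun _ : Fin (k + 1) => μ)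

theorem risk_mem_Icc (L : Loss X) (D : LabelledDist X) (h : Predictor X) :
    L.risk D h ∈ Set.Icc (0 : ℝ) 1 := (L.toFun D h).2

theorem integrable_of_mem_Icc_of_discrete {α : Type*} [MeasurableSpace α] [DiscreteMeasurableSpace α]
    (μ : Measure α) [IsFiniteMeasure μ] {f : α → ℝ} {a b : ℝ} (hf : ∀ x, f x ∈ Set.Icc a b) :
    Integrable f μ :=
  Integrable.of_mem_Icc a b (Measurable.of_discrete).aemeasurable (.of_forall hf)

variable [Countable X] [DiscreteMeasurableSpace X]

/-- The deviation is at most `e` except with probability `e`, and never exceeds `1`. Only the class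
`{h}` enters, so `k` need not grow with `H`, and the bound also covers predictors outside `H`. -/
theorem abs_avgRisk_sub_risk_le (L : Loss X) (h : Predictor X) {mH : ℝ → ℝ → ℕ}
    (hUC : L.UniformConvergenceOn {h} mH) {e : ℝ} (he : e ∈ Set.Ioo (0 : ℝ) 1) {k : ℕ}
    (hk : mH e e ≤ k + 1) (D : LabelledDist X) :
    |avgRisk L h k D - L.risk D h| ≤ 2 * e := by
  set π := Measure.pi fun _ : Fin (k + 1) => (D : Measure (X × Bool))
  have hbad := hUC e he e he D (k + 1) hk
  simp only [Finset.mem_singleton, forall_eq, not_le, iidSample] at hbad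
  set B := {S : Fin (k + 1) → X × Bool | e < |L.risk (empirical S) h - L.risk D h|}
  have hB : π.real B ≤ e := ENNReal.toReal_le_of_le_ofReal he.1.le hbad
  have hi : ∀ {f : (Fin (k + 1) → X × Bool) → ℝ} {a b : ℝ}, (∀ x, f x ∈ Set.Icc a b) →
      Integrable f π := fun hf => integrable_of_mem_Icc_of_discrete π hf
  have h1 : avgRisk L h k D - L.risk D h = ∫ S, (L.risk (empirical S) h - L.risk D h) ∂π := by
    rw [integral_sub (hi fun S => risk_mem_Icc _ _ _) (integrable_const _)]
    simp [avgRisk, π]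
  rw [h1]
  have habs : ∀ S : Fin (k + 1) → X × Bool, |L.risk (empirical S) h - L.risk D h| ≤ 1 := fun S => by
    have h1 := risk_mem_Icc L (empirical S) h
    have h2 := risk_mem_Icc L D h
    rw [abs_le]; constructor <;> linarith [h1.1, h1.2, h2.1, h2.2]
  calc |∫ S, (L.risk (empirical S) h - L.risk D h) ∂π|
      ≤ ∫ S, |L.risk (empirical S) h - L.risk D h| ∂π := abs_integral_le_integral_abs
    _ ≤ ∫ S, (e + B.indicator (fun _ => (1 : ℝ)) S) ∂π := by
      refine integral_mono (hi (a := 0) (b := 1) fun S => ⟨abs_nonneg _, habs S⟩)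
        ((integrable_const _).add ((integrable_const _).indicator .of_discrete)) fun S => ?_
      by_cases hS : S ∈ B
      · simp only [Set.indicator_of_mem hS]; linarith [habs S, he.1]
      · simp only [Set.indicator_of_notMem hS, add_zero]; exact not_lt.1 hS
    _ = e + π.real B := by
      rw [integral_add (integrable_const _) ((integrable_const _).indicator .of_discrete),
        integral_indicator_const _ .of_discrete]
      simp
    _ ≤ 2 * e := by linarith

end AverageRisk

/-! ### Labels drawn according to a predictor. -/

section FakeLabels

/-- The probability of the label `b` under the prediction `v`. -/
def labelProb (v : unitInterval) (b : Bool) : ENNReal :=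
  if b then ENNReal.ofReal v else ENNReal.ofReal (1 - v)

theorem labelProb_add (v : unitInterval) : labelProb v true + labelProb v false = 1 := by
  simp only [labelProb, if_true, Bool.false_eq_true, if_false]
  rw [← ENNReal.ofReal_add v.2.1 (by linarith [v.2.2])]
  simp

theorem labelProb_ne_top (v : unitInterval) (b : Bool) : labelProb v b ≠ ⊤ := by
  cases b <;> simp [labelProb]

/-- Attach to each example a second label, drawn according to the predictor `p`. -/
def withFake (μ : Measure (X × Bool)) (p : Predictor X) : Measure ((X × Bool) × Bool) :=
  (μ.prod Measure.count).withDensity fun ω => labelProb (p ω.1.1) ω.2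

/-- Replace the labels by labels drawn according to the predictor `p`. -/
def relabel (μ : Measure (X × Bool)) (p : Predictor X) : Measure (X × Bool) :=
  (withFake μ p).map fun ω => (ω.1.1, ω.2)

variable [Countable X] [DiscreteMeasurableSpace X] (μ : Measure (X × Bool)) (p : Predictor X)

theorem withFake_singleton [SFinite μ] (z : X × Bool) (b : Bool) :
    withFake μ p {(z, b)} = μ {z} * labelProb (p z.1) b := by
  rw [withFake, withDensity_apply _ .of_discrete, ← Set.singleton_prod_singleton,
    Set.singleton_prod_singleton, lintegral_singleton, ← Set.singleton_prod_singleton,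
    Measure.prod_prod, Measure.count_singleton, mul_one, mul_comm]

theorem withFake_map_fst [SFinite μ] : (withFake μ p).map Prod.fst = μ := by
  refine Measure.ext_of_singleton fun z => ?_
  rw [Measure.map_apply .of_discrete .of_discrete]
  have : (Prod.fst ⁻¹' {z} : Set ((X × Bool) × Bool)) = {(z, true)} ∪ {(z, false)} := by
    ext ⟨z', b⟩; cases b <;> simp
  rw [this, measure_union (by simp) .of_discrete, withFake_singleton, withFake_singleton, ← mul_add,
    labelProb_add, mul_one]

instance [IsProbabilityMeasure μ] : IsProbabilityMeasure (withFake μ p) := by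
  constructor
  rw [← Set.preimage_univ (f := Prod.fst), ← Measure.map_apply .of_discrete .of_discrete,
    withFake_map_fst, measure_univ]

instance [IsProbabilityMeasure μ] : IsProbabilityMeasure (relabel μ p) :=
  Measure.isProbabilityMeasure_map (Measurable.of_discrete).aemeasurable

theorem relabel_singleton [SFinite μ] (x : X) (b : Bool) :
    relabel μ p {(x, b)} = μ (inGroup {x}) * labelProb (p x) b := by
  rw [relabel, Measure.map_apply .of_discrete .of_discrete]
  have : (fun ω : (X × Bool) × Bool => (ω.1.1, ω.2)) ⁻¹' {(x, b)}
      = {((x, true), b)} ∪ {((x, false), b)} := by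
    ext ⟨⟨x', y⟩, b'⟩; cases y <;> simp
  have e : (inGroup {x} : Set (X × Bool)) = {(x, true)} ∪ {(x, false)} := by
    ext ⟨x', y⟩; cases y <;> simp [inGroup]
  rw [this, measure_union (by simp) .of_discrete, withFake_singleton, withFake_singleton, ← add_mul,
    e, measure_union (by simp) .of_discrete]

/-- The numerical value of a label. -/
def labelValue (b : Bool) : ℝ := if b then 1 else 0

theorem integral_withFake [IsProbabilityMeasure μ] {f : (X × Bool) × Bool → ℝ} {a b : ℝ}
    (hf : ∀ ω, f ω ∈ Set.Icc a b) :
    ∫ ω, f ω ∂(withFake μ p)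
      = ∫ z, ((p z.1 : ℝ) * f (z, true) + (1 - p z.1) * f (z, false)) ∂μ := by
  have hi : Integrable f (withFake μ p) := integrable_of_mem_Icc_of_discrete _ hf
  have hd : ∀ᵐ ω ∂(μ.prod Measure.count), labelProb (p ω.1.1) ω.2 < ⊤ :=
    .of_forall fun ω => (labelProb_ne_top _ _).lt_top
  have hi' := (integrable_withDensity_iff_integrable_smul'
    (Measurable.of_discrete (f := fun ω : (X × Bool) × Bool => labelProb (p ω.1.1) ω.2)) hd).1 hi
  rw [withFake, integral_withDensity_eq_integral_toReal_smul .of_discrete hd, integral_prod _ hi']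
  refine integral_congr_ae (.of_forall fun z => ?_)
  have h1 : 0 ≤ (p z.1 : ℝ) := (p z.1).2.1
  have h2 : 0 ≤ 1 - (p z.1 : ℝ) := by linarith [(p z.1).2.2]
  simp [integral_countable, measureReal_def, labelProb,
    ENNReal.toReal_ofReal h1, ENNReal.toReal_ofReal h2, Measure.count_apply]

theorem sub_labelValue_mul_mem_Icc (a b : Bool) {t : ℝ} (ht : t ∈ Set.Icc (-1 : ℝ) 1) :
    (labelValue a - labelValue b) * t ∈ Set.Icc (-1 : ℝ) 1 := by
  obtain ⟨h1, h2⟩ := ht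
  cases a <;> cases b <;> simp [labelValue] <;> (try constructor) <;> linarith

/-- Given the features, the second label has mean `p x`, so averaging it out turns a difference of
labels into the residual on which a gradient step acts. -/
theorem integral_withFake_sub_mul [IsProbabilityMeasure μ] {f : X → ℝ}
    (hf : ∀ x, f x ∈ Set.Icc (-1 : ℝ) 1) :
    ∫ ω, (labelValue ω.1.2 - labelValue ω.2) * f ω.1.1 ∂(withFake μ p)
      = ∫ z, (labelValue z.2 - p z.1) * f z.1 ∂μ := by
  rw [integral_withFake μ p (a := -1) (b := 1)
    (f := fun ω => (labelValue ω.1.2 - labelValue ω.2) * f ω.1.1)]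
  · refine integral_congr_ae (.of_forall fun z => ?_)
    simp only [labelValue, if_true, Bool.false_eq_true, if_false]
    ring
  · exact fun ω => sub_labelValue_mul_mem_Icc _ _ (hf _)

end FakeLabels

end MultiGroup

/-! ### Hybrid argument and gradient steps for the squared error. -/

namespace MultiGroup

variable {X : Type*} [MeasurableSpace X]

/-- The expected squared error of the predictor `p`. -/
def brier (μ : Measure (X × Bool)) (p : Predictor X) : ℝ :=
  ∫ z, (labelValue z.2 - p z.1) ^ 2 ∂μ

theorem labelValue_mem_Icc (b : Bool) : labelValue b ∈ Set.Icc (0 : ℝ) 1 := by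
  cases b <;> simp [labelValue]

theorem sq_labelValue_sub_mem_Icc (b : Bool) (v : unitInterval) :
    (labelValue b - v) ^ 2 ∈ Set.Icc (0 : ℝ) 1 := by
  have h1 := labelValue_mem_Icc b
  have h2 := v.2
  refine ⟨sq_nonneg _, ?_⟩
  rw [sq_le_one_iff_abs_le_one, abs_le]
  constructor <;> linarith [h1.1, h1.2, h2.1, h2.2]

/-- Move each value of `p` by `u` and clip to `[0,1]`. -/
def shiftClip (p : Predictor X) (u : X → ℝ) : Predictor X :=
  fun x => Set.projIcc 0 1 zero_le_one ((p x : ℝ) + u x)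

/-- Labels lie in `[0,1]`, so clipping cannot hurt and a gradient step may be analysed without it.
-/
theorem sq_sub_projIcc_le {y : ℝ} (hy : y ∈ Set.Icc (0 : ℝ) 1) (v : ℝ) :
    (y - (Set.projIcc 0 1 zero_le_one v : unitInterval)) ^ 2 ≤ (y - v) ^ 2 := by
  rw [sq_le_sq, Set.coe_projIcc]
  rcases le_total v 0 with h | h
  · rw [min_eq_right (by linarith), max_eq_left h, abs_of_nonneg (by linarith [hy.1]),
      abs_of_nonneg (by linarith [hy.1])]
    linarith
  · rcases le_total v 1 with h' | h'
    · rw [min_eq_right h', max_eq_right h]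
    · rw [min_eq_left h', max_eq_right zero_le_one, abs_of_nonpos (by linarith [hy.2]),
        abs_of_nonpos (by linarith [hy.2])]
      linarith

variable {κ : Type*}

/-- The hybrid of the examples `s` and the labels `y` at slot `i`: true labels before `i`,
the labels `y` after `i`, and the example `(x, b)` in slot `i`. -/
def hybrid [LinearOrder κ] (s : κ → X × Bool) (y : κ → Bool) (i : κ) (x : X) (b : Bool) :
    κ → X × Bool :=
  fun j => if j = i then (x, b) else if j < i then s j else ((s j).1, y j)

/-- The influence of the label of `x` on the test `Λ` in slot `i` of the hybrid. -/
def influence [LinearOrder κ] (Λ : (κ → X × Bool) → ℝ) (s : κ → X × Bool) (y : κ → Bool) (i : κ)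
    (x : X) : ℝ :=
  Λ (hybrid s y i x true) - Λ (hybrid s y i x false)

open Classical in
/-- A gradient step on the group `g` along (or, for `σ = false`, against) the influence of the
labels. -/
def gradStep [LinearOrder κ] (η : ℝ) (g : Set X) (Λ : (κ → X × Bool) → ℝ) (i : κ) (σ : Bool)
    (s : κ → X × Bool) (y : κ → Bool) (p : Predictor X) : Predictor X :=
  shiftClip p fun x => if x ∈ g then (if σ then η else -η) * influence Λ s y i x else 0

section Hybrid

variable {X : Type*} {k : ℕ}

/-- Examples with true labels before slot `i` and with the second label from slot `i` on. -/
def hybridSample (i : ℕ) (ω : Fin k → (X × Bool) × Bool) : Fin k → X × Bool :=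
  fun j => if (j : ℕ) < i then (ω j).1 else ((ω j).1.1, (ω j).2)

/-- The two hybrids differ only in the label at slot `i`, and a function of one bit is affine in it,
with the influence as slope. -/
theorem hybridSample_succ_sub (Λ : (Fin k → X × Bool) → ℝ) (i : Fin k)
    (ω : Fin k → (X × Bool) × Bool) :
    Λ (hybridSample (i + 1) ω) - Λ (hybridSample i ω)
      = (labelValue (ω i).1.2 - labelValue (ω i).2) *
        influence Λ (fun j => (ω j).1) (fun j => (ω j).2) i (ω i).1.1 := by
  have h1 : hybridSample (i + 1) ω
      = hybrid (fun j => (ω j).1) (fun j => (ω j).2) i (ω i).1.1 (ω i).1.2 := by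
    funext j
    rcases lt_trichotomy j i with h | h | h
    · have h' : (j : ℕ) < i := h
      simp [hybridSample, hybrid, h.ne, h, h'.trans (Nat.lt_succ_self _)]
    · subst h; simp [hybridSample, hybrid]
    · have h' : ¬ (j : ℕ) < i + 1 := by have : (i : ℕ) < j := h; omega
      simp [hybridSample, hybrid, h.ne', h.not_gt, h']
  have h2 : hybridSample i ω
      = hybrid (fun j => (ω j).1) (fun j => (ω j).2) i (ω i).1.1 (ω i).2 := by
    funext j
    rcases lt_trichotomy j i with h | h | h
    · have h' : (j : ℕ) < i := h
      simp [hybridSample, hybrid, h.ne, h]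
    · subst h; simp [hybridSample, hybrid]
    · simp [hybridSample, hybrid, h.ne', h.not_gt]
  rw [h1, h2]
  cases (ω i).1.2 <;> cases (ω i).2 <;> simp [influence, labelValue]

theorem influence_update (Λ : (Fin k → X × Bool) → ℝ) (i : Fin k)
    (ω : Fin k → (X × Bool) × Bool) (v : (X × Bool) × Bool) (x : X) :
    influence Λ (fun j => (Function.update ω i v j).1) (fun j => (Function.update ω i v j).2) i x
      = influence Λ (fun j => (ω j).1) (fun j => (ω j).2) i x := by
  have : ∀ b, hybrid (fun j => (Function.update ω i v j).1)
      (fun j => (Function.update ω i v j).2) i x b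
      = hybrid (fun j => (ω j).1) (fun j => (ω j).2) i x b := fun b => by
    funext j
    by_cases h : j = i
    · simp [hybrid, h]
    · simp [hybrid, h]
  simp [influence, this]

end Hybrid

variable [Countable X] [DiscreteMeasurableSpace X]

theorem brier_mem_Icc (μ : Measure (X × Bool)) [IsProbabilityMeasure μ] (p : Predictor X) :
    brier μ p ∈ Set.Icc (0 : ℝ) 1 := by
  refine ⟨integral_nonneg fun _ => sq_nonneg _, ?_⟩
  have := integral_mono (μ := μ) (g := fun _ => (1 : ℝ))
    (integrable_of_mem_Icc_of_discrete μ fun z : X × Bool => sq_labelValue_sub_mem_Icc z.2 (p z.1))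
    (integrable_const _) fun z => (sq_labelValue_sub_mem_Icc z.2 (p z.1)).2
  simpa [brier] using this

theorem pi_map_pi_const {ι α β : Type*} [Fintype ι] [MeasurableSpace α] [DiscreteMeasurableSpace α]
    [MeasurableSpace β] (μ : Measure α) [IsProbabilityMeasure μ] (f : α → β) :
    (Measure.pi fun _ : ι => μ).map (fun ω j => f (ω j)) = Measure.pi fun _ : ι => μ.map f := by
  have : IsProbabilityMeasure (μ.map f) :=
    Measure.isProbabilityMeasure_map (Measurable.of_discrete).aemeasurable
  exact Measure.pi_map_pi fun _ => (Measurable.of_discrete).aemeasurable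

theorem measureReal_mul_integral_cond {α : Type*} [MeasurableSpace α] [DiscreteMeasurableSpace α]
    (μ : Measure α) [IsProbabilityMeasure μ] {s : Set α} (hs : 0 < μ.real s) (f : α → ℝ) :
    μ.real s * ∫ z, f z ∂μ[|s] = ∫ z in s, f z ∂μ := by
  rw [ProbabilityTheory.cond, integral_smul_measure, smul_eq_mul, ENNReal.toReal_inv,
    ← measureReal_def]
  field_simp

/-- Expand the square: the linear term is the correlation of the influence with the residual on `g`,
and the quadratic term is at most `η ^ 2` because the influence is at most `1` in absolute value. -/
theorem brier_gradStep_le [LinearOrder κ] (μ : Measure (X × Bool)) [IsProbabilityMeasure μ]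
    {g : Set X} (hg : 0 < μ.real (inGroup g)) {η : ℝ} {Λ : (κ → X × Bool) → ℝ}
    (hΛ : ∀ S, Λ S ∈ Set.Icc (0 : ℝ) 1) (i : κ) (σ : Bool) (s : κ → X × Bool) (y : κ → Bool)
    (p : Predictor X) :
    brier μ (gradStep η g Λ i σ s y p) ≤ brier μ p - 2 * (if σ then η else -η) *
      (μ.real (inGroup g) *
        ∫ z, (labelValue z.2 - p z.1) * influence Λ s y i z.1 ∂μ[|inGroup g]) + η ^ 2 := by
  set c := if σ then η else -η with hc
  have hc2 : c ^ 2 = η ^ 2 := by rw [hc]; split_ifs <;> ring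
  set Δ := influence Λ s y i
  have hΔ : ∀ x, |Δ x| ≤ 1 := fun x => by
    have h1 := hΛ (hybrid s y i x true)
    have h2 := hΛ (hybrid s y i x false)
    change |Λ (hybrid s y i x true) - Λ (hybrid s y i x false)| ≤ 1
    rw [abs_le]; constructor <;> linarith [h1.1, h1.2, h2.1, h2.2]
  have hy : ∀ z : X × Bool, |labelValue z.2 - p z.1| ≤ 1 := fun z => by
    have := (sq_labelValue_sub_mem_Icc z.2 (p z.1)).2
    rwa [sq_le_one_iff_abs_le_one] at this
  set G : X × Bool → ℝ := (inGroup g).indicator fun z => (labelValue z.2 - p z.1) * Δ z.1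
  have hG1 : ∀ z : X × Bool, |(labelValue z.2 - p z.1) * Δ z.1| ≤ 1 := fun z => by
    rw [abs_mul]; exact mul_le_one₀ (hy z) (abs_nonneg _) (hΔ _)
  have hG : ∀ z, G z ∈ Set.Icc (-1 : ℝ) 1 := fun z => by
    by_cases hz : z ∈ inGroup g
    · simp only [G, Set.indicator_of_mem hz]; exact abs_le.1 (hG1 z)
    · simp [G, Set.indicator_of_notMem hz]
  have hiG : Integrable G μ := integrable_of_mem_Icc_of_discrete μ hG
  have hib : ∀ q : Predictor X, Integrable (fun z : X × Bool => (labelValue z.2 - q z.1) ^ 2) μ :=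
    fun q => integrable_of_mem_Icc_of_discrete μ fun z => sq_labelValue_sub_mem_Icc z.2 (q z.1)
  have hpt : ∀ z : X × Bool, (labelValue z.2 - gradStep η g Λ i σ s y p z.1) ^ 2
      ≤ (labelValue z.2 - p z.1) ^ 2 - 2 * c * G z + η ^ 2 := fun z => by
    refine (sq_sub_projIcc_le (labelValue_mem_Icc z.2) _).trans ?_
    by_cases hz : z.1 ∈ g
    · have hz' : z ∈ inGroup g := hz
      simp only [G, Set.indicator_of_mem hz', if_pos hz]
      have : (c * Δ z.1) ^ 2 ≤ η ^ 2 := by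
        rw [mul_pow, hc2]
        exact mul_le_of_le_one_right (sq_nonneg _) ((sq_le_one_iff_abs_le_one _).2 (hΔ _))
      change (labelValue z.2 - (p z.1 + c * Δ z.1)) ^ 2 ≤ _
      nlinarith
    · have hz' : z ∉ inGroup g := hz
      simp only [G, Set.indicator_of_notMem hz', if_neg hz]
      nlinarith [sq_nonneg η]
  have hint : ∫ z, G z ∂μ = μ.real (inGroup g) *
        ∫ z, (labelValue z.2 - p z.1) * Δ z.1 ∂μ[|inGroup g] := by
    rw [measureReal_mul_integral_cond μ hg, integral_indicator .of_discrete]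
  have h := integral_mono (hib (gradStep η g Λ i σ s y p))
    (((hib p).sub (hiG.const_mul (2 * c))).add (integrable_const (η ^ 2))) hpt
  have h2 := integral_add ((hib p).sub (hiG.const_mul (2 * c))) (integrable_const (μ := μ) (η ^ 2))
  rw [integral_sub' (hib p) (hiG.const_mul (2 * c)), integral_const_mul, hint, integral_const,
    probReal_univ, one_smul] at h2
  exact h.trans h2.le

variable {k : ℕ}

/-- Slot `i` can be resampled independently, since the influence depends only on the other slots.
Averaging the second label of the new example then leaves the residual. -/
theorem integral_hybridSample_succ_sub (ν : Measure (X × Bool)) [IsProbabilityMeasure ν]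
    (p : Predictor X) {Λ : (Fin k → X × Bool) → ℝ} (hΛ : ∀ S, Λ S ∈ Set.Icc (0 : ℝ) 1) (i : Fin k) :
    ∫ ω, Λ (hybridSample (i + 1) ω) ∂(Measure.pi fun _ : Fin k => withFake ν p)
        - ∫ ω, Λ (hybridSample i ω) ∂(Measure.pi fun _ : Fin k => withFake ν p)
      = ∫ ω, (∫ z, (labelValue z.2 - p z.1) *
          influence Λ (fun j => (ω j).1) (fun j => (ω j).2) i z.1 ∂ν)
          ∂(Measure.pi fun _ : Fin k => withFake ν p) := by
  have hinf : ∀ s y x, influence Λ s y i x ∈ Set.Icc (-1 : ℝ) 1 := fun s y x => by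
    have h1 := hΛ (hybrid s y i x true)
    have h2 := hΛ (hybrid s y i x false)
    simp only [influence]
    constructor <;> linarith [h1.1, h1.2, h2.1, h2.2]
  rw [← integral_sub (integrable_of_mem_Icc_of_discrete _ fun ω => hΛ _)
    (integrable_of_mem_Icc_of_discrete _ fun ω => hΛ _)]
  simp_rw [hybridSample_succ_sub]
  conv_lhs => rw [← pi_map_update (withFake ν p) i]
  rw [integral_map (Measurable.of_discrete).aemeasurable
    (Measurable.of_discrete).aestronglyMeasurable, integral_prod _
      (integrable_of_mem_Icc_of_discrete _ fun ω => sub_labelValue_mul_mem_Icc _ _ (hinf _ _ _))]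
  refine integral_congr_ae (.of_forall fun ω => ?_)
  simp only [influence_update, Function.update_self]
  exact integral_withFake_sub_mul ν p (hinf _ _)

/-- If a test on `k` examples tells true labels from labels drawn according to `p`, some label
influence correlates with the error of `p`. -/
theorem exists_influence_of_lt (hk : 0 < k) (ν : Measure (X × Bool)) [IsProbabilityMeasure ν]
    (p : Predictor X) {Λ : (Fin k → X × Bool) → ℝ} (hΛ : ∀ S, Λ S ∈ Set.Icc (0 : ℝ) 1) {e : ℝ}
    (hgap : e < |∫ S, Λ S ∂(Measure.pi fun _ : Fin k => ν)
      - ∫ S, Λ S ∂(Measure.pi fun _ : Fin k => relabel ν p)|) :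
    ∃ (i : Fin k) (σ : Bool), e / k ≤ (if σ then 1 else -1) *
      ∫ ω, (∫ z, (labelValue z.2 - p z.1) *
        influence Λ (fun j => (ω j).1) (fun j => (ω j).2) i z.1 ∂ν)
        ∂(Measure.pi fun _ : Fin k => withFake ν p) := by
  set π := Measure.pi fun _ : Fin k => withFake ν p with hπ
  set a : ℕ → ℝ := fun i => ∫ ω, Λ (hybridSample i ω) ∂π with ha
  have h0 : ∫ S, Λ S ∂(Measure.pi fun _ : Fin k => relabel ν p) = a 0 := by
    have hm : (Measure.pi fun _ : Fin k => relabel ν p) = π.map (hybridSample 0) := by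
      rw [hπ, show (hybridSample 0 : (Fin k → (X × Bool) × Bool) → _)
          = fun ω j => ((ω j).1.1, (ω j).2) by funext ω j; simp [hybridSample],
        pi_map_pi_const (withFake ν p) fun ω => (ω.1.1, ω.2)]
      rfl
    rw [hm, integral_map (Measurable.of_discrete).aemeasurable
      (Measurable.of_discrete).aestronglyMeasurable]
  have hkt : ∫ S, Λ S ∂(Measure.pi fun _ : Fin k => ν) = a k := by
    have hm : (Measure.pi fun _ : Fin k => ν) = π.map (hybridSample k) := by
      rw [hπ, show (hybridSample k : (Fin k → (X × Bool) × Bool) → _)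
          = fun ω j => (ω j).1 by funext ω j; simp [hybridSample],
        pi_map_pi_const (withFake ν p) Prod.fst, withFake_map_fst]
    rw [hm, integral_map (Measurable.of_discrete).aemeasurable
      (Measurable.of_discrete).aestronglyMeasurable]
  -- The hybrids telescope from model labels to true labels, so one of the `k` increments carries at
  -- least `e / k` of the gap.
  rw [h0, hkt, ← Finset.sum_range_sub, ← Fin.sum_univ_eq_sum_range (fun i => a (i + 1) - a i)] at hgap
  have hstep : ∀ i : Fin k, a (i + 1) - a i = ∫ ω, (∫ z, (labelValue z.2 - p z.1) *
      influence Λ (fun j => (ω j).1) (fun j => (ω j).2) i z.1 ∂ν) ∂π :=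
    fun i => integral_hybridSample_succ_sub ν p hΛ i
  by_contra! hno
  refine absurd hgap (not_lt.2 ?_)
  have habs : ∀ i : Fin k, |a (i + 1) - a i| ≤ e / k := fun i => by
    have h1 := (hno i true).le
    have h2 := (hno i false).le
    rw [if_pos rfl, one_mul, ← hstep] at h1
    rw [if_neg (by simp), ← hstep] at h2
    rw [abs_le]; constructor <;> linarith
  refine (Finset.abs_sum_le_sum_abs _ _).trans ((Finset.sum_le_sum fun i _ => habs i).trans ?_)
  have hk' : (k : ℝ) ≠ 0 := by exact_mod_cast hk.ne'
  rw [Finset.sum_const, Finset.card_univ, Fintype.card_fin, nsmul_eq_mul]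
  field_simp
  exact le_rfl

open Classical in
/-- If a test on `k` examples from the group `g` tells true labels from labels drawn according to
`p`, some gradient step decreases the expected squared error, on average over the examples. -/
theorem exists_gradStep_le (hk : 0 < k) (μ : Measure (X × Bool)) [IsProbabilityMeasure μ]
    (p : Predictor X) {g : Set X} {γ : ℝ} (hγ : 0 < γ) (hg : γ ≤ μ.real (inGroup g))
    {Λ : (Fin k → X × Bool) → ℝ} (hΛ : ∀ S, Λ S ∈ Set.Icc (0 : ℝ) 1) {e : ℝ} (he : 0 ≤ e)
    (hgap : e < |∫ S, Λ S ∂(Measure.pi fun _ : Fin k => μ[|inGroup g])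
      - ∫ S, Λ S ∂(Measure.pi fun _ : Fin k => relabel (μ[|inGroup g]) p)|) :
    ∃ (i : Fin k) (σ : Bool) (y : (Fin k → X × Bool) → Fin k → Bool),
      ∫ s, brier μ (gradStep (γ * e / k) g Λ i σ s (y s) p)
        ∂(Measure.pi fun _ : Fin k => μ[|inGroup g]) ≤ brier μ p - (γ * e / k) ^ 2 := by
  set η := γ * e / k with hη
  have hk' : (0 : ℝ) < k := by exact_mod_cast hk
  have hη0 : 0 ≤ η := by positivity
  have hg0 : 0 < μ.real (inGroup g) := hγ.trans_le hg
  set ν := μ[|inGroup g] with hν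
  have : IsProbabilityMeasure ν := cond_isProbabilityMeasure fun h0 => by
    simp [measureReal_def, h0] at hg0
  obtain ⟨i, σ, hi⟩ := exists_influence_of_lt hk ν p hΛ hgap
  -- In the hybrid the labels after slot `i` are random draws from `p`. Replacing them by the best
  -- labels for `s` only lowers the score, and makes them a finite choice that advice can name.
  have hmin : ∀ s, ∃ y, ∀ y', brier μ (gradStep η g Λ i σ s y p)
      ≤ brier μ (gradStep η g Λ i σ s y' p) := fun s =>
    Finite.exists_min fun y => brier μ (gradStep η g Λ i σ s y p)
  choose y hy using hmin
  refine ⟨i, σ, y, ?_⟩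
  set π := Measure.pi fun _ : Fin k => withFake ν p
  have hm : (Measure.pi fun _ : Fin k => ν) = π.map (fun ω j => (ω j).1) := by
    rw [pi_map_pi_const (withFake ν p) Prod.fst, withFake_map_fst]
  set I : (Fin k → (X × Bool) × Bool) → ℝ := fun ω => ∫ z, (labelValue z.2 - p z.1) *
    influence Λ (fun j => (ω j).1) (fun j => (ω j).2) i z.1 ∂ν with hI
  have hIb : ∀ ω, I ω ∈ Set.Icc (-1 : ℝ) 1 := fun ω => by
    rw [Set.mem_Icc, ← abs_le]
    have hb : ∀ z : X × Bool, ‖(labelValue z.2 - p z.1) *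
        influence Λ (fun j => (ω j).1) (fun j => (ω j).2) i z.1‖ ≤ 1 := fun z => by
      rw [norm_mul]
      refine mul_le_one₀ ?_ (norm_nonneg _) ?_
      · have := (sq_labelValue_sub_mem_Icc z.2 (p z.1)).2
        rwa [sq_le_one_iff_abs_le_one] at this
      · have h1 := hΛ (hybrid (fun j => (ω j).1) (fun j => (ω j).2) i z.1 true)
        have h2 := hΛ (hybrid (fun j => (ω j).1) (fun j => (ω j).2) i z.1 false)
        rw [Real.norm_eq_abs, influence, abs_le]
        constructor <;> linarith [h1.1, h1.2, h2.1, h2.2]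
    simpa using norm_integral_le_of_norm_le_const (μ := ν) (.of_forall hb)
  have hIi : Integrable I π := integrable_of_mem_Icc_of_discrete _ hIb
  rw [hm, integral_map (Measurable.of_discrete).aemeasurable
    (Measurable.of_discrete).aestronglyMeasurable]
  set c := (if σ then η else -η) with hc
  have hcσ : c = η * (if σ then 1 else -1) := by rw [hc]; split_ifs <;> ring
  calc ∫ ω, brier μ (gradStep η g Λ i σ (fun j => (ω j).1) (y fun j => (ω j).1) p) ∂π
      ≤ ∫ ω, (brier μ p + η ^ 2 - 2 * c * μ.real (inGroup g) * I ω) ∂π := by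
        refine integral_mono (integrable_of_mem_Icc_of_discrete _ fun ω => brier_mem_Icc _ _)
          ((integrable_const _).sub (hIi.const_mul _)) fun ω => ?_
        refine (hy _ fun j => (ω j).2).trans ((brier_gradStep_le μ hg0 hΛ i σ _ _ p).trans ?_)
        simp only [hI]
        linarith
    _ = brier μ p + η ^ 2 - 2 * η * μ.real (inGroup g) *
          ((if σ then 1 else -1) * ∫ ω, I ω ∂π) := by
        rw [integral_sub (integrable_const _) (hIi.const_mul _), integral_const_mul, hcσ]
        simp
    -- The step size `η = γ * (e / k)` is the product of the lower bounds for the group mass and for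
    -- the correlation, so the linear gain is at least twice the quadratic cost.
    _ ≤ brier μ p + η ^ 2 - 2 * η * η := by
        have h1 : η ≤ μ.real (inGroup g) * ((if σ then 1 else -1) * ∫ ω, I ω ∂π) := by
          have : η = γ * (e / k) := by rw [hη]; ring
          rw [this]
          exact mul_le_mul hg hi (by positivity) hg0.le
        have h2 := mul_le_mul_of_nonneg_left h1 hη0
        linarith
    _ = brier μ p - η ^ 2 := by ring

end MultiGroup

namespace MultiGroup

/-! ### Occupancy counts and collisions in i.i.d. samples. -/

section Occupancy

variable {α β J : Type*} [MeasurableSpace α] [Countable α] [MeasurableSingletonClass α] [Fintype J]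

-- Expand the product over maps `φ` from points to sample positions. The points being distinct, only
-- injective `φ` contribute, each with probability `∏ j, ρ {x j}`, and there are at most `n ^ |J|`
-- of them.
open Classical in
theorem lintegral_prod_sum_indicator_le (ρ : Measure α) [IsProbabilityMeasure ρ] (n : ℕ)
    {x : J → α} (hx : Function.Injective x) :
    ∫⁻ F, ∏ j, ∑ i : Fin n, (if F i = x j then (1 : ENNReal) else 0)
        ∂(Measure.pi fun _ : Fin n => ρ) ≤ ∏ j, (n * ρ {x j}) := by
  simp_rw [Finset.prod_univ_sum]
  rw [lintegral_finsetSum _ fun _ _ => .of_discrete]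
  have hterm : ∀ φ : J → Fin n, ∫⁻ F, ∏ j, (if F (φ j) = x j then (1 : ENNReal) else 0)
      ∂(Measure.pi fun _ : Fin n => ρ) ≤ ∏ j, ρ {x j} := fun φ => by
    by_cases hφ : Function.Injective φ
    · have h1 := lintegral_map (μ := Measure.pi fun _ : Fin n => ρ)
        (f := fun G : J → α => ∏ j, (if G j = x j then (1 : ENNReal) else 0))
        (g := fun F j => F (φ j)) .of_discrete .of_discrete
      rw [← h1, pi_map_comp_injective ρ φ hφ, ← Measure.pi_singleton (μ := fun _ : J => ρ) x,
        ← lintegral_indicator_one .of_discrete]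
      refine lintegral_mono fun G => ?_
      by_cases hG : G = x
      · simp [hG]
      · obtain ⟨j, hj⟩ := Function.ne_iff.1 hG
        rw [Finset.prod_eq_zero (Finset.mem_univ j) (if_neg hj)]
        exact bot_le
    · obtain ⟨j, j', hjj, hne⟩ : ∃ j j', φ j = φ j' ∧ j ≠ j' := by
        simpa [Function.Injective] using hφ
      have : ∀ F : Fin n → α, ∏ j, (if F (φ j) = x j then (1 : ENNReal) else 0) = 0 := fun F => by
        by_cases h : F (φ j) = x j
        · refine Finset.prod_eq_zero (Finset.mem_univ j') (if_neg fun h' => hne (hx ?_))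
          rw [← h, ← h', hjj]
        · exact Finset.prod_eq_zero (Finset.mem_univ j) (if_neg h)
      simp [this]
  refine (Finset.sum_le_sum fun φ _ => hterm φ).trans ?_
  rw [Finset.sum_const, Fintype.card_piFinset, Finset.prod_const, Finset.prod_mul_distrib,
    Finset.prod_const]
  simp

/-- The probability that two of `k` i.i.d. examples agree under `f`, in a value from `T`. -/
theorem measure_collision_le (ν : Measure α) [IsProbabilityMeasure ν] (f : α → β) (T : Set β)
    {r : ENNReal} (hr : ∀ b ∈ T, ν (f ⁻¹' {b}) ≤ r) (k : ℕ) :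
    (Measure.pi fun _ : Fin k => ν) {z | ∃ i j, i ≠ j ∧ f (z i) = f (z j) ∧ f (z j) ∈ T}
      ≤ k ^ 2 * r := by
  set E : Fin k × Fin k → Set (Fin k → α) :=
    fun ij => {z | ij.1 ≠ ij.2 ∧ f (z ij.1) = f (z ij.2) ∧ f (z ij.2) ∈ T} with hE
  have hsub : {z : Fin k → α | ∃ i j, i ≠ j ∧ f (z i) = f (z j) ∧ f (z j) ∈ T}
      ⊆ ⋃ ij ∈ (Finset.univ : Finset (Fin k × Fin k)), E ij := by
    rintro z ⟨i, j, h⟩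
    simp only [Finset.mem_univ, Set.iUnion_true, Set.mem_iUnion]
    exact ⟨(i, j), h⟩
  have hterm : ∀ ij, (Measure.pi fun _ : Fin k => ν) (E ij) ≤ r := fun ij => by
    by_cases hij : ij.1 = ij.2
    · have : E ij = ∅ := by ext; simp [hE, hij]
      simp [this]
    rw [← pi_map_update ν ij.1, Measure.map_apply .of_discrete .of_discrete,
      Measure.prod_apply .of_discrete]
    refine (lintegral_mono (g := fun _ => r) fun ω => ?_).trans (by simp)
    by_cases hT : f (ω ij.2) ∈ T
    · refine (measure_mono fun z hz => ?_).trans (hr _ hT)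
      have hz' := (hz : _ ∧ _ ∧ _).2.1
      simpa [Function.update_of_ne (Ne.symm hij)] using hz'
    · refine (measure_mono (t := ∅) fun z hz => ?_).trans (by simp)
      have hz' := (hz : _ ∧ _ ∧ _).2.2
      simp [Function.update_of_ne (Ne.symm hij)] at hz'
      exact hT hz'
  refine (measure_mono hsub).trans ((measure_biUnion_finset_le _ _).trans
    ((Finset.sum_le_sum fun ij _ => hterm ij).trans ?_))
  simp [sq]

end Occupancy

/-! ### Synthetic distributions and their competitors. -/

section Synthetic

variable {X : Type*} [MeasurableSpace X]

/-- The features are weighted by `W` on `F`, the labels drawn according to `p`. -/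
def synthMeasure (W : X → ℕ) (p : Predictor X) (F : Finset X) : Measure (X × Bool) :=
  (∑ x ∈ F, (W x : ENNReal))⁻¹ • ∑ x ∈ F, (W x : ENNReal) •
    (labelProb (p x) true • Measure.dirac (x, true) + labelProb (p x) false • Measure.dirac (x, false))

variable [DiscreteMeasurableSpace X]

theorem synthMeasure_singleton (W : X → ℕ) (p : Predictor X) (F : Finset X) (x : X) (b : Bool)
    (hx : x ∈ F) :
    synthMeasure W p F {(x, b)} = (∑ x ∈ F, (W x : ENNReal))⁻¹ * W x * labelProb (p x) b := by
  classical
  simp only [synthMeasure, Measure.smul_apply, Measure.finsetSum_apply, Measure.add_apply,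
    smul_eq_mul, mul_assoc]
  congr 1
  refine (Finset.sum_eq_single_of_mem x hx fun y _ hy => ?_).trans ?_
  · simp [hy]
  · cases b <;> simp

theorem synthMeasure_inGroup [DecidableEq X] (W : X → ℕ) (p : Predictor X) {F F' : Finset X}
    (h : F ⊆ F') :
    synthMeasure W p F' (inGroup F) = (∑ x ∈ F', (W x : ENNReal))⁻¹ * ∑ x ∈ F, (W x : ENNReal) := by
  simp only [synthMeasure, Measure.smul_apply, Measure.finsetSum_apply, Measure.add_apply,
    smul_eq_mul]
  congr 1
  rw [← Finset.inter_eq_right.2 h, ← Finset.filter_mem_eq_inter, Finset.sum_filter]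
  refine Finset.sum_congr rfl fun x _ => ?_
  by_cases hx : x ∈ F
  · simp [hx, inGroup, labelProb_add, Finset.inter_eq_right.2 h, Finset.filter_mem_eq_inter]
  · simp [hx, inGroup, Finset.inter_eq_right.2 h, Finset.filter_mem_eq_inter]

theorem synthMeasure_compl (W : X → ℕ) (p : Predictor X) (F : Finset X) (s : Set (X × Bool))
    (hs : ∀ z ∈ s, z.1 ∉ F) : synthMeasure W p F s = 0 := by
  simp only [synthMeasure, Measure.smul_apply, Measure.finsetSum_apply, Measure.add_apply,
    smul_eq_mul]
  refine mul_eq_zero_of_right _ (Finset.sum_eq_zero fun x hx => ?_)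
  have : ∀ b, (x, b) ∉ s := fun b hb => hs _ hb hx
  simp [this]

/-- `synthMeasure` as a distribution. -/
def synth (W : X → ℕ) (p : Predictor X) (F : Finset X) (h : 0 < ∑ x ∈ F, W x) : LabelledDist X :=
  ⟨synthMeasure W p F, by
    classical
    constructor
    have h1 : synthMeasure W p F Set.univ = synthMeasure W p F (inGroup F) := by
      refine le_antisymm ?_ (measure_mono (Set.subset_univ _))
      rw [← Set.union_compl_self (inGroup (F : Set X))]
      refine (measure_union_le _ _).trans ?_
      rw [synthMeasure_compl W p F (inGroup (F : Set X))ᶜ fun z hz => hz, add_zero]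
    rw [h1, synthMeasure_inGroup W p subset_rfl, ENNReal.inv_mul_cancel]
    · exact_mod_cast h.ne'
    · exact_mod_cast ENNReal.natCast_ne_top _⟩

variable [Countable X]

/-- The normalising constants cancel. Hence the synthetic distributions on all subsets of a window
are group restrictions of a single one. -/
theorem restrictTo_synth (W : X → ℕ) (p : Predictor X) {F F' : Finset X} (hF : F ⊆ F')
    (h : 0 < ∑ x ∈ F, W x) (h' : 0 < ∑ x ∈ F', W x) :
    ∃ hg : 0 < groupMass (synth W p F' h') F, restrictTo (synth W p F' h') F hg = synth W p F h := by
  classical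
  have hS0 : (∑ x ∈ F, (W x : ENNReal)) ≠ 0 := by exact_mod_cast h.ne'
  have hS0' : (∑ x ∈ F', (W x : ENNReal)) ≠ 0 := by exact_mod_cast h'.ne'
  have hT : (∑ x ∈ F, (W x : ENNReal)) ≠ ⊤ := by exact_mod_cast ENNReal.natCast_ne_top _
  have hT' : (∑ x ∈ F', (W x : ENNReal)) ≠ ⊤ := by exact_mod_cast ENNReal.natCast_ne_top _
  have hm : synthMeasure W p F' (inGroup F)
      = (∑ x ∈ F', (W x : ENNReal))⁻¹ * ∑ x ∈ F, (W x : ENNReal) := synthMeasure_inGroup W p hF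
  have hm0 : synthMeasure W p F' (inGroup F) ≠ 0 := by
    rw [hm]; exact mul_ne_zero (ENNReal.inv_ne_zero.2 hT') hS0
  refine ⟨ENNReal.toReal_pos hm0 ?_, Subtype.ext (Measure.ext_of_singleton fun ⟨x, b⟩ => ?_)⟩
  · change synthMeasure W p F' (inGroup F) ≠ ⊤
    rw [hm]; exact ENNReal.mul_ne_top (ENNReal.inv_ne_top.2 hS0') hT
  · change ((synthMeasure W p F')[|inGroup F]) {(x, b)} = synthMeasure W p F {(x, b)}
    rw [cond_apply .of_discrete]
    by_cases hx : x ∈ F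
    · rw [Set.inter_eq_right.2 (by simpa [inGroup] using hx), synthMeasure_singleton _ _ _ _ _ hx,
        synthMeasure_singleton _ _ _ _ _ (hF hx), hm, ENNReal.mul_inv (.inl (by simp [hT']))
        (.inl (by simp [hS0'])), inv_inv]
      calc (∑ x ∈ F', (W x : ENNReal)) * (∑ x ∈ F, (W x : ENNReal))⁻¹ *
            ((∑ x ∈ F', (W x : ENNReal))⁻¹ * W x * labelProb (p x) b)
          = ((∑ x ∈ F', (W x : ENNReal)) * (∑ x ∈ F', (W x : ENNReal))⁻¹) *
            ((∑ x ∈ F, (W x : ENNReal))⁻¹ * W x * labelProb (p x) b) := by ring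
        _ = _ := by rw [ENNReal.mul_inv_cancel hS0' hT', one_mul]
    · rw [Set.inter_singleton_eq_empty.2 (by simpa [inGroup] using hx), measure_empty, mul_zero,
        synthMeasure_compl]
      rintro z rfl; exact hx

/-- By compatibility, one predictor competes on all restrictions of a synthetic distribution. -/
theorem exists_competitive_synth {L : Loss X} (hL : L.MultiPACCompatible) (H : Finset (Predictor X))
    {e : ℝ} (he : 0 < e) (W : X → ℕ) (p : Predictor X) (F' : Finset X) :
    ∃ h₀ : Predictor X, ∀ F ⊆ F', ∀ h : 0 < ∑ x ∈ F, W x, L.Competitive (synth W p F h) H e h₀ := by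
  classical
  by_cases h' : 0 < ∑ x ∈ F', W x
  -- All subsets of `F'` serve as groups at once: compatibility does not charge for their number.
  · obtain ⟨h₀, hh₀⟩ := hL (synth W p F' h') H (F'.powerset.image (fun F : Finset X => (↑F : Set X))) e he
    refine ⟨h₀, fun F hF h => ?_⟩
    obtain ⟨hg, e⟩ := restrictTo_synth W p hF h h'
    rw [← e]
    exact hh₀ _ (Finset.mem_image_of_mem (fun F : Finset X => (↑F : Set X)) (Finset.mem_powerset.2 hF)) hg
  · refine ⟨fun _ => 0, fun F hF h => absurd (h.trans_le ?_) h'⟩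
    exact Finset.sum_le_sum_of_subset hF

end Synthetic

end MultiGroup

/-! ### From synthetic distributions to the relabelled distribution. -/

namespace MultiGroup

variable {X : Type*} [MeasurableSpace X] [DiscreteMeasurableSpace X]

open Classical in
/-- The unnormalised weight of `x` in a synthetic distribution that consists of the atoms in `A ∩ g`
and of the points `F i`, each of weight `R`. -/
def slotWeight (W : X → ℕ) (A : Finset X) (g : Set X) (R : ℕ) {n : ℕ} (F : Fin n → X) (x : X) :
    ENNReal :=
  if x ∈ A then (if x ∈ g then (W x : ENNReal) else 0)
  else R * ∑ i, if F i = x then 1 else 0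

-- Points repeated in `F` are overcounted on the right. Only this direction is needed, and a sum
-- over slots is what can be averaged over random `F`.
open Classical in
theorem synthMeasure_singleton_le_slotWeight {W : X → ℕ} (p : Predictor X) {A : Finset X}
    {g : Set X} {R n : ℕ} (hR : ∀ x ∉ A, W x = R) {F : Fin n → X} (hF : ∀ i, F i ∉ A)
    (z : X × Bool) :
    synthMeasure W p (A.filter (· ∈ g) ∪ Finset.univ.image F) {z}
      ≤ (∑ x ∈ A.filter (· ∈ g) ∪ Finset.univ.image F, (W x : ENNReal))⁻¹ * slotWeight W A g R F z.1
        * labelProb (p z.1) z.2 := by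
  obtain ⟨x, b⟩ := z
  by_cases hx : x ∈ A.filter (· ∈ g) ∪ Finset.univ.image F
  · rw [synthMeasure_singleton _ _ _ _ _ hx]
    gcongr
    rcases Finset.mem_union.1 hx with h | h
    · rw [Finset.mem_filter] at h
      simp [slotWeight, h]
    · obtain ⟨i, -, rfl⟩ := Finset.mem_image.1 h
      rw [slotWeight, if_neg (hF i), hR _ (hF i)]
      refine le_mul_of_one_le_right' ?_
      refine le_trans ?_ (Finset.single_le_sum (f := fun j => if F j = F i then (1 : ENNReal) else 0)
        (fun _ _ => bot_le) (Finset.mem_univ i))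
      simp
  · rw [synthMeasure_compl]
    · exact bot_le
    · rintro z rfl; exact hx

variable [Countable X]

-- Atoms contribute factors that do not depend on `F`; the points off `A` are distinct by `hx`, so
-- the occupancy bound applies to them.
open Classical in
theorem lintegral_prod_slotWeight_le {W : X → ℕ} {A : Finset X} {g : Set X} {R n k : ℕ}
    {M : X → ENNReal} (hA : ∀ x ∈ A, x ∈ g → (W x : ENNReal) ≤ M x)
    (ρ : Measure X) [IsProbabilityMeasure ρ] (hρ : ∀ x ∉ A, R * (n * ρ {x}) ≤ M x) {x : Fin k → X}
    (hx : ∀ i j, i ≠ j → x i = x j → x j ∈ A) :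
    ∫⁻ F, ∏ j, slotWeight W A g R F (x j) ∂(Measure.pi fun _ : Fin n => ρ) ≤ ∏ j, M (x j) := by
  have hsplit : ∀ F : Fin n → X, ∏ j, slotWeight W A g R F (x j)
      = (∏ j : {j // x j ∈ A}, if x j ∈ g then (W (x j) : ENNReal) else 0) *
        ((∏ _j : {j // x j ∉ A}, (R : ENNReal)) *
          ∏ j : {j // x j ∉ A}, ∑ i, if F i = x j then 1 else 0) := fun F => by
    rw [← Fintype.prod_subtype_mul_prod_subtype (fun j => x j ∈ A), ← Finset.prod_mul_distrib]
    congr 1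
    · exact Finset.prod_congr rfl fun j _ => by simp [slotWeight, j.2]
    · exact Finset.prod_congr rfl fun j _ => by simp [slotWeight, j.2]
  have hinj : Function.Injective fun j : {j // x j ∉ A} => x j := fun i j hij => by
    by_contra hne
    exact j.2 (hx i j (fun h => hne (Subtype.ext h)) hij)
  simp_rw [hsplit]
  rw [lintegral_const_mul _ .of_discrete, lintegral_const_mul _ .of_discrete,
    ← Fintype.prod_subtype_mul_prod_subtype (fun j => x j ∈ A)]
  refine mul_le_mul' (Finset.prod_le_prod' fun j _ => ?_) ?_
  · split_ifs with h
    · exact hA _ j.2 h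
    · exact bot_le
  · refine (mul_le_mul_right (lintegral_prod_sum_indicator_le ρ n hinj) _).trans ?_
    rw [← Finset.prod_mul_distrib]
    exact Finset.prod_le_prod' fun j _ => hρ _ j.2

theorem cond_inGroup_mul_eq (μ : Measure (X × Bool)) [IsProbabilityMeasure μ] {g : Set X}
    (hg : μ (inGroup g) ≠ 0) {x : X} (hx : x ∈ g) :
    μ (inGroup g) * μ[|inGroup g] (inGroup {x}) = μ (inGroup {x}) := by
  rw [cond_apply .of_discrete, ← mul_assoc, ENNReal.mul_inv_cancel hg (by finiteness), one_mul]
  congr 1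
  refine Set.inter_eq_right.2 fun z hz => ?_
  have : z.1 = x := hz
  simpa [inGroup, this] using hx

open Classical in
/-- A test that is large on average over each of the synthetic distributions consisting of the atoms
`A ∩ g` and a set of `n` points, is large on average over `μ` conditioned on `g` and relabelled. -/
theorem measure_mul_le_lintegral_relabel (μ : Measure (X × Bool)) [IsProbabilityMeasure μ]
    {g : Set X} (hg : μ (inGroup g) ≠ 0) {W : X → ℕ} (p : Predictor X) {A : Finset X} {R n K k : ℕ}
    (hA : ∀ x ∈ A, (W x : ENNReal) ≤ K * μ (inGroup {x})) (hR : ∀ x ∉ A, W x = R)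
    (ρ : Measure X) [IsProbabilityMeasure ρ]
    (hρ : ∀ x ∉ A, R * (n * ρ {x}) ≤ if x ∈ g then K * μ (inGroup {x}) else 0)
    {good : Set (Fin n → X)} (hgood : ∀ F ∈ good, Function.Injective F ∧ ∀ i, F i ∉ A)
    {t : ℕ} (ht : t = ∑ x ∈ A.filter (· ∈ g), W x + n * R) (ht0 : 0 < t)
    {ψ : (Fin k → X × Bool) → ENNReal} (hψ : ∀ z, ψ z ≤ 2) {v : ENNReal}
    (hv : ∀ F ∈ good, v ≤ ∫⁻ z, ψ z
      ∂(Measure.pi fun _ : Fin k => synthMeasure W p (A.filter (· ∈ g) ∪ Finset.univ.image F))) :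
    (Measure.pi fun _ : Fin n => ρ) good * v
      ≤ ((t : ENNReal)⁻¹ * (K * μ (inGroup g))) ^ k *
        ∫⁻ z, ψ z ∂(Measure.pi fun _ : Fin k => relabel (μ[|inGroup g]) p)
        + 2 * (k ^ 2 * ((t : ENNReal)⁻¹ * R)) := by
  set ν := μ[|inGroup g] with hν
  have : IsProbabilityMeasure ν := cond_isProbabilityMeasure hg
  set M : X → ENNReal := fun x => if x ∈ g then K * μ (inGroup {x}) else 0 with hM
  -- The tuples without a repeated point off `A`. Only for these does averaging over `F` give a
  -- product bound; the others are unlikely, since such a point has weight at most `R` out of `t`.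
  set NR : Set (Fin k → X × Bool) :=
    {z | ∃ i j, i ≠ j ∧ (z i).1 = (z j).1 ∧ (z j).1 ∈ {x | x ∉ A}}ᶜ with hNR
  set B : ENNReal := 2 * (k ^ 2 * ((t : ENNReal)⁻¹ * R)) with hB
  set G : (Fin n → X) → (Fin k → X × Bool) → ENNReal := fun F z =>
    NR.indicator ψ z * ((∏ j, ((t : ENNReal)⁻¹ * labelProb (p (z j).1) (z j).2)) *
      ∏ j, slotWeight W A g R F (z j).1) with hG
  have hstep : ∀ F ∈ good, v ≤ ∑' z, G F z + B := fun F hF => by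
    obtain ⟨hinj, hFA⟩ := hgood F hF
    have hdisj : Disjoint (A.filter (· ∈ g)) (Finset.univ.image F) := by
      rw [Finset.disjoint_left]
      intro x hx hx'
      obtain ⟨i, -, rfl⟩ := Finset.mem_image.1 hx'
      exact hFA i (Finset.mem_filter.1 hx).1
    have hsum : ∑ x ∈ A.filter (· ∈ g) ∪ Finset.univ.image F, W x = t := by
      rw [Finset.sum_union hdisj, Finset.sum_image hinj.injOn, ht]
      congr 1
      simp [hR _ (hFA _)]
    have hsum' : ∑ x ∈ A.filter (· ∈ g) ∪ Finset.univ.image F, (W x : ENNReal) = t := by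
      exact_mod_cast congrArg (Nat.cast : ℕ → ENNReal) hsum
    set σ := synthMeasure W p (A.filter (· ∈ g) ∪ Finset.univ.image F) with hσ
    have hprob : IsProbabilityMeasure σ :=
      (synth W p (A.filter (· ∈ g) ∪ Finset.univ.image F) (by rwa [hsum])).2
    have hpt : ∀ z, σ {z} ≤ (t : ENNReal)⁻¹ * slotWeight W A g R F z.1 * labelProb (p z.1) z.2 :=
      fun z => hsum' ▸ synthMeasure_singleton_le_slotWeight p hR hFA z
    have hlight : ∀ x ∈ {x | x ∉ A}, σ (Prod.fst ⁻¹' {x}) ≤ (t : ENNReal)⁻¹ * R := fun x hx => by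
      by_cases hx' : x ∈ A.filter (· ∈ g) ∪ Finset.univ.image F
      · have h1 := synthMeasure_inGroup W p (Finset.singleton_subset_iff.2 hx')
        rw [hsum', Finset.sum_singleton, hR x hx, Finset.coe_singleton] at h1
        exact h1.le
      · rw [hσ, synthMeasure_compl]
        · exact bot_le
        · rintro z rfl; exact hx'
    have hcoll := measure_collision_le σ Prod.fst {x | x ∉ A} hlight k
    refine (hv F hF).trans ?_
    rw [← lintegral_add_compl ψ (MeasurableSet.of_discrete (s := NR))]
    refine add_le_add ?_ ?_
    · rw [← lintegral_indicator .of_discrete, lintegral_countable']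
      refine ENNReal.tsum_le_tsum fun z => ?_
      simp only [hG, Measure.pi_singleton]
      rw [← Finset.prod_mul_distrib]
      refine mul_le_mul_right (Finset.prod_le_prod' fun j _ => (hpt (z j)).trans (le_of_eq ?_)) _
      ring
    · calc ∫⁻ z in NRᶜ, ψ z ∂(Measure.pi fun _ : Fin k => σ)
          ≤ ∫⁻ z in NRᶜ, 2 ∂(Measure.pi fun _ : Fin k => σ) := lintegral_mono hψ
        _ = 2 * (Measure.pi fun _ : Fin k => σ) NRᶜ := by simp
        _ ≤ B := by
          rw [hB, hNR, compl_compl]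
          gcongr
  -- Averaged over `F`, the slot weights are at most `K * μ` on `g`; together with the label factors
  -- this is the density of the relabelled conditional law up to a constant per example.
  have hexp : ∀ z, ∫⁻ F, G F z ∂(Measure.pi fun _ : Fin n => ρ)
      ≤ ψ z * ∏ j, ((t : ENNReal)⁻¹ * (K * μ (inGroup g)) * relabel ν p {z j}) := fun z => by
    simp only [hG]
    rw [lintegral_const_mul _ .of_discrete, lintegral_const_mul _ .of_discrete]
    by_cases hz : z ∈ NR
    · rw [Set.indicator_of_mem hz]
      refine mul_le_mul_right ?_ _
      have hx : ∀ i j, i ≠ j → (z i).1 = (z j).1 → (z j).1 ∈ A := fun i j hij he => by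
        by_contra h
        exact hz ⟨i, j, hij, he, h⟩
      refine (mul_le_mul_right (lintegral_prod_slotWeight_le (M := M)
        (fun x hx hxg => by simpa [hM, hxg] using hA x hx) ρ hρ hx) _).trans (le_of_eq ?_)
      rw [← Finset.prod_mul_distrib]
      refine Finset.prod_congr rfl fun j _ => ?_
      have hr := relabel_singleton ν p (z j).1 (z j).2
      rw [Prod.mk.eta] at hr
      rw [hr]
      by_cases hxg : (z j).1 ∈ g
      · simp only [hM, if_pos hxg]
        rw [← cond_inGroup_mul_eq μ hg hxg]
        ring
      · have h0 : ν (inGroup {(z j).1}) = 0 := by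
          rw [hν, cond_apply .of_discrete]
          have : inGroup g ∩ inGroup {(z j).1} = (∅ : Set (X × Bool)) := by
            ext z'
            simp only [inGroup, Set.mem_inter_iff, Set.mem_preimage, Set.mem_singleton_iff,
              Set.mem_empty_iff_false, iff_false, not_and]
            exact fun h h' => hxg (h' ▸ h)
          rw [this, measure_empty, mul_zero]
        simp [hM, hxg, h0]
    · rw [Set.indicator_of_notMem hz, zero_mul]
      exact bot_le
  calc (Measure.pi fun _ : Fin n => ρ) good * v
      = ∫⁻ _ in good, v ∂(Measure.pi fun _ : Fin n => ρ) := by simp [mul_comm]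
    _ ≤ ∫⁻ F in good, (∑' z, G F z + B) ∂(Measure.pi fun _ : Fin n => ρ) :=
        setLIntegral_mono .of_discrete hstep
    _ ≤ ∫⁻ F, (∑' z, G F z + B) ∂(Measure.pi fun _ : Fin n => ρ) := setLIntegral_le_lintegral _ _
    _ = ∑' z, ∫⁻ F, G F z ∂(Measure.pi fun _ : Fin n => ρ) + B := by
        rw [lintegral_add_right _ measurable_const, lintegral_tsum fun _ =>
          (Measurable.of_discrete).aemeasurable]
        simp
    _ ≤ ∑' z, ψ z * ∏ j, ((t : ENNReal)⁻¹ * (K * μ (inGroup g)) * relabel ν p {z j}) + B := by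
        gcongr with z
        exact hexp z
    _ = _ := by
        congr 1
        rw [lintegral_countable', ← ENNReal.tsum_mul_left]
        refine tsum_congr fun z => ?_
        rw [Finset.prod_mul_distrib, Measure.pi_singleton]
        simp
        ring

end MultiGroup

namespace MultiGroup

variable {X : Type*} [MeasurableSpace X] [DiscreteMeasurableSpace X] [Countable X]

/-- Sampling `⌊N · μ(B)⌋` points from a set `B` of light points, without collision. -/
theorem exists_light_sample (μ : Measure (X × Bool)) [IsProbabilityMeasure μ] (B : Set X) (N R : ℕ)
    {θ : ℝ} (hθ : 0 ≤ θ) (hlight : ∀ x ∈ B, μ.real (inGroup {x}) ≤ θ) {n : ℕ}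
    (hn : n = ⌊N * μ.real (inGroup B)⌋₊) :
    ∃ ρ : Measure X, IsProbabilityMeasure ρ ∧
      (∀ x, (R : ENNReal) * (n * ρ {x}) ≤ ((N * R : ℕ) : ENNReal) * μ (inGroup {x})) ∧
      (∀ x ∉ B, (n : ENNReal) * ρ {x} = 0) ∧
      1 - N ^ 2 * θ ≤ (Measure.pi fun _ : Fin n => ρ).real
        {F | Function.Injective F ∧ ∀ i, F i ∈ B} := by
  -- With nothing to draw, `B` may be null and conditioning on it meaningless, so an arbitrary law
  -- is used.
  rcases Nat.eq_zero_or_pos n with h0 | hpos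
  · obtain ⟨x₀⟩ : Nonempty X := by
      obtain ⟨z⟩ : Nonempty (X × Bool) := nonempty_of_isProbabilityMeasure μ
      exact ⟨z.1⟩
    clear hn
    subst h0
    refine ⟨Measure.dirac x₀, inferInstance, by simp, by simp, ?_⟩
    have : {F : Fin 0 → X | Function.Injective F ∧ ∀ i, F i ∈ B} = Set.univ := by
      ext F; simp [Function.injective_of_subsingleton]
    rw [this]
    simp
    positivity
  set lam := μ.real (inGroup B) with hlam
  have hnle : (n : ℝ) ≤ N * lam := hn ▸ Nat.floor_le (by positivity)
  have hn1 : (0 : ℝ) < n := by exact_mod_cast hpos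
  have hlam0 : 0 < lam := by
    by_contra h
    have : lam = 0 := le_antisymm (not_lt.1 h) measureReal_nonneg
    rw [this, mul_zero] at hnle
    linarith
  have hlam1 : lam ≤ 1 := measureReal_le_one
  have hlE : μ (inGroup B) = ENNReal.ofReal lam := by
    rw [hlam, measureReal_def, ENNReal.ofReal_toReal (by finiteness)]
  have hl0 : μ (inGroup B) ≠ 0 := by
    rw [hlE]; simpa using hlam0
  have hmap : ∀ s : Set X, (μ.map Prod.fst) s = μ (inGroup s) := fun s =>
    Measure.map_apply .of_discrete .of_discrete
  set ρ := (μ.map Prod.fst)[|B] with hρ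
  have hprob0 : IsProbabilityMeasure (μ.map Prod.fst) :=
    Measure.isProbabilityMeasure_map (Measurable.of_discrete).aemeasurable
  have hprob : IsProbabilityMeasure ρ := cond_isProbabilityMeasure (by rwa [hmap])
  have hin : ∀ x ∈ B, ρ {x} = (μ (inGroup B))⁻¹ * μ (inGroup {x}) := fun x hx => by
    rw [hρ, cond_apply .of_discrete, hmap, Set.inter_eq_right.2 (Set.singleton_subset_iff.2 hx),
      hmap]
  have hout : ∀ x ∉ B, ρ {x} = 0 := fun x hx => by
    rw [hρ, cond_apply .of_discrete, Set.inter_singleton_eq_empty.2 hx, measure_empty, mul_zero]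
  refine ⟨ρ, hprob, fun x => ?_, fun x hx => by rw [hout x hx, mul_zero], ?_⟩
  · by_cases hx : x ∈ B
    · have h1 : (n : ENNReal) ≤ N * μ (inGroup B) := by
        rw [hlE, ← ENNReal.ofReal_natCast, ← ENNReal.ofReal_natCast, ← ENNReal.ofReal_mul (by simp)]
        exact ENNReal.ofReal_le_ofReal hnle
      calc (R : ENNReal) * (n * ρ {x})
          ≤ R * (N * μ (inGroup B) * ((μ (inGroup B))⁻¹ * μ (inGroup {x}))) := by
            rw [hin x hx]; gcongr
        _ = (μ (inGroup B) * (μ (inGroup B))⁻¹) * (N * R * μ (inGroup {x})) := by ring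
        _ = _ := by
          rw [ENNReal.mul_inv_cancel hl0 (by finiteness), one_mul]; push_cast; ring
    · simp [hout x hx]
  · set π := Measure.pi fun _ : Fin n => ρ
    set E₁ : Set (Fin n → X) := {F | ∃ i j, i ≠ j ∧ id (F i) = id (F j) ∧ id (F j) ∈ Set.univ}
    set E₂ : Set (Fin n → X) := ⋃ i : Fin n, {F | F i ∈ Bᶜ}
    have hsub : {F : Fin n → X | Function.Injective F ∧ ∀ i, F i ∈ B}ᶜ ⊆ E₁ ∪ E₂ := by
      intro F hF
      by_cases h : ∀ i, F i ∈ B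
      · left
        have : ¬ Function.Injective F := fun h' => hF ⟨h', h⟩
        obtain ⟨i, j, hij, hne⟩ : ∃ i j, F i = F j ∧ i ≠ j := by
          simpa [Function.Injective] using this
        exact ⟨i, j, hne, hij, Set.mem_univ _⟩
      · right
        push Not at h
        obtain ⟨i, hi⟩ := h
        exact Set.mem_iUnion.2 ⟨i, hi⟩
    have h2 : π E₂ = 0 := by
      refine measure_iUnion_null fun i => ?_
      have h := (measurePreserving_eval (fun _ : Fin n => ρ) i).measure_preimage
        (MeasurableSet.of_discrete (s := Bᶜ)).nullMeasurableSet
      change π (Function.eval i ⁻¹' Bᶜ) = 0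
      rw [h, hρ, cond_apply .of_discrete, Set.inter_compl_self, measure_empty, mul_zero]
    have h1 : π E₁ ≤ ENNReal.ofReal (N ^ 2 * θ) := by
      refine (measure_collision_le ρ id Set.univ (r := ENNReal.ofReal (θ / lam)) (fun x _ => ?_)
        n).trans ?_
      · rw [Set.preimage_id]
        by_cases hx : x ∈ B
        · rw [hin x hx, hlE, ← ENNReal.ofReal_inv_of_pos hlam0,
            ← ENNReal.ofReal_toReal (a := μ (inGroup {x})) (by finiteness),
            ← ENNReal.ofReal_mul (by positivity)]
          refine ENNReal.ofReal_le_ofReal ?_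
          rw [div_eq_inv_mul]
          exact mul_le_mul_of_nonneg_left (hlight x hx) (by positivity)
        · simp [hout x hx]
      · rw [← ENNReal.ofReal_natCast, ← ENNReal.ofReal_pow (by simp),
          ← ENNReal.ofReal_mul (by positivity)]
        refine ENNReal.ofReal_le_ofReal ?_
        -- Conditioning on `B` inflates each mass by `1 / lam`, while the number of pairs carries
        -- `lam ^ 2`.
        calc (n : ℝ) ^ 2 * (θ / lam) ≤ (N * lam) ^ 2 * (θ / lam) := by gcongr
          _ = N ^ 2 * θ * lam := by field_simp
          _ ≤ N ^ 2 * θ * 1 := by gcongr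
          _ = N ^ 2 * θ := mul_one _
    have h3 : π.real {F : Fin n → X | Function.Injective F ∧ ∀ i, F i ∈ B}ᶜ ≤ N ^ 2 * θ :=
      ENNReal.toReal_le_of_le_ofReal (by positivity)
        ((measure_mono hsub).trans ((measure_union_le _ _).trans (by rw [h2, add_zero]; exact h1)))
    rw [probReal_compl_eq_one_sub .of_discrete] at h3
    linarith

open Classical in
/-- A predictor that competes on synthetic distributions with the right weights on a set `A` of
atoms, and constant weights outside of it, competes on the relabelled distribution, if the points
outside of `A` are light. -/
theorem avgRisk_relabel_le_of_competitive_synth {L : Loss X} {k : ℕ} {e : ℝ}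
    (he : e ∈ Set.Ioc (0 : ℝ) (1 / 2))
    (hU : ∀ (D : LabelledDist X) (h : Predictor X), |avgRisk L h k D - L.risk D h| ≤ 2 * e)
    (μ : Measure (X × Bool)) [IsProbabilityMeasure μ] {g : Set X} {γ : ℝ} (hγ : 0 < γ)
    (hg : γ ≤ μ.real (inGroup g)) {A XM : Finset X} (hAX : A ⊆ XM) {N R : ℕ} (hN : 0 < N)
    (hR0 : 0 < R) {W : X → ℕ}
    (hA : ∀ x ∈ A, (W x : ℝ) ≤ (N * R : ℕ) * μ.real (inGroup {x}) ∧
      (N * R : ℕ) * μ.real (inGroup {x}) - 1 ≤ W x)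
    (hR : ∀ x ∉ A, W x = R) {θ τ : ℝ} (hθ : 0 ≤ θ) (hlight : ∀ x ∉ A, μ.real (inGroup {x}) ≤ θ)
    (htail : μ.real (inGroup (XM : Set X)ᶜ) ≤ τ) (hNθ : N ^ 2 * θ ≤ e)
    (hη : (k + 1) * ((τ + A.card / (N * R : ℕ) + 1 / N) / γ) ≤ e)
    (hcoll : 4 * (k + 1) ^ 2 / (N * γ) ≤ e) {p : Predictor X} {H : Finset (Predictor X)}
    {h₀ : Predictor X}
    (hh₀ : ∀ F ⊆ XM, ∀ hF : 0 < ∑ x ∈ F, W x, L.Competitive (synth W p F hF) H e h₀)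
    {h : Predictor X} (hh : h ∈ H) :
    avgRisk L h₀ k (relabel (μ[|inGroup g]) p)
      ≤ avgRisk L h k (relabel (μ[|inGroup g]) p) + 8 * e := by
  obtain ⟨he0, he1⟩ := he
  set q := μ.real (inGroup g) with hq
  have hq0 : 0 < q := hγ.trans_le hg
  have hgne : μ (inGroup g) ≠ 0 := fun h0 => by simp [hq, measureReal_def, h0] at hq0
  have hν : IsProbabilityMeasure (μ[|inGroup g]) := cond_isProbabilityMeasure hgne
  have hτ0 : 0 ≤ τ := measureReal_nonneg.trans htail
  set K := N * R with hK
  have hK0 : (0 : ℝ) < K := by rw [hK]; push_cast; positivity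
  have hN0 : (0 : ℝ) < N := by exact_mod_cast hN
  set B : Set X := g ∩ (XM \ A : Set X) with hB
  set n := ⌊N * μ.real (inGroup B)⌋₊ with hn
  obtain ⟨ρ, hρ, hρ1, hρ2, hρ3⟩ := exists_light_sample μ B N R hθ
    (fun x hx => hlight x hx.2.2) hn
  set good : Set (Fin n → X) := {F | Function.Injective F ∧ ∀ i, F i ∈ B} with hgood
  set t := ∑ x ∈ A.filter (· ∈ g), W x + n * R with ht
  set η := (τ + A.card / (K : ℝ) + 1 / N) / γ with hη'
  have hη0 : 0 ≤ η := by positivity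
  have hηe : η ≤ e := le_trans (by nlinarith [(Nat.cast_nonneg k : (0 : ℝ) ≤ k)]) hη
  -- The total weight falls short of `K * q` by at most the unseen tail `K * τ`, one unit for
  -- rounding each atom, and `R` for rounding `n`; `η` is this loss relative to `K * γ`.
  have htK : K * q * (1 - η) ≤ t := by
    have hsplit : q ≤ μ.real (inGroup ((A.filter (· ∈ g) : Finset X) : Set X))
        + μ.real (inGroup B) + τ := by
      have hsub : (inGroup g : Set (X × Bool)) ⊆
          (inGroup ((A.filter (· ∈ g) : Finset X) : Set X) ∪ inGroup B)
            ∪ inGroup (XM : Set X)ᶜ := by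
        intro z hz
        have hz' : z.1 ∈ g := hz
        by_cases h1 : z.1 ∈ A
        · left; left
          simpa [inGroup] using ⟨h1, hz'⟩
        · by_cases h2 : z.1 ∈ XM
          · left; right; exact ⟨hz', h2, h1⟩
          · right; simpa [inGroup] using h2
      refine (measureReal_mono hsub).trans ((measureReal_union_le _ _).trans
        (add_le_add (measureReal_union_le _ _) htail))
    have hsumA : μ.real (inGroup ((A.filter (· ∈ g) : Finset X) : Set X))
        ≤ ∑ x ∈ A.filter (· ∈ g), μ.real (inGroup {x}) := by
      have : (inGroup ((A.filter (· ∈ g) : Finset X) : Set X) : Set (X × Bool))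
          ⊆ ⋃ x ∈ A.filter (· ∈ g), inGroup {x} := fun z hz => by
        simp only [Set.mem_iUnion]
        exact ⟨z.1, hz, rfl⟩
      exact (measureReal_mono this (measure_ne_top _ _)).trans (measureReal_biUnion_finset_le _ _)
    have hWA : (K : ℝ) * ∑ x ∈ A.filter (· ∈ g), μ.real (inGroup {x}) - A.card
        ≤ ∑ x ∈ A.filter (· ∈ g), (W x : ℝ) := by
      have h1 : ∑ x ∈ A.filter (· ∈ g), (K * μ.real (inGroup {x}) - 1)
          ≤ ∑ x ∈ A.filter (· ∈ g), (W x : ℝ) :=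
        Finset.sum_le_sum fun x hx => (hA x (Finset.mem_filter.1 hx).1).2
      rw [Finset.sum_sub_distrib, ← Finset.mul_sum, Finset.sum_const, nsmul_eq_mul, mul_one] at h1
      have h2 : ((A.filter (· ∈ g)).card : ℝ) ≤ A.card := by
        exact_mod_cast Finset.card_filter_le _ _
      linarith
    have hfl : N * μ.real (inGroup B) - 1 ≤ n := (Nat.sub_one_lt_floor _).le
    have hηγ : K * γ * η = K * τ + A.card + R := by
      rw [hη', hK]; push_cast; field_simp
    have hηq : K * γ * η ≤ K * q * η := by gcongr
    have hKR : (K : ℝ) = N * R := by rw [hK]; push_cast; ring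
    rw [ht]
    push_cast
    have h3 : (N * μ.real (inGroup B) - 1) * R ≤ n * R := by gcongr
    have h4 := mul_le_mul_of_nonneg_left hsplit hK0.le
    have h5 := mul_le_mul_of_nonneg_left hsumA hK0.le
    have h6 : (N * μ.real (inGroup B) - 1) * R = K * μ.real (inGroup B) - R := by rw [hKR]; ring
    linarith
  have h1η : 1 / 2 ≤ 1 - η := by linarith
  have ht0 : (0 : ℝ) < t := lt_of_lt_of_le (by positivity) htK
  -- The summand `1` keeps the test nonnegative, as the one-sided comparison of densities requires.
  -- A lower bound on its mean is an upper bound on the regret of `h₀`.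
  set f : (Fin (k + 1) → X × Bool) → ℝ :=
    fun S => 1 - L.risk (empirical S) h₀ + L.risk (empirical S) h with hf
  have hf0 : ∀ S, f S ∈ Set.Icc (0 : ℝ) 2 := fun S => by
    have h1 := risk_mem_Icc L (empirical S) h₀
    have h2 := risk_mem_Icc L (empirical S) h
    constructor <;> simp only [hf] <;> linarith [h1.1, h1.2, h2.1, h2.2]
  have hint : ∀ (σ : Measure (X × Bool)) [IsProbabilityMeasure σ],
      ∫ S, f S ∂(Measure.pi fun _ : Fin (k + 1) => σ) = 1 - avgRisk L h₀ k σ + avgRisk L h k σ := by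
    intro σ _
    have i1 : ∀ h : Predictor X, Integrable (fun S : Fin (k + 1) → X × Bool =>
        L.risk (empirical S) h) (Measure.pi fun _ : Fin (k + 1) => σ) :=
      fun h => integrable_of_mem_Icc_of_discrete _ fun S => risk_mem_Icc L (empirical S) h
    have i2 : Integrable (fun S : Fin (k + 1) → X × Bool => 1 - L.risk (empirical S) h₀)
        (Measure.pi fun _ : Fin (k + 1) => σ) := (integrable_const _).sub (i1 h₀)
    simp only [hf]
    rw [integral_add i2 (i1 h),
      integral_sub (integrable_const _) (i1 h₀)]
    simp [avgRisk]
  have hlint : ∀ (σ : Measure (X × Bool)) [IsProbabilityMeasure σ],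
      ∫⁻ S, ENNReal.ofReal (f S) ∂(Measure.pi fun _ : Fin (k + 1) => σ)
        = ENNReal.ofReal (1 - avgRisk L h₀ k σ + avgRisk L h k σ) := by
    intro σ _
    rw [← hint σ, ofReal_integral_eq_lintegral_ofReal
      (integrable_of_mem_Icc_of_discrete _ hf0) (.of_forall fun S => (hf0 S).1)]
  have key := measure_mul_le_lintegral_relabel μ hgne p (A := A) (W := W) (R := R) (n := n) (K := K)
    (k := k + 1) (fun x hx => by
      rw [← ENNReal.ofReal_natCast, ← ENNReal.ofReal_natCast,
        ← ENNReal.ofReal_toReal (a := μ _) (by finiteness), ← ENNReal.ofReal_mul (by positivity)]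
      exact ENNReal.ofReal_le_ofReal (hA x hx).1) hR ρ (fun x hx => by
        split_ifs with hxg
        · exact hρ1 x
        · rw [hρ2 x fun hB => hxg hB.1, mul_zero]) (good := good)
    (fun F hF => ⟨hF.1, fun i => (hF.2 i).2.2⟩) ht (by exact_mod_cast ht0)
    (ψ := fun S => ENNReal.ofReal (f S)) (fun S => by
      simpa using ENNReal.ofReal_le_ofReal (hf0 S).2) (v := ENNReal.ofReal (1 - 5 * e))
    (fun F hF => by
      have hsub : A.filter (· ∈ g) ∪ Finset.univ.image F ⊆ XM := by
        refine Finset.union_subset ((Finset.filter_subset _ _).trans hAX) fun x hx => ?_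
        obtain ⟨i, -, rfl⟩ := Finset.mem_image.1 hx
        exact (hF.2 i).2.1
      have hpos : 0 < ∑ x ∈ A.filter (· ∈ g) ∪ Finset.univ.image F, W x := by
        have h1 : ∑ x ∈ A.filter (· ∈ g) ∪ Finset.univ.image F, W x = t := by
          rw [Finset.sum_union, Finset.sum_image hF.1.injOn, ht]
          · congr 1
            simp [hR _ (hF.2 _).2.2]
          · rw [Finset.disjoint_left]
            intro x hx hx'
            obtain ⟨i, -, rfl⟩ := Finset.mem_image.1 hx'
            exact (hF.2 i).2.2 (Finset.mem_filter.1 hx).1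
        rw [h1]; exact_mod_cast ht0
      set D := synth W p _ hpos
      have hD : IsProbabilityMeasure (synthMeasure W p (A.filter (· ∈ g) ∪ Finset.univ.image F)) :=
        D.2
      rw [hlint]
      refine ENNReal.ofReal_le_ofReal ?_
      -- Of the `5 * e`, one `e` is the slack in competing, and each of the two passages between
      -- risk and `avgRisk` costs `2 * e`.
      have c1 := hh₀ _ hsub hpos h hh
      have c2 := abs_le.1 (hU D h₀)
      have c3 := abs_le.1 (hU D h)
      change 1 - 5 * e ≤ 1 - avgRisk L h₀ k (D : Measure (X × Bool))
        + avgRisk L h k (D : Measure (X × Bool))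
      linarith [c2.2, c3.1])
  rw [hlint] at key
  set I := 1 - avgRisk L h₀ k (relabel (μ[|inGroup g]) p) + avgRisk L h k (relabel (μ[|inGroup g]) p)
    with hI
  have hI0 : 0 ≤ I := by
    rw [hI, ← hint]; exact integral_nonneg fun S => (hf0 S).1
  suffices hfin : 1 - 8 * e ≤ I by linarith
  rcases le_or_gt (1 - 8 * e) 0 with hneg | hpos8
  · exact hneg.trans hI0
  have keyR : (Measure.pi fun _ : Fin n => ρ).real good * (1 - 5 * e)
      ≤ ((t : ℝ)⁻¹ * (K * q)) ^ (k + 1) * I + 2 * (((k + 1 : ℕ) : ℝ) ^ 2 * ((t : ℝ)⁻¹ * R)) := by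
    have htop : ((t : ENNReal)⁻¹ * (K * μ (inGroup g))) ^ (k + 1) * ENNReal.ofReal I
        + 2 * (((k + 1 : ℕ) : ENNReal) ^ 2 * ((t : ENNReal)⁻¹ * R)) ≠ ⊤ := by
      have : (t : ENNReal) ≠ 0 := by
        have : t ≠ 0 := by exact_mod_cast ht0.ne'
        exact_mod_cast this
      finiteness
    have h1 := ENNReal.toReal_mono htop key
    rw [ENNReal.toReal_mul, ENNReal.toReal_ofReal (by linarith), ENNReal.toReal_add (by
      exact fun h => htop (by rw [h, top_add])) (fun h => htop (by rw [h, add_top]))] at h1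
    generalize k + 1 = m at h1 ⊢
    simpa [ENNReal.toReal_mul, ENNReal.toReal_pow, ENNReal.toReal_inv, ENNReal.toReal_ofReal hI0,
      measureReal_def, hq] using h1
  have hc : 2 * (((k + 1 : ℕ) : ℝ) ^ 2 * ((t : ℝ)⁻¹ * R)) ≤ e := by
    have h1 : N * γ / 2 * R ≤ t := by
      refine le_trans ?_ htK
      have : (K : ℝ) = N * R := by rw [hK]; push_cast; ring
      rw [this]
      calc (N : ℝ) * γ / 2 * R = N * R * γ * (1 / 2) := by ring
        _ ≤ N * R * q * (1 - η) := by gcongr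
    have h2 : (t : ℝ)⁻¹ * R ≤ 2 / (N * γ) := by
      rw [inv_mul_le_iff₀ ht0]
      calc (R : ℝ) = N * γ / 2 * R * (2 / (N * γ)) := by field_simp
        _ ≤ t * (2 / (N * γ)) := by gcongr
    refine le_trans ?_ hcoll
    calc 2 * (((k + 1 : ℕ) : ℝ) ^ 2 * ((t : ℝ)⁻¹ * R))
        ≤ 2 * (((k + 1 : ℕ) : ℝ) ^ 2 * (2 / (N * γ))) := by gcongr
      _ = 4 * (k + 1) ^ 2 / (N * γ) := by push_cast; ring
  have hP : 1 - e ≤ (Measure.pi fun _ : Fin n => ρ).real good := by linarith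
  -- The factors `1 - e` and `1 - 5 * e` leave at least `1 - 6 * e`, and collisions take another
  -- `e`; the normalisation `hC` will take the eighth.
  have hbr : 1 - 7 * e ≤ ((t : ℝ)⁻¹ * (K * q)) ^ (k + 1) * I := by
    have := mul_le_mul_of_nonneg_right hP (show 0 ≤ 1 - 5 * e by linarith)
    nlinarith
  have hC : 1 - e ≤ (t / (K * q)) ^ (k + 1) := by
    have h1 : 1 - η ≤ t / (K * q) := by
      rw [le_div_iff₀ (by positivity)]; linarith
    have h2 : 1 + ((k + 1 : ℕ) : ℝ) * (-η) ≤ (1 + -η) ^ (k + 1) :=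
      one_add_mul_le_pow (by linarith) _
    have h3 : (1 + -η) ^ (k + 1) ≤ (t / (K * q)) ^ (k + 1) :=
      pow_le_pow_left₀ (by linarith) (by linarith) _
    push_cast at h2
    linarith
  have hIeq : I = (t / (K * q)) ^ (k + 1) * (((t : ℝ)⁻¹ * (K * q)) ^ (k + 1) * I) := by
    rw [← mul_assoc, ← mul_pow]
    have : t / (K * q) * ((t : ℝ)⁻¹ * (K * q)) = 1 := by field_simp
    rw [this, one_pow, one_mul]
  have hfin2 : (1 - e) * (1 - 7 * e) ≤ I := by
    rw [hIeq]
    exact mul_le_mul hC hbr (by linarith) (by positivity)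
  nlinarith

end MultiGroup

namespace MultiGroup

/-! ### Union bounds. -/

section Union

variable {α ι : Type*} [MeasurableSpace α] [Countable α] [MeasurableSingletonClass α]

/-- Hoeffding's inequality for finitely many functions. -/
theorem measureReal_exists_deviation_le [Fintype ι] (μ : Measure α) [IsProbabilityMeasure μ]
    (U : ι → α → ℝ) (h01 : ∀ i w, U i w ∈ Set.Icc (0 : ℝ) 1) {r : ℕ} (hr : 0 < r) {β : ℝ}
    (hβ : 0 ≤ β) :
    (Measure.pi fun _ : Fin r => μ).real
      {w | ∃ i, β ≤ |(∑ l, U i (w l)) / r - ∫ x, U i x ∂μ|}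
      ≤ Fintype.card ι * (2 * Real.exp (-2 * r * β ^ 2)) := by
  have e : {w : Fin r → α | ∃ i, β ≤ |(∑ l, U i (w l)) / r - ∫ x, U i x ∂μ|}
      = ⋃ i ∈ (Finset.univ : Finset ι), {w | β ≤ |(∑ l, U i (w l)) / r - ∫ x, U i x ∂μ|} := by
    ext w; simp
  rw [e]
  refine (measureReal_biUnion_finset_le _ _).trans ((Finset.sum_le_sum fun i _ =>
    hoeffding_mean μ (U i) .of_discrete (h01 i) hr hβ).trans ?_)
  simp

variable {β γ : Type*} [MeasurableSpace β] [Countable β] [MeasurableSingletonClass β]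
  [MeasurableSpace γ] [Countable γ] [MeasurableSingletonClass γ]

/-- A union bound for three successive experiments. -/
theorem prod_prod_measure_le (μ₁ : Measure α) (μ₂ : Measure β) (μ₃ : Measure γ)
    [IsProbabilityMeasure μ₁] [IsProbabilityMeasure μ₂] [IsProbabilityMeasure μ₃]
    (B₁ : Set α) (B₂ : α → Set β) (B₃ : α → β → Set γ) {a : ENNReal} (h₁ : μ₁ B₁ ≤ a)
    (h₂ : ∀ x ∉ B₁, μ₂ (B₂ x) ≤ a) (h₃ : ∀ x y, μ₃ (B₃ x y) ≤ a) :
    (μ₁.prod (μ₂.prod μ₃)) {p | p.1 ∈ B₁ ∨ (p.1 ∉ B₁ ∧ p.2.1 ∈ B₂ p.1) ∨ p.2.2 ∈ B₃ p.1 p.2.1}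
      ≤ a + (a + a) := by
  have e : {p : α × β × γ | p.1 ∈ B₁ ∨ (p.1 ∉ B₁ ∧ p.2.1 ∈ B₂ p.1) ∨ p.2.2 ∈ B₃ p.1 p.2.1}
      = (B₁ ×ˢ Set.univ) ∪ ({p | p.1 ∉ B₁ ∧ p.2.1 ∈ B₂ p.1} ∪ {p | p.2.2 ∈ B₃ p.1 p.2.1}) := by
    ext p; simp
  rw [e]
  refine (measure_union_le _ _).trans (add_le_add ?_ ((measure_union_le _ _).trans
    (add_le_add ?_ ?_)))
  · rw [Measure.prod_prod]; simpa using h₁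
  · rw [Measure.prod_apply .of_discrete]
    refine (lintegral_mono (g := fun _ => a) fun x => ?_).trans (by simp)
    by_cases hx : x ∈ B₁
    · simp [hx]
    · have : (Prod.mk x ⁻¹' {p : α × β × γ | p.1 ∉ B₁ ∧ p.2.1 ∈ B₂ p.1}) = B₂ x ×ˢ Set.univ := by
        ext; simp [hx]
      rw [this, Measure.prod_prod]
      simpa using h₂ x hx
  · rw [Measure.prod_apply .of_discrete]
    refine (lintegral_mono (g := fun _ => a) fun x => ?_).trans (by simp)
    rw [Measure.prod_apply .of_discrete]
    exact (lintegral_mono (g := fun _ => a) fun y => h₃ x y).trans (by simp)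

end Union

/-! ### Blocks, advised updates and acceptance tests. -/

variable {X : Type*}

/-- A sample that is large enough to draw `k + 1` examples from a group by rejection sampling. -/
abbrev Block (X : Type*) (k n : ℕ) : Type _ := Fin (k + 1) → Fin (n + 1) → X × Bool

/-- Whether the first example in the block lies in `g`. -/
def groupHit {k n : ℕ} (g : Set X) : Block X k n → ℝ := {w | w 0 0 ∈ inGroup g}.indicator fun _ => 1

theorem groupHit_mem_Icc {k n : ℕ} (g : Set X) (w : Block X k n) :
    groupHit g w ∈ Set.Icc (0 : ℝ) 1 := by
  by_cases h : w ∈ {w : Block X k n | w 0 0 ∈ inGroup g}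
  · rw [groupHit, Set.indicator_of_mem h]; simp
  · rw [groupHit, Set.indicator_of_notMem h]; simp

variable [MeasurableSpace X]

/-- The law of a block. -/
def blockLaw (μ : Measure (X × Bool)) (k n : ℕ) : Measure (Block X k n) :=
  Measure.pi fun _ => Measure.pi fun _ => μ

instance (μ : Measure (X × Bool)) [IsProbabilityMeasure μ] (k n : ℕ) :
    IsProbabilityMeasure (blockLaw μ k n) := by unfold blockLaw; infer_instance

/-- The advice for an update: either to keep the predictor, or a group, a test predictor
(`none` stands for the competitor of the present predictor), a slot, a direction, and labels. -/
abbrev Advice (H : Finset (Predictor X)) (G : Finset (Set X)) (k : ℕ) : Type _ :=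
  Option (G × Option H × Fin (k + 1) × Bool × (Fin (k + 1) → Bool))

/-- The predictor that advice refers to. -/
def testPredictor {H : Finset (Predictor X)} (c : Predictor X) : Option H → Predictor X
  | none => c
  | some h => h

open Classical in
/-- The update of `p` that the advice prescribes, on the examples that rejection sampling finds
in the block `w`. -/
def update (L : Loss X) (H : Finset (Predictor X)) (G : Finset (Set X)) (k n : ℕ) (η : ℝ)
    (best : Predictor X → Predictor X) (p : Predictor X) (w : Block X k n) :
    Advice H G k → Predictor X
  | none => p
  | some (g, h, i, σ, y) =>
    if w ∈ found (inGroup (g : Set X)) then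
      gradStep η g (fun S => L.risk (empirical S) (testPredictor (best p) h)) i σ
        (pick (inGroup (g : Set X)) w) y p
    else p

/-- The predictors `p` for which drawing the labels according to `p` changes the average empirical
risk of `best p` and of the predictors in `H` by at most `e`, on all groups of mass at least `γ`. -/
def indistinguishable (L : Loss X) (H : Finset (Predictor X)) (G : Finset (Set X)) (k : ℕ)
    (best : Predictor X → Predictor X) (μ : Measure (X × Bool)) (γ e : ℝ) : Set (Predictor X) :=
  {p | ∀ g ∈ G, γ ≤ μ.real (inGroup g) → ∀ h : Option H,
    |avgRisk L (testPredictor (best p) h) k (μ[|inGroup g])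
      - avgRisk L (testPredictor (best p) h) k (relabel (μ[|inGroup g]) p)| ≤ e}

/-- The empirical risk of `c` on the examples in `g` that rejection sampling finds. -/
def groupRisk (L : Loss X) {k n : ℕ} (g : Set X) (c : Predictor X) : Block X k n → ℝ :=
  (found (inGroup g)).indicator fun w => L.risk (empirical (pick (inGroup g) w)) c

theorem groupRisk_mem_Icc (L : Loss X) {k n : ℕ} (g : Set X) (c : Predictor X) (w : Block X k n) :
    groupRisk L g c w ∈ Set.Icc (0 : ℝ) 1 := by
  by_cases h : w ∈ found (inGroup g)
  · rw [groupRisk, Set.indicator_of_mem h]; exact risk_mem_Icc _ _ _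
  · rw [groupRisk, Set.indicator_of_notMem h]; simp

variable [DiscreteMeasurableSpace X] [Countable X]

/-- A failed rejection leaves `p` unchanged, so a success probability of at least `1 / 2` preserves
half of the gain of a gradient step. The advice may depend on the block, which is how the best
labels enter. -/
theorem exists_update_brier_le (L : Loss X) (H : Finset (Predictor X)) (G : Finset (Set X))
    (k n : ℕ) (best : Predictor X → Predictor X) (μ : Measure (X × Bool)) [IsProbabilityMeasure μ]
    {γ e : ℝ} (hγ : 0 < γ) (he : 0 ≤ e)
    (hhit : ∀ q, γ ≤ q → q ≤ 1 → 1 / 2 ≤ hitProb q n ^ (k + 1)) {p : Predictor X}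
    (hp : p ∉ indistinguishable L H G k best μ γ e) :
    ∃ q : Block X k n → Advice H G k,
      ∫ w, brier μ (update L H G k n (γ * e / (k + 1 : ℕ)) best p w (q w)) ∂(blockLaw μ k n)
        ≤ brier μ p - (γ * e / (k + 1 : ℕ)) ^ 2 / 2 := by
  simp only [indistinguishable, Set.mem_ofPred_eq, not_forall, not_le] at hp
  obtain ⟨g, hgG, hg, h, hgap⟩ := hp
  have hg0 : 0 < μ.real (inGroup g) := hγ.trans_le hg
  set Λ : (Fin (k + 1) → X × Bool) → ℝ :=
    fun S => L.risk (empirical S) (testPredictor (best p) h) with hΛ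
  set η := γ * e / (k + 1 : ℕ) with hη
  obtain ⟨i, σ, y, hstep⟩ := exists_gradStep_le k.succ_pos μ p hγ hg (Λ := Λ)
    (fun S => risk_mem_Icc _ _ _) he hgap
  refine ⟨fun w => some (⟨g, hgG⟩, h, i, σ, y (pick (inGroup g) w)), ?_⟩
  set f : (Fin (k + 1) → X × Bool) → ℝ := fun s => brier μ (gradStep η g Λ i σ s (y s) p) with hf
  have hint : ∀ φ : Block X k n → Predictor X, Integrable (fun w => brier μ (φ w))
      (blockLaw μ k n) :=
    fun φ => integrable_of_mem_Icc_of_discrete _ fun w => brier_mem_Icc μ _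
  rw [← integral_add_compl (MeasurableSet.of_discrete (s := found (inGroup g))) (hint _)]
  have h1 : ∫ w in found (inGroup g), brier μ (update L H G k n η best p w
      (some (⟨g, hgG⟩, h, i, σ, y (pick (inGroup g) w)))) ∂(blockLaw μ k n)
      = hitProb (μ.real (inGroup g)) n ^ (k + 1) *
        ∫ s, f s ∂(Measure.pi fun _ : Fin (k + 1) => μ[|inGroup g]) := by
    have := setIntegral_found (κ := Fin (k + 1)) μ (inGroup g) hg0 n f
    rw [Fintype.card_fin] at this
    rw [← this]
    refine setIntegral_congr_fun .of_discrete fun w hw => ?_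
    simp only [update, if_pos hw, hf]
    rfl
  have h2 : ∫ w in (found (inGroup g))ᶜ, brier μ (update L H G k n η best p w
      (some (⟨g, hgG⟩, h, i, σ, y (pick (inGroup g) w)))) ∂(blockLaw μ k n)
      = (1 - hitProb (μ.real (inGroup g)) n ^ (k + 1)) * brier μ p := by
    have hc : ∀ w ∈ (found (inGroup g))ᶜ, brier μ (update L H G k n η best p w
        (some (⟨g, hgG⟩, h, i, σ, y (pick (inGroup g) w)))) = brier μ p := fun w hw => by
      simp only [update]
      rw [if_neg hw]
    rw [setIntegral_congr_fun .of_discrete hc, setIntegral_const,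
      probReal_compl_eq_one_sub .of_discrete, blockLaw, measureReal_found μ _ hg0,
      Fintype.card_fin, smul_eq_mul]
  rw [h1, h2]
  have hc := hhit _ hg measureReal_le_one
  have h3 := mul_le_mul_of_nonneg_left hstep (show 0 ≤ hitProb (μ.real (inGroup g)) n ^ (k + 1) by
    linarith)
  nlinarith [sq_nonneg η]

theorem integral_groupRisk (L : Loss X) (k n : ℕ) (μ : Measure (X × Bool)) [IsProbabilityMeasure μ]
    {g : Set X} (hg : 0 < μ.real (inGroup g)) (c : Predictor X) :
    ∫ w, groupRisk L g c w ∂(blockLaw μ k n)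
      = hitProb (μ.real (inGroup g)) n ^ (k + 1) * avgRisk L c k (μ[|inGroup g]) := by
  have := setIntegral_found (κ := Fin (k + 1)) μ (inGroup g) hg n fun S => L.risk (empirical S) c
  rw [Fintype.card_fin] at this
  simp only [groupRisk]
  rw [integral_indicator .of_discrete]
  exact this

theorem integral_groupHit (k n : ℕ) (μ : Measure (X × Bool)) [IsProbabilityMeasure μ]
    (g : Set X) : ∫ w, groupHit g w ∂(blockLaw μ k n) = μ.real (inGroup g) := by
  simp only [groupHit]
  rw [integral_indicator_const _ .of_discrete, smul_eq_mul, mul_one, measureReal_def,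
    measureReal_def]
  congr 1
  have h1 := (measurePreserving_eval (fun _ : Fin (n + 1) => μ) 0).comp
    (measurePreserving_eval (fun _ : Fin (k + 1) => Measure.pi fun _ : Fin (n + 1) => μ) 0)
  exact h1.measure_preimage (MeasurableSet.of_discrete (s := inGroup g)).nullMeasurableSet

/-- The mean of `f` over the blocks. -/
def blockMean {k n r : ℕ} (f : Block X k n → ℝ) (s : Fin r → Block X k n) : ℝ :=
  (∑ l, f (s l)) / r

/-- The predictor `c` competes with `H` on the blocks `s`, for each group that is often hit. -/
def accepts (L : Loss X) (H : Finset (Predictor X)) (G : Finset (Set X)) (γ e : ℝ) {k n r : ℕ}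
    (s : Fin r → Block X k n) (c : Predictor X) : Prop :=
  ∀ g ∈ G, 3 * γ / 4 ≤ blockMean (groupHit g) s → ∀ h ∈ H,
    blockMean (groupRisk L g c) s ≤ blockMean (groupRisk L g h) s + 14 * e

theorem avgRisk_mem_Icc (L : Loss X) (c : Predictor X) (k : ℕ) (ν : Measure (X × Bool))
    [IsProbabilityMeasure ν] : avgRisk L c k ν ∈ Set.Icc (0 : ℝ) 1 := by
  refine ⟨integral_nonneg fun S => (risk_mem_Icc _ _ _).1, ?_⟩
  have := integral_mono (μ := Measure.pi fun _ : Fin (k + 1) => ν)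
    (integrable_of_mem_Icc_of_discrete _ fun S => risk_mem_Icc L (empirical S) c)
    (integrable_const (1 : ℝ)) fun S => (risk_mem_Icc L (empirical S) c).2
  simpa [avgRisk] using this

variable {L : Loss X} {H : Finset (Predictor X)} {G : Finset (Set X)} {γ e β : ℝ} {k n r : ℕ}
  {s : Fin r → Block X k n} {μ : Measure (X × Bool)} [IsProbabilityMeasure μ]

/-- A failed rejection is counted as risk `0`, a bias of at most `e`; the sampling error adds `β`.
-/
theorem abs_blockMean_sub_avgRisk_lt {g : Set X} (hg : 0 < μ.real (inGroup g))
    (hhit : 1 - e ≤ hitProb (μ.real (inGroup g)) n ^ (k + 1)) {c : Predictor X}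
    (hc : |blockMean (groupRisk L g c) s - ∫ w, groupRisk L g c w ∂(blockLaw μ k n)| < β) :
    |blockMean (groupRisk L g c) s - avgRisk L c k (μ[|inGroup g])| < β + e := by
  rw [integral_groupRisk L k n μ hg] at hc
  have hprob : IsProbabilityMeasure (μ[|inGroup g]) := cond_isProbabilityMeasure fun h0 => by
    simp [measureReal_def, h0] at hg
  have h5 : hitProb (μ.real (inGroup g)) n ^ (k + 1) ≤ 1 :=
    hitProb_pow_le_one measureReal_nonneg measureReal_le_one _ _
  obtain ⟨h6, h7⟩ := avgRisk_mem_Icc L c k (μ[|inGroup g])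
  rw [abs_lt] at hc ⊢
  constructor <;> nlinarith [hc.1, hc.2]

/-- Group frequencies are accurate up to `γ / 4`, so a group that reaches the threshold `3 * γ / 4`
has mass at least `γ / 2`, where `c` competes. Two risk estimates, each off by at most `2 * e`, turn
`10 * e` into `14 * e`. -/
theorem accepts_of_avgRisk_le (hβe : β ≤ e) (hβγ : β ≤ γ / 4) (hγ : 0 < γ)
    (hhit : ∀ q, γ / 2 ≤ q → q ≤ 1 → 1 - e ≤ hitProb q n ^ (k + 1))
    {c : Predictor X}
    (hV : ∀ g ∈ G, |blockMean (groupHit g) s - ∫ w, groupHit g w ∂(blockLaw μ k n)| < β)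
    (hc : ∀ g ∈ G, |blockMean (groupRisk L g c) s - ∫ w, groupRisk L g c w ∂(blockLaw μ k n)| < β)
    (hH : ∀ g ∈ G, ∀ h ∈ H,
      |blockMean (groupRisk L g h) s - ∫ w, groupRisk L g h w ∂(blockLaw μ k n)| < β)
    (hcomp : ∀ g ∈ G, γ / 2 ≤ μ.real (inGroup g) → ∀ h ∈ H,
      avgRisk L c k (μ[|inGroup g]) ≤ avgRisk L h k (μ[|inGroup g]) + 10 * e) :
    accepts L H G γ e s c := by
  intro g hg hact h hh
  have h1 := abs_lt.1 (hV g hg)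
  rw [integral_groupHit] at h1
  have hgγ : γ / 2 ≤ μ.real (inGroup g) := by linarith [h1.2]
  have hg0 : 0 < μ.real (inGroup g) := (half_pos hγ).trans_le hgγ
  have h4 := hhit _ hgγ measureReal_le_one
  have h2 := abs_lt.1 (abs_blockMean_sub_avgRisk_lt hg0 h4 (hc g hg))
  have h3 := abs_lt.1 (abs_blockMean_sub_avgRisk_lt hg0 h4 (hH g hg h hh))
  have h6 := hcomp g hg hgγ h hh
  linarith [h2.2, h3.1]

/-- A group of mass at least `γ` reaches the threshold, so acceptance covers it; the two risk
estimates again cost `4 * e`. -/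
theorem avgRisk_le_of_accepts (hβe : β ≤ e) (hβγ : β ≤ γ / 4) (hγ : 0 < γ)
    (hhit : ∀ q, γ / 2 ≤ q → q ≤ 1 → 1 - e ≤ hitProb q n ^ (k + 1))
    {c : Predictor X}
    (hV : ∀ g ∈ G, |blockMean (groupHit g) s - ∫ w, groupHit g w ∂(blockLaw μ k n)| < β)
    (hc : ∀ g ∈ G, |blockMean (groupRisk L g c) s - ∫ w, groupRisk L g c w ∂(blockLaw μ k n)| < β)
    (hH : ∀ g ∈ G, ∀ h ∈ H,
      |blockMean (groupRisk L g h) s - ∫ w, groupRisk L g h w ∂(blockLaw μ k n)| < β)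
    (hacc : accepts L H G γ e s c) {g : Set X} (hg : g ∈ G) (hgγ : γ ≤ μ.real (inGroup g))
    {h : Predictor X} (hh : h ∈ H) :
    avgRisk L c k (μ[|inGroup g]) ≤ avgRisk L h k (μ[|inGroup g]) + 18 * e := by
  have h1 := abs_lt.1 (hV g hg)
  rw [integral_groupHit] at h1
  have hgγ2 : γ / 2 ≤ μ.real (inGroup g) := by linarith
  have hg0 : 0 < μ.real (inGroup g) := hγ.trans_le hgγ
  have h4 := hhit _ hgγ2 measureReal_le_one
  have h2 := abs_lt.1 (abs_blockMean_sub_avgRisk_lt hg0 h4 (hc g hg))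
  have h3 := abs_lt.1 (abs_blockMean_sub_avgRisk_lt hg0 h4 (hH g hg h hh))
  have h6 := hacc g hg (by linarith [h1.1]) h hh
  linarith [h2.1, h3.2]

end MultiGroup

/-! ### The learner and its probability of success. -/

namespace MultiGroup

variable {X : Type*}

open Classical in
/-- The weights guessed for the points in the sample, and the weight `R` elsewhere. -/
def guessedWeight (R : ℕ) {m K : ℕ} (s : Fin m → X × Bool) (w : Fin m → Fin (K + 1)) (x : X) : ℕ :=
  if h : ∃ j, (s j).1 = x then w h.choose else R

/-- A point that occurs several times has several guesses, one of which is used; guesses that come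
from one function `v` make the choice immaterial. -/
theorem guessedWeight_of_forall_eq {R m K : ℕ} {s : Fin m → X × Bool} {w : Fin m → Fin (K + 1)}
    {v : X → ℕ} (hw : ∀ j, (w j : ℕ) = v (s j).1) (j : Fin m) :
    guessedWeight R s w (s j).1 = v (s j).1 := by
  have h : ∃ i, (s i).1 = (s j).1 := ⟨j, rfl⟩
  rw [guessedWeight, dif_pos h, hw, h.choose_spec]

/-- The finitely many points up to the largest one in the sample, in an enumeration of `X`. -/
theorem finite_window {enc : X → ℕ} (henc : Function.Injective enc) {m : ℕ}
    (s : Fin m → X × Bool) : {x | ∃ j, enc x ≤ enc (s j).1}.Finite := by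
  have : {x | ∃ j, enc x ≤ enc (s j).1} = ⋃ j, enc ⁻¹' Set.Iic (enc (s j).1) := by ext; simp
  rw [this]
  exact Set.finite_iUnion fun j => (Set.finite_Iic _).preimage henc.injOn

/-- `finite_window` as a `Finset`. -/
def window {enc : X → ℕ} (henc : Function.Injective enc) {m : ℕ} (s : Fin m → X × Bool) :
    Finset X :=
  (finite_window henc s).toFinset

variable [MeasurableSpace X] [DiscreteMeasurableSpace X]

/-- A predictor that competes with `H` on all restrictions of a synthetic distribution. -/
def competitor (L : Loss X) (H : Finset (Predictor X)) (e : ℝ) (W : X → ℕ) (F' : Finset X)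
    (p : Predictor X) : Predictor X :=
  Classical.epsilon fun h₀ =>
    ∀ F ⊆ F', ∀ h : 0 < ∑ x ∈ F, W x, L.Competitive (synth W p F h) H e h₀

/-- The numerical parameters of the learner: accuracy `e`, group mass `γ`, number `k + 1` of examples
in a test, row length `n + 1` in rejection sampling, number `N` of points in the synthetic
distributions, weight `R` of each of them, number `m` of examples in the first part of the sample,
number `T` of updates and number `r` of blocks in the final selection. -/
structure Params where
  (e γ : ℝ)
  (k n N R m T r : ℕ)

/-- The advice that leads to a candidate. -/
abbrev Params.Index (P : Params) (H : Finset (Predictor X)) (G : Finset (Set X)) : Type _ :=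
  (Fin P.m → Fin (P.N * P.R + 1)) × (Fin P.T → Advice H G P.k)

/-- The competitor of `p` for guessed weights. -/
def Params.best (P : Params) (L : Loss X) (H : Finset (Predictor X)) {enc : X → ℕ}
    (henc : Function.Injective enc) (s₁ : Fin P.m → X × Bool)
    (w : Fin P.m → Fin (P.N * P.R + 1)) : Predictor X → Predictor X :=
  competitor L H P.e (guessedWeight P.R s₁ w) (window henc s₁)

/-- The candidate predictor that the advice `c` leads to. -/
def Params.candidate (P : Params) (L : Loss X) (H : Finset (Predictor X)) (G : Finset (Set X))
    {enc : X → ℕ} (henc : Function.Injective enc) (s₁ : Fin P.m → X × Bool)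
    (s₂ : Fin P.T → Block X P.k P.n) (c : P.Index H G) : Predictor X :=
  P.best L H henc s₁ c.1 (runPath (update L H G P.k P.n (P.γ / 2 * P.e / (P.k + 1 : ℕ))
    (P.best L H henc s₁ c.1)) P.T (fun _ => 0) s₂ c.2)

open Classical in
/-- The output of the learner: some accepted candidate. -/
def Params.select (P : Params) (L : Loss X) (H : Finset (Predictor X)) (G : Finset (Set X))
    {enc : X → ℕ} (henc : Function.Injective enc) (s₁ : Fin P.m → X × Bool)
    (s₂ : Fin P.T → Block X P.k P.n) (s₃ : Fin P.r → Block X P.k P.n) : Predictor X :=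
  if h : ∃ c, accepts L H G P.γ P.e s₃ (P.candidate L H G henc s₁ s₂ c) then
    P.candidate L H G henc s₁ s₂ h.choose
  else fun _ => 0

/-- The relations between the parameters that make the learner succeed with probability at least
`1 - 3 * a`. -/
structure Params.Valid (P : Params) (a β τ : ℝ) (indexCard hCard gCard : ℕ) : Prop where
  e_mem : P.e ∈ Set.Ioc (0 : ℝ) (1 / 2)
  γ_pos : 0 < P.γ
  N_pos : 0 < P.N
  R_pos : 0 < P.R
  m_pos : 0 < P.m
  r_pos : 0 < P.r
  T_pos : 0 < P.T
  a_nonneg : 0 ≤ a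
  τ_pos : 0 < τ
  β_nonneg : 0 ≤ β
  β_le : β ≤ P.e
  β_le' : β ≤ P.γ / 4
  coverage : 1 / (P.m * (P.e / P.N ^ 2) ^ 2) + 1 / (P.m * τ) ≤ a
  rounding : (P.k + 1) * ((τ + P.m / (P.N * P.R : ℕ) + 1 / P.N) / (P.γ / 2)) ≤ P.e
  collision : 4 * (P.k + 1) ^ 2 / (P.N * (P.γ / 2)) ≤ P.e
  rejection : (P.k + 1 : ℕ) * (1 / ((P.n + 1 : ℕ) * (P.γ / 2))) ≤ P.e
  descent : 1 / ((P.γ / 2 * P.e / (P.k + 1 : ℕ)) ^ 2 / 2 * P.T) ≤ a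
  selection : gCard * (indexCard + hCard + 1) * (2 * Real.exp (-2 * P.r * β ^ 2)) ≤ a

variable [Countable X] {P : Params} {a β τ : ℝ} {L : Loss X} {H : Finset (Predictor X)}
  {G : Finset (Set X)} {enc : X → ℕ} (henc : Function.Injective enc)
  {μ : Measure (X × Bool)} [IsProbabilityMeasure μ]

theorem Params.Valid.le_hitProb {i h g : ℕ} (hP : P.Valid a β τ i h g) (q : ℝ) (hq : P.γ / 2 ≤ q)
    (hq1 : q ≤ 1) : 1 - P.e ≤ hitProb q P.n ^ (P.k + 1) := by
  have hγ : 0 < P.γ / 2 := by linarith [hP.γ_pos]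
  refine le_trans ?_ (one_sub_le_hitProb_pow (hγ.trans_le hq) hq1 P.n (P.k + 1))
  have : (P.k + 1 : ℕ) * (1 / ((P.n + 1 : ℕ) * q)) ≤ P.e := by
    refine le_trans ?_ hP.rejection
    gcongr
  linarith

/-- The event that the first part of the sample misses a heavy point, or a heavy tail. -/
def badCoverage (P : Params) (enc : X → ℕ) (μ : Measure (X × Bool)) (τ : ℝ) :
    Set (Fin P.m → X × Bool) :=
  {S | ∃ x, P.e / P.N ^ 2 < μ.real (Prod.fst ⁻¹' {x}) ∧ ∀ j, (S j).1 ≠ x} ∪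
    {S | τ < μ.real {z | ∀ j, enc (S j).1 < enc z.1}}

theorem measure_badCoverage_le {i h g : ℕ} (hP : P.Valid a β τ i h g) :
    (Measure.pi fun _ : Fin P.m => μ) (badCoverage P enc μ τ) ≤ ENNReal.ofReal a := by
  have hN : (0 : ℝ) < P.N := by exact_mod_cast hP.N_pos
  have hθ : 0 < P.e / P.N ^ 2 := div_pos hP.e_mem.1 (by positivity)
  have h1 := measureReal_exists_missed_le Prod.fst μ hP.m_pos hθ
  have h2 := measureReal_tail_le (fun z : X × Bool => enc z.1) μ hP.m_pos hP.τ_pos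
  rw [← ENNReal.ofReal_toReal (a := (Measure.pi fun _ : Fin P.m => μ) _) (by finiteness)]
  refine ENNReal.ofReal_le_ofReal ?_
  exact (measureReal_union_le _ _).trans ((add_le_add h1 h2).trans hP.coverage)

/-- For a sample that covers the distribution and correctly guessed weights, the competitor of `p`
competes on the relabelled distribution. -/
theorem exists_best_competitive {i h g : ℕ} (hP : P.Valid a β τ i h g)
    (hL : L.MultiPACCompatible)
    (hU : ∀ (D : LabelledDist X) (h : Predictor X), |avgRisk L h P.k D - L.risk D h| ≤ 2 * P.e)
    {s₁ : Fin P.m → X × Bool} (hs₁ : s₁ ∉ badCoverage P enc μ τ) :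
    ∃ w : Fin P.m → Fin (P.N * P.R + 1), ∀ (p : Predictor X) (g : Set X),
      P.γ / 2 ≤ μ.real (inGroup g) → ∀ h ∈ H,
        avgRisk L (P.best L H henc s₁ w p) P.k (relabel (μ[|inGroup g]) p)
          ≤ avgRisk L h P.k (relabel (μ[|inGroup g]) p) + 8 * P.e := by
  classical
  have hN : (0 : ℝ) < P.N := by exact_mod_cast hP.N_pos
  have hR0 : (0 : ℝ) < P.R := by exact_mod_cast hP.R_pos
  have hfl : ∀ x, ⌊(P.N * P.R : ℕ) * μ.real (inGroup {x})⌋₊ < P.N * P.R + 1 := fun x => by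
    rw [Nat.lt_add_one_iff]
    refine Nat.floor_le_of_le (mul_le_of_le_one_right (by positivity) measureReal_le_one)
  -- The right guess is the true mass rounded down to a multiple of `1 / (N * R)`.
  set v : X → ℕ := fun x => ⌊(P.N * P.R : ℕ) * μ.real (inGroup {x})⌋₊ with hv
  set w : Fin P.m → Fin (P.N * P.R + 1) := fun j => ⟨v (s₁ j).1, hfl _⟩ with hw
  refine ⟨w, fun p g hg h hh => ?_⟩
  simp only [badCoverage, Set.mem_union, Set.mem_ofPred_eq, not_or, not_exists, not_and, not_forall,
    not_not, not_lt] at hs₁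
  obtain ⟨hs1, hs2⟩ := hs₁
  -- Every sampled point is treated as an atom, light or not; coverage ensures that all heavy points
  -- are among them.
  set A : Finset X := Finset.univ.image fun j => (s₁ j).1 with hAdef
  have hcardA : (A.card : ℝ) ≤ P.m := by
    have : A.card ≤ P.m := Finset.card_image_le.trans (by simp)
    exact_mod_cast this
  have hspec : ∀ F ⊆ window henc s₁, ∀ hF : 0 < ∑ x ∈ F, guessedWeight P.R s₁ w x,
      L.Competitive (synth (guessedWeight P.R s₁ w) p F hF) H P.e (P.best L H henc s₁ w p) :=
    Classical.epsilon_spec (exists_competitive_synth hL H hP.e_mem.1 (guessedWeight P.R s₁ w) p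
      (window henc s₁))
  have hkpos : (0 : ℝ) ≤ P.k + 1 := by positivity
  have hγ := hP.γ_pos
  refine avgRisk_relabel_le_of_competitive_synth hP.e_mem hU μ (half_pos hP.γ_pos) hg
    (A := A) (XM := window henc s₁) ?_ hP.N_pos hP.R_pos (W := guessedWeight P.R s₁ w) ?_ ?_
    (θ := P.e / P.N ^ 2) (div_nonneg hP.e_mem.1.le (by positivity)) ?_ (τ := τ) ?_ ?_ ?_
    hP.collision hspec hh
  · intro x hx
    obtain ⟨j, -, rfl⟩ := Finset.mem_image.1 hx
    exact (finite_window henc s₁).mem_toFinset.2 ⟨j, le_rfl⟩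
  · intro x hx
    obtain ⟨j, -, rfl⟩ := Finset.mem_image.1 hx
    rw [guessedWeight_of_forall_eq (v := v) (fun _ => rfl) j]
    exact ⟨Nat.floor_le (by positivity), (Nat.sub_one_lt_floor _).le⟩
  · intro x hx
    rw [guessedWeight, dif_neg]
    rintro ⟨j, rfl⟩
    exact hx (Finset.mem_image_of_mem _ (Finset.mem_univ j))
  · intro x hx
    by_contra hlt
    obtain ⟨j, hj⟩ := hs1 x (not_le.1 hlt)
    exact hx (hj ▸ Finset.mem_image_of_mem _ (Finset.mem_univ j))
  · refine le_trans (measureReal_mono fun z hz => ?_) hs2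
    have hz' : z.1 ∉ window henc s₁ := hz
    rw [window, Set.Finite.mem_toFinset] at hz'
    simpa using hz'
  · field_simp
    exact le_rfl
  · refine le_trans ?_ hP.rounding
    gcongr

/-- With high probability, some candidate competes on all groups of mass at least `γ / 2`. -/
theorem measure_no_competitive_candidate_le {i h g : ℕ} (hP : P.Valid a β τ i h g)
    (hL : L.MultiPACCompatible)
    (hU : ∀ (D : LabelledDist X) (h : Predictor X), |avgRisk L h P.k D - L.risk D h| ≤ 2 * P.e)
    {s₁ : Fin P.m → X × Bool} (hs₁ : s₁ ∉ badCoverage P enc μ τ) :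
    (Measure.pi fun _ : Fin P.T => blockLaw μ P.k P.n)
      {s₂ | ∀ c, ¬ ∀ g ∈ G, P.γ / 2 ≤ μ.real (inGroup g) → ∀ h ∈ H,
        avgRisk L (P.candidate L H G henc s₁ s₂ c) P.k (μ[|inGroup g])
          ≤ avgRisk L h P.k (μ[|inGroup g]) + 10 * P.e} ≤ ENNReal.ofReal a := by
  obtain ⟨w, hw⟩ := exists_best_competitive (H := H) henc hP hL hU hs₁
  have he := hP.e_mem.1
  have hγ := hP.γ_pos
  set η := P.γ / 2 * P.e / (P.k + 1 : ℕ) with hη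
  have hη0 : 0 < η := by positivity
  set good := indistinguishable L H G P.k (P.best L H henc s₁ w) μ (P.γ / 2) P.e with hgood
  have hdes := measure_forall_runPath_notMem_le (blockLaw μ P.k P.n)
    (update L H G P.k P.n η (P.best L H henc s₁ w)) none (fun _ _ => rfl) (brier μ)
    (brier_mem_Icc μ) good (c := η ^ 2 / 2) (by positivity)
    (fun p hp => exists_update_brier_le L H G P.k P.n (P.best L H henc s₁ w) μ (by positivity) he.le
      (fun q hq hq1 => le_trans (by linarith [hP.e_mem.2]) (hP.le_hitProb q hq hq1)) hp)
    P.T (fun _ => 0)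
  have hT : (0 : ℝ) < P.T := by exact_mod_cast hP.T_pos
  have hle : (Measure.pi fun _ : Fin P.T => blockLaw μ P.k P.n).real
      {b | ∀ q, runPath (update L H G P.k P.n η (P.best L H henc s₁ w)) P.T (fun _ => 0) b q ∉ good}
      ≤ a := by
    refine le_trans ?_ hP.descent
    rw [le_div_iff₀ (by positivity), mul_comm]
    exact hdes.trans (brier_mem_Icc μ _).2
  refine le_trans (measure_mono ?_)
    ((ENNReal.le_ofReal_iff_toReal_le (by finiteness) hP.a_nonneg).2 hle)
  intro s₂ hs₂ q hq
  refine hs₂ (w, q) fun g hg hgγ h hh => ?_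
  set p := runPath (update L H G P.k P.n η (P.best L H henc s₁ w)) P.T (fun _ => 0) s₂ q
  -- Passing from model labels to true labels costs `e` for the competitor (`none`) and `e` for `h`,
  -- on top of the `8 * e` in `hw`.
  have h1 := abs_le.1 (hq g hg hgγ none)
  have h2 := abs_le.1 (hq g hg hgγ (some ⟨h, hh⟩))
  have h3 := hw p g hgγ h hh
  change avgRisk L (P.best L H henc s₁ w p) P.k (μ[|inGroup g]) ≤ _
  simp only [testPredictor] at h1 h2
  linarith [h1.2, h2.1]

/-- The functions whose means over the blocks the final selection compares. -/
def Params.statistic (P : Params) (L : Loss X) (H : Finset (Predictor X)) (G : Finset (Set X))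
    {enc : X → ℕ} (henc : Function.Injective enc) (s₁ : Fin P.m → X × Bool)
    (s₂ : Fin P.T → Block X P.k P.n) :
    G × Option (P.Index H G ⊕ H) → Block X P.k P.n → ℝ
  | (g, none) => groupHit g
  | (g, some (.inl c)) => groupRisk L g (P.candidate L H G henc s₁ s₂ c)
  | (g, some (.inr h)) => groupRisk L g h

/-- The learner succeeds with high probability. -/
theorem measure_select_fails_le
    (hP : P.Valid a β τ (Fintype.card (P.Index H G)) H.card G.card) (hL : L.MultiPACCompatible)
    (hU : ∀ (D : LabelledDist X) (h : Predictor X), |avgRisk L h P.k D - L.risk D h| ≤ 2 * P.e) :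
    ((Measure.pi fun _ : Fin P.m => μ).prod
      ((Measure.pi fun _ : Fin P.T => blockLaw μ P.k P.n).prod
        (Measure.pi fun _ : Fin P.r => blockLaw μ P.k P.n)))
      {S | ¬ ∀ g ∈ G, P.γ ≤ μ.real (inGroup g) → ∀ h ∈ H,
        avgRisk L (P.select L H G henc S.1 S.2.1 S.2.2) P.k (μ[|inGroup g])
          ≤ avgRisk L h P.k (μ[|inGroup g]) + 18 * P.e}
      ≤ ENNReal.ofReal a + (ENNReal.ofReal a + ENNReal.ofReal a) := by
  set B₂ : (Fin P.m → X × Bool) → Set (Fin P.T → Block X P.k P.n) := fun s₁ =>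
    {s₂ | ∀ c, ¬ ∀ g ∈ G, P.γ / 2 ≤ μ.real (inGroup g) → ∀ h ∈ H,
        avgRisk L (P.candidate L H G henc s₁ s₂ c) P.k (μ[|inGroup g])
          ≤ avgRisk L h P.k (μ[|inGroup g]) + 10 * P.e}
  -- The first two parts of the sample determine all candidates, so the third part is fresh data for
  -- every statistic.
  set B₃ : (Fin P.m → X × Bool) → (Fin P.T → Block X P.k P.n) → Set (Fin P.r → Block X P.k P.n) :=
    fun s₁ s₂ => {s₃ | ∃ j, β ≤ |(∑ l, P.statistic L H G henc s₁ s₂ j (s₃ l)) / P.r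
      - ∫ w, P.statistic L H G henc s₁ s₂ j w ∂(blockLaw μ P.k P.n)|}
  refine le_trans (measure_mono ?_) (prod_prod_measure_le _ _ _ (badCoverage P enc μ τ) B₂ B₃
    (measure_badCoverage_le hP)
    (fun s₁ hs₁ => measure_no_competitive_candidate_le henc hP hL hU hs₁) fun s₁ s₂ => ?_)
  · rintro ⟨s₁, s₂, s₃⟩ hS
    by_contra hno
    simp only [Set.mem_ofPred_eq, not_or, not_and] at hno
    obtain ⟨h1, h2, h3⟩ := hno
    refine hS ?_
    obtain ⟨c, hc⟩ := not_forall_not.1 (h2 h1)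
    simp only [B₃, Set.mem_ofPred_eq, not_exists, not_le] at h3
    have hV : ∀ g ∈ G, |blockMean (groupHit g) s₃
        - ∫ w, groupHit g w ∂(blockLaw μ P.k P.n)| < β := fun g hg => h3 (⟨g, hg⟩, none)
    have hC : ∀ c, ∀ g ∈ G, |blockMean (groupRisk L g (P.candidate L H G henc s₁ s₂ c)) s₃
        - ∫ w, groupRisk L g (P.candidate L H G henc s₁ s₂ c) w ∂(blockLaw μ P.k P.n)| < β :=
      fun c g hg => h3 (⟨g, hg⟩, some (.inl c))
    have hH : ∀ g ∈ G, ∀ h ∈ H, |blockMean (groupRisk L g h) s₃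
        - ∫ w, groupRisk L g h w ∂(blockLaw μ P.k P.n)| < β :=
      fun g hg h hh => h3 (⟨g, hg⟩, some (.inr ⟨h, hh⟩))
    have hex : ∃ c, accepts L H G P.γ P.e s₃ (P.candidate L H G henc s₁ s₂ c) :=
      ⟨c, accepts_of_avgRisk_le hP.β_le hP.β_le' hP.γ_pos hP.le_hitProb hV (hC c) hH hc⟩
    intro g hg hgγ h hh
    simp only [Params.select, dif_pos hex]
    exact avgRisk_le_of_accepts hP.β_le hP.β_le' hP.γ_pos hP.le_hitProb hV (hC _) hH
      hex.choose_spec hg hgγ hh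
  · rw [ENNReal.le_ofReal_iff_toReal_le (by finiteness) hP.a_nonneg]
    refine (measureReal_exists_deviation_le (blockLaw μ P.k P.n)
      (P.statistic L H G henc s₁ s₂) ?_ hP.r_pos hP.β_nonneg).trans ?_
    · rintro ⟨g, _ | c | h⟩ w
      · exact groupHit_mem_Icc _ _
      · exact groupRisk_mem_Icc _ _ _ _
      · exact groupRisk_mem_Icc _ _ _ _
    · refine le_trans (le_of_eq ?_) hP.selection
      simp only [Fintype.card_prod, Fintype.card_option, Fintype.card_sum, Fintype.card_coe]
      push_cast
      rfl

end MultiGroup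

/-! ### Counting advice and choosing the parameters. -/

namespace MultiGroup

variable {X : Type*}

/-- The number of pieces of advice is at most exponential. -/
theorem card_index_le (P : Params) (H : Finset (Predictor X)) (G : Finset (Set X)) :
    (Fintype.card (P.Index H G) : ℝ) ≤ Real.exp (P.m * (P.N * P.R) +
      P.T * (Real.log (1 + G.card) + Real.log (1 + H.card) + 2 * (P.k + 1) + 2)) := by
  have hexp : ∀ x : ℝ, x + 1 ≤ Real.exp x := Real.add_one_le_exp
  have h2 : (2 : ℝ) ≤ Real.exp 1 := by linarith [hexp 1]
  have h4 : (4 : ℝ) ≤ Real.exp 2 := by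
    have : Real.exp 2 = Real.exp 1 * Real.exp 1 := by rw [← Real.exp_add]; norm_num
    nlinarith
  have hpow : (2 : ℝ) ^ (P.k + 1) ≤ Real.exp (P.k + 1) := by
    have : Real.exp (P.k + 1 : ℝ) = Real.exp 1 ^ (P.k + 1) := by
      rw [← Real.exp_nat_mul]; push_cast; ring_nf
    rw [this]
    gcongr
  have hk : (P.k + 1 : ℝ) ≤ Real.exp (P.k + 1) := by linarith [hexp (P.k + 1)]
  have hG : Real.exp (Real.log (1 + G.card)) = 1 + (G.card : ℝ) := Real.exp_log (by positivity)
  have hH : Real.exp (Real.log (1 + H.card)) = 1 + (H.card : ℝ) := Real.exp_log (by positivity)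
  have hcard : (Fintype.card (P.Index H G) : ℝ) = ((P.N * P.R : ℝ) + 1) ^ P.m *
      ((G.card : ℝ) * ((H.card + 1) * ((P.k + 1) * (2 * 2 ^ (P.k + 1)))) + 1) ^ P.T := by
    simp [Params.Index, Advice]
  have hadv : (G.card : ℝ) * ((H.card + 1) * ((P.k + 1) * (2 * 2 ^ (P.k + 1)))) + 1 ≤
      Real.exp (Real.log (1 + G.card) + Real.log (1 + H.card) + 2 * (P.k + 1) + 2) := by
    rw [show Real.log (1 + G.card) + Real.log (1 + H.card) + 2 * (P.k + 1 : ℝ) + 2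
      = Real.log (1 + G.card) + (Real.log (1 + H.card) + ((P.k + 1) + (2 + (P.k + 1)))) by ring,
      Real.exp_add, Real.exp_add, Real.exp_add, Real.exp_add _ (P.k + 1 : ℝ), hG, hH]
    have h1 : (H.card + 1 : ℝ) * ((P.k + 1) * (2 * 2 ^ (P.k + 1)))
        ≤ (1 + H.card) * (Real.exp (P.k + 1) * (Real.exp 2 * Real.exp (P.k + 1))) := by
      rw [add_comm (H.card : ℝ)]
      gcongr
      linarith
    have h3 : (1 : ℝ) ≤ (1 + H.card) * (Real.exp (P.k + 1) * (Real.exp 2 * Real.exp (P.k + 1))) := by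
      have a1 : (1 : ℝ) ≤ 1 + H.card := by simp
      have a2 : (1 : ℝ) ≤ Real.exp (P.k + 1) := Real.one_le_exp (by positivity)
      have a3 : (1 : ℝ) ≤ Real.exp 2 := by linarith
      exact one_le_mul_of_one_le_of_one_le a1 (one_le_mul_of_one_le_of_one_le a2
        (one_le_mul_of_one_le_of_one_le a3 a2))
    have h5 := mul_le_mul_of_nonneg_left h1 (show (0 : ℝ) ≤ G.card by positivity)
    nlinarith
  rw [hcard, Real.exp_add, Real.exp_nat_mul _ P.m, Real.exp_nat_mul _ P.T]
  gcongr
  exact hexp _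

/-- The left side counts the statistics in the final union bound; the exponential form lets
Hoeffding's exponent absorb it. -/
theorem mul_add_le_exp {g i h x : ℝ} (hg : 0 ≤ g) (hi : 0 ≤ i) (hh : 0 ≤ h) (hx : 0 ≤ x)
    (hix : i ≤ Real.exp x) :
    g * (i + h + 1) ≤ Real.exp (Real.log (1 + g) + Real.log (1 + h) + 1 + x) := by
  have h2 : (2 : ℝ) ≤ Real.exp 1 := by linarith [Real.add_one_le_exp (1 : ℝ)]
  have h1 : 1 ≤ Real.exp x := Real.one_le_exp hx
  rw [Real.exp_add, Real.exp_add, Real.exp_add, Real.exp_log (by linarith),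
    Real.exp_log (by linarith)]
  have h3 : i + h + 1 ≤ (1 + h) * (2 * Real.exp x) := by nlinarith
  calc g * (i + h + 1) ≤ (1 + g) * ((1 + h) * (2 * Real.exp x)) := by
        gcongr
        linarith
    _ ≤ (1 + g) * ((1 + h) * (Real.exp 1 * Real.exp x)) := by gcongr
    _ = _ := by ring

/-- The exponent that the final selection needs. -/
def Params.exponent (P : Params) (d : ℕ) (hCard gCard : ℕ) : ℝ :=
  6 * d + (Real.log (1 + gCard) + Real.log (1 + hCard) + 1 + (P.m * (P.N * P.R) +
      P.T * (Real.log (1 + gCard) + Real.log (1 + hCard) + 2 * (P.k + 1) + 2)))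

theorem log_one_add_nonneg (n : ℕ) : 0 ≤ Real.log (1 + n) := Real.log_nonneg (by simp)

/-- The terms are at most `a ^ 2 * N ^ 4 / m` and `3 * K * a * b / m`, and `m` is `3 * d` times the
sum of the numerators. -/
theorem coverage_le {m e N a K b d : ℝ} (he : 0 < e) (hN : 0 < N) (hm0 : 0 < m) (ha : 0 < a)
    (hd : 0 < d) (hea : 1 ≤ e * a) (hm : m = 3 * d * (a ^ 2 * N ^ 4 + 3 * K * a * b)) :
    1 / (m * (e / N ^ 2) ^ 2) + 1 / (m * (1 / (3 * K * a * b))) ≤ 1 / (3 * d) := by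
  have h1 : 1 / (m * (e / N ^ 2) ^ 2) ≤ a ^ 2 * N ^ 4 / m := by
    rw [div_le_div_iff₀ (by positivity) (by positivity)]
    have : 1 ≤ (e * a) ^ 2 := one_le_pow₀ hea
    calc 1 * m ≤ (e * a) ^ 2 * m := by gcongr
      _ = _ := by field_simp
  have h2 : 1 / (m * (1 / (3 * K * a * b))) = 3 * K * a * b / m := by
    rw [one_div, mul_inv, one_div, inv_inv, div_eq_inv_mul]
  rw [h2]
  refine (add_le_add h1 le_rfl).trans (le_of_eq ?_)
  rw [← add_div, div_eq_div_iff (by positivity) (by positivity)]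
  linear_combination -hm

/-- The tail, the rounding of atoms and the rounding of the number of light points each get a third
of the allowance `1 / (K * a * b)`. -/
theorem rounding_le {m N a K b R γ' : ℝ} (hN1 : 1 ≤ N) (hm : 0 < m) (ha : 0 < a) (hb : 0 < b)
    (hK : 1 ≤ K) (hγ0 : 0 < γ') (hγ : 1 / γ' ≤ b) (hN : N = 4 * K ^ 2 * a * b) (hR : R = 3 * K * a * b * m) :
    K * ((1 / (3 * K * a * b) + m / (N * R) + 1 / N) / γ') ≤ 1 / a := by
  have hK0 : 0 < K := by linarith
  have hRpos : 0 < R := by rw [hR]; positivity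
  have h1 : m / (N * R) ≤ 1 / (3 * K * a * b) := by
    calc m / (N * R) ≤ m / (1 * R) := by gcongr
      _ = _ := by rw [hR]; field_simp
  have h2 : 1 / N ≤ 1 / (3 * K * a * b) := by
    rw [hN]
    gcongr 1 / (?_ * _ * _)
    nlinarith
  have h3 : 1 / (3 * K * a * b) + m / (N * R) + 1 / N ≤ 1 / (K * a * b) :=
    (add_le_add (add_le_add le_rfl h1) h2).trans (le_of_eq (by field_simp; norm_num))
  calc K * ((1 / (3 * K * a * b) + m / (N * R) + 1 / N) / γ')
      = K * ((1 / (3 * K * a * b) + m / (N * R) + 1 / N) * (1 / γ')) := by ring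
    _ ≤ K * (1 / (K * a * b) * b) := by gcongr
    _ = 1 / a := by field_simp

theorem div_le_of_inv_le {x y γ' b c : ℝ} (hy : 0 < y) (hγ : 1 / γ' ≤ b) (hx : 0 ≤ x)
    (h : x / y * b ≤ c) : x / (y * γ') ≤ c := by
  refine le_trans (le_of_eq ?_) ((mul_le_mul_of_nonneg_left hγ (div_nonneg hx hy.le)).trans h)
  rw [div_mul_div_comm, mul_one]

/-- The step size is at least `1 / (K * a * b)`, so `T` steps of half its square amount to at least
`3 * d`. -/
theorem descent_le {e γ K d a b T : ℝ} (he : 0 < e) (hγ : 0 < γ) (hK : 1 ≤ K) (hd : 0 < d)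
    (hγb : 1 ≤ γ / 2 * b) (hea : 1 ≤ e * a) (hT : T = 6 * d * (K * a * b) ^ 2) :
    1 / ((γ / 2 * e / K) ^ 2 / 2 * T) ≤ 1 / (3 * d) := by
  rw [hT]
  refine one_div_le_one_div_of_le (by positivity) ?_
  have h1 : 1 ≤ (γ / 2 * b * (e * a)) ^ 2 :=
    one_le_pow₀ (one_le_mul_of_one_le_of_one_le hγb hea)
  have hK0 : K ≠ 0 := by linarith
  calc 3 * d = 3 * d * 1 := by ring
    _ ≤ 3 * d * (γ / 2 * b * (e * a)) ^ 2 := by gcongr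
    _ = _ := by field_simp; ring

/-- A choice of the parameters that makes the learner succeed. -/
theorem Params.valid {P : Params} {a b d : ℕ} {δ : ℝ} (H : Finset (Predictor X))
    (G : Finset (Set X)) (he : P.e ∈ Set.Ioc (0 : ℝ) (1 / 2)) (hγ : 0 < P.γ) (hδ : 0 < δ)
    (ha : 1 / P.e ≤ a) (hb : 2 / P.γ ≤ b) (hd : 1 / δ ≤ d)
    (hN : P.N = 4 * (P.k + 1) ^ 2 * a * b)
    (hm : P.m = 3 * d * (a ^ 2 * P.N ^ 4 + 3 * (P.k + 1) * a * b))
    (hR : P.R = 3 * (P.k + 1) * a * b * P.m) (hn : P.n = (P.k + 1) * a * b)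
    (hT : P.T = 6 * d * ((P.k + 1) * a * b) ^ 2)
    (hr : P.r = 2 * (a * b) ^ 2 * (⌈P.exponent d H.card G.card⌉₊ + 1)) :
    P.Valid (δ / 3) (1 / (2 * a * b)) (1 / (3 * (P.k + 1) * a * b))
      (Fintype.card (P.Index H G)) H.card G.card := by
  have he0 := he.1
  have ha0 : (0 : ℝ) < a := lt_of_lt_of_le (by positivity) ha
  have hb0 : (0 : ℝ) < b := lt_of_lt_of_le (by positivity) hb
  have hd0 : (0 : ℝ) < d := lt_of_lt_of_le (by positivity) hd
  have hea : 1 ≤ P.e * a := by rwa [div_le_iff₀ he0, mul_comm] at ha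
  have hγb : 1 ≤ P.γ / 2 * b := by rw [div_le_iff₀ hγ] at hb; linarith
  have hδd : 1 ≤ δ * d := by rwa [div_le_iff₀ hδ, mul_comm] at hd
  have ha1 : 0 < a := by exact_mod_cast ha0
  have hb1 : 0 < b := by exact_mod_cast hb0
  have hd1 : 0 < d := by exact_mod_cast hd0
  have hab : (0 : ℝ) < a * b := by positivity
  have hNpos : 0 < P.N := by rw [hN]; positivity
  have hmpos : 0 < P.m := by rw [hm]; positivity
  have hRpos : 0 < P.R := by rw [hR]; positivity
  have hN' : (P.N : ℝ) = 4 * (P.k + 1) ^ 2 * a * b := by rw [hN]; push_cast; ring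
  have hm' : (P.m : ℝ) = 3 * d * (a ^ 2 * P.N ^ 4 + 3 * (P.k + 1) * a * b) := by
    rw [hm]; push_cast; ring
  have hR' : (P.R : ℝ) = 3 * (P.k + 1) * a * b * P.m := by rw [hR]; push_cast; ring
  have hn' : (P.n : ℝ) = (P.k + 1) * a * b := by rw [hn]; push_cast; ring
  have hT' : (P.T : ℝ) = 6 * d * ((P.k + 1) * a * b) ^ 2 := by rw [hT]; push_cast; ring
  have hr' : (P.r : ℝ) = 2 * (a * b) ^ 2 * (⌈P.exponent d H.card G.card⌉₊ + 1) := by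
    rw [hr]; push_cast; ring
  have hN0 : (0 : ℝ) < P.N := by exact_mod_cast hNpos
  have hm0 : (0 : ℝ) < P.m := by exact_mod_cast hmpos
  have hinvγ : 1 / (P.γ / 2) ≤ b := by rw [div_le_iff₀ (by positivity), mul_comm]; exact hγb
  have hinva : 1 / (a : ℝ) ≤ P.e := by rw [div_le_iff₀ ha0]; exact hea
  have hd3 : 1 / (3 * (d : ℝ)) ≤ δ / 3 := by
    rw [div_le_div_iff₀ (by positivity) (by norm_num)]; linarith
  have hN1 : (1 : ℝ) ≤ P.N := by exact_mod_cast hNpos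
  have hk1 : (1 : ℝ) ≤ P.k + 1 := by simp
  refine ⟨he, hγ, hNpos, hRpos, hmpos, ?_, ?_, by positivity, by positivity, by positivity,
    ?_, ?_, ?_, ?_, ?_, ?_, ?_, ?_⟩
  · rw [hr]; positivity
  · rw [hT]; positivity
  · refine le_trans ?_ hinva
    gcongr
    have : (1 : ℝ) ≤ b := by exact_mod_cast hb1
    nlinarith
  · rw [div_le_iff₀ (by positivity)]
    have : (1 : ℝ) ≤ a := by exact_mod_cast ha1
    nlinarith
  · exact (coverage_le he0 hN0 hm0 ha0 hd0 hea hm').trans hd3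
  · push_cast
    exact (rounding_le hN1 hm0 ha0 hb0 hk1 (half_pos hγ) hinvγ hN' hR').trans hinva
  · refine (div_le_of_inv_le (by positivity) hinvγ (by positivity) ?_).trans hinva
    rw [hN']
    field_simp
    exact le_rfl
  · push_cast
    rw [mul_one_div]
    refine (div_le_of_inv_le (by positivity) hinvγ (by positivity) ?_).trans hinva
    rw [hn']
    field_simp
    simp
  · refine le_trans ?_ hd3
    push_cast
    exact descent_le he0 hγ hk1 hd0 hγb hea hT'
  · refine le_trans ?_ hd3
    have hexp0 : 0 ≤ (P.m * (P.N * P.R) : ℝ) +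
        P.T * (Real.log (1 + G.card) + Real.log (1 + H.card) + 2 * (P.k + 1) + 2) := by
      have := log_one_add_nonneg G.card
      have := log_one_add_nonneg H.card
      positivity
    have h1 := mul_add_le_exp (Nat.cast_nonneg G.card) (Nat.cast_nonneg _)
      (Nat.cast_nonneg H.card) hexp0 (card_index_le P H G)
    -- With `β = 1 / (2 * a * b)`, the choice of `r` makes `2 * r * β ^ 2` equal to the rounded
    -- exponent plus one.
    have h2 : -2 * P.r * (1 / (2 * (a : ℝ) * b)) ^ 2 ≤ -P.exponent d H.card G.card := by
      have : -2 * P.r * (1 / (2 * (a : ℝ) * b)) ^ 2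
          = -(⌈P.exponent d H.card G.card⌉₊ + 1 : ℝ) := by
        rw [hr']; field_simp
      rw [this]
      linarith [Nat.le_ceil (P.exponent d H.card G.card)]
    have h6 : (6 * d : ℝ) ≤ Real.exp (6 * d) := by linarith [Real.add_one_le_exp (6 * (d : ℝ))]
    calc (G.card : ℝ) * (Fintype.card (P.Index H G) + H.card + 1)
          * (2 * Real.exp (-2 * P.r * (1 / (2 * (a : ℝ) * b)) ^ 2))
        ≤ Real.exp (Real.log (1 + G.card) + Real.log (1 + H.card) + 1 + (P.m * (P.N * P.R) +
            P.T * (Real.log (1 + G.card) + Real.log (1 + H.card) + 2 * (P.k + 1) + 2)))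
          * (2 * Real.exp (-P.exponent d H.card G.card)) := by gcongr
      -- The exponent cancels the number of statistics; its summand `6 * d` is what remains for the
      -- failure probability.
      _ = 2 / Real.exp (6 * d) := by
        rw [Params.exponent, neg_add, Real.exp_add (-(6 * (d : ℝ))), Real.exp_neg, Real.exp_neg]
        field_simp
      _ ≤ 2 / (6 * d) := by gcongr
      _ = _ := by field_simp; norm_num

/-! ### Splitting one sample among the stages of the learner. -/

/-- The positions in the sample, according to their use. -/
abbrev Params.Slot (P : Params) : Type :=
  Fin P.m ⊕ (Fin P.T × Fin (P.k + 1) × Fin (P.n + 1)) ⊕ (Fin P.r × Fin (P.k + 1) × Fin (P.n + 1))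

/-- The number of examples that the learner uses. -/
def Params.size (P : Params) : ℕ :=
  P.m + (P.T * ((P.k + 1) * (P.n + 1)) + P.r * ((P.k + 1) * (P.n + 1)))

theorem Params.card_slot (P : Params) : Fintype.card P.Slot = P.size := by
  simp [Params.size]

/-- The positions in a large enough sample. -/
def Params.slot (P : Params) {m : ℕ} (hm : P.size ≤ m) : P.Slot ↪ Fin m :=
  (Function.Embedding.nonempty_of_card_le (by rw [P.card_slot, Fintype.card_fin]; exact hm)).some

/-- The learner: it uses the first examples of the sample, and no coins. -/
def Params.learn [MeasurableSpace X] [DiscreteMeasurableSpace X] (P : Params) (L : Loss X) (H : Finset (Predictor X))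
    (G : Finset (Set X)) {enc : X → ℕ} (henc : Function.Injective enc) (m : ℕ)
    (S : Fin m → X × Bool) : Predictor X :=
  if hm : P.size ≤ m then
    P.select L H G henc (fun i => S (P.slot hm (.inl i)))
      (fun i j l => S (P.slot hm (.inr (.inl (i, j, l)))))
      (fun i j l => S (P.slot hm (.inr (.inr (i, j, l)))))
  else fun _ => 0

/-- Distinct positions make the three parts of the sample independent. Returning from `avgRisk` to
the risk costs `2 * e` for each of the two predictors compared, so `18 * e` becomes `22 * e`. -/
theorem measure_learn_fails_le [MeasurableSpace X] [DiscreteMeasurableSpace X] [Countable X] {P : Params} {a β τ : ℝ}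
    {L : Loss X} {H : Finset (Predictor X)} {G : Finset (Set X)} {enc : X → ℕ}
    (henc : Function.Injective enc)
    (hP : P.Valid a β τ (Fintype.card (P.Index H G)) H.card G.card) (hL : L.MultiPACCompatible)
    (hU : ∀ (D : LabelledDist X) (h : Predictor X), |avgRisk L h P.k D - L.risk D h| ≤ 2 * P.e)
    (D : LabelledDist X) {m : ℕ} (hm : P.size ≤ m) :
    iidSample D m {S | ¬ ∀ g ∈ G, ∀ hg : 0 < groupMass D g, P.γ ≤ groupMass D g →
        L.Competitive (restrictTo D g hg) H (22 * P.e) (P.learn L H G henc m S)}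
      ≤ ENNReal.ofReal a + (ENNReal.ofReal a + ENNReal.ofReal a) := by
  have hsel := measure_select_fails_le henc (μ := (D : Measure (X × Bool))) hP hL hU
  have hsplit := pi_map_split (a := Fin P.m) (b := Fin P.T) (c := Fin P.r) (ι := Fin (P.k + 1))
    (κ := Fin (P.n + 1)) (D : Measure (X × Bool))
  have hslot := pi_map_comp_injective (D : Measure (X × Bool)) (P.slot hm) (P.slot hm).injective
  unfold blockLaw at hsel
  rw [← hsplit, ← hslot] at hsel
  refine le_trans (measure_mono ?_)
    ((Measure.le_map_apply (Measurable.of_discrete).aemeasurable _).trans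
      ((Measure.le_map_apply (Measurable.of_discrete).aemeasurable _).trans hsel))
  intro S hS hno
  refine hS fun g hg hg0 hgγ h hh => ?_
  have h1 := hno g hg hgγ h hh
  have h2 := abs_le.1 (hU (restrictTo D g hg0) h)
  have h3 := abs_le.1 (hU (restrictTo D g hg0) (P.learn L H G henc m S))
  have h4 : avgRisk L (P.learn L H G henc m S) P.k (restrictTo D g hg0)
      ≤ avgRisk L h P.k (restrictTo D g hg0) + 18 * P.e := by
    rw [Params.learn, dif_pos hm]
    exact h1
  linarith [h2.2, h3.1]

end MultiGroup

/-! ### Polynomial bounds for the sample complexity. -/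

namespace MultiGroup

section PolyBounded

variable {ι σ : Type*}

/-- The function `φ` is nonnegative and at most a polynomial in the variables `v`. -/
def PolyBounded (v : ι → σ → ℝ) (φ : ι → ℝ) : Prop :=
  ∃ f : MvPolynomial σ ℝ, ∀ i, 0 ≤ φ i ∧ φ i ≤ f.eval (v i)

namespace PolyBounded

variable {v : ι → σ → ℝ} {φ ψ : ι → ℝ}

theorem mono (hψ : PolyBounded v ψ) (h0 : ∀ i, 0 ≤ φ i) (h : ∀ i, φ i ≤ ψ i) :
    PolyBounded v φ :=
  let ⟨f, hf⟩ := hψ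
  ⟨f, fun i => ⟨h0 i, (h i).trans (hf i).2⟩⟩

theorem const {c : ℝ} (hc : 0 ≤ c) : PolyBounded v fun _ => c :=
  ⟨.C c, fun i => ⟨hc, by simp⟩⟩

theorem var (j : σ) (h : ∀ i, 0 ≤ v i j) : PolyBounded v fun i => v i j :=
  ⟨.X j, fun i => ⟨h i, by simp⟩⟩

theorem add (hφ : PolyBounded v φ) (hψ : PolyBounded v ψ) : PolyBounded v fun i => φ i + ψ i :=
  let ⟨f, hf⟩ := hφ
  let ⟨g, hg⟩ := hψ
  ⟨f + g, fun i => ⟨add_nonneg (hf i).1 (hg i).1, by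
    rw [map_add]; exact add_le_add (hf i).2 (hg i).2⟩⟩

theorem mul (hφ : PolyBounded v φ) (hψ : PolyBounded v ψ) : PolyBounded v fun i => φ i * ψ i :=
  let ⟨f, hf⟩ := hφ
  let ⟨g, hg⟩ := hψ
  ⟨f * g, fun i => ⟨mul_nonneg (hf i).1 (hg i).1, by
    rw [map_mul]
    exact mul_le_mul (hf i).2 (hg i).2 (hg i).1 ((hf i).1.trans (hf i).2)⟩⟩

theorem pow (hφ : PolyBounded v φ) (n : ℕ) : PolyBounded v fun i => φ i ^ n := by
  induction n with
  | zero => simpa using const zero_le_one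
  | succ n ih => simpa only [pow_succ] using ih.mul hφ

theorem ceil (hφ : PolyBounded v φ) : PolyBounded v fun i => (⌈φ i⌉₊ : ℝ) :=
  (hφ.add (const zero_le_one)).mono (fun _ => Nat.cast_nonneg _) fun i =>
    let ⟨_, hf⟩ := hφ
    (Nat.ceil_lt_add_one (hf i).1).le

/-- A polynomial `f` need not be monotone, so bounds on its arguments would not do: its arguments
must be exactly the values of the polynomials `q`, which are substituted into it. -/
theorem of_eval {τ : Type*} (f : MvPolynomial τ ℝ) (q : τ → MvPolynomial σ ℝ) (h0 : ∀ i, 0 ≤ φ i)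
    (h : ∀ i, φ i ≤ f.eval fun j => (q j).eval (v i)) : PolyBounded v φ := by
  refine ⟨MvPolynomial.bind₁ q f, fun i => ⟨h0 i, ?_⟩⟩
  have := MvPolynomial.aeval_bind₁ (v i) q f
  simp only [MvPolynomial.aeval_eq_eval] at this
  rw [this]
  exact h i

end PolyBounded

end PolyBounded

/-- The parameters of the learning problem: `ε`, `δ`, `γ`, and the sizes of the predictor class
and of the collection of groups. -/
abbrev Task : Type := Set.Ioo (0 : ℝ) 1 × Set.Ioo (0 : ℝ) 1 × Set.Ioo (0 : ℝ) 1 × ℕ × ℕ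

/-- The quantities in which the sample complexity is polynomial. -/
def taskVars (t : Task) : Fin 5 → ℝ :=
  ![1 / (t.1 : ℝ), 1 / (t.2.1 : ℝ), 1 / (t.2.2.1 : ℝ), Real.log t.2.2.2.1, Real.log t.2.2.2.2]

theorem taskVars_nonneg (t : Task) (j : Fin 5) : 0 ≤ taskVars t j := by
  have h1 := t.1.2.1
  have h2 := t.2.1.2.1
  have h3 := t.2.2.1.2.1
  fin_cases j
  · exact one_div_nonneg.2 h1.le
  · exact one_div_nonneg.2 h2.le
  · exact one_div_nonneg.2 h3.le
  · exact Real.log_natCast_nonneg _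
  · exact Real.log_natCast_nonneg _

/-- Cardinalities enter the advice count through `log (1 + n)`, which stays meaningful for empty
collections, while the complexity bound is stated with `log n`. -/
theorem log_one_add_le (n : ℕ) : Real.log (1 + n) ≤ 1 + Real.log n := by
  rcases n.eq_zero_or_pos with rfl | hn
  · simp
  have hn1 : (1 : ℝ) ≤ n := by exact_mod_cast hn
  calc Real.log (1 + n) ≤ Real.log (Real.exp 1 * n) := by
        refine Real.log_le_log (by positivity) ?_
        nlinarith [Real.add_one_le_exp (1 : ℝ)]
    _ = _ := by rw [Real.log_mul (Real.exp_pos 1).ne' (by positivity), Real.log_exp]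

/-- The parameters of the learner. -/
def Params.ofTask (mUC : ℝ → ℝ → ℕ → ℕ) (ε δ γ : ℝ) (hCard gCard : ℕ) : Params :=
  let a := ⌈22 * (1 / ε)⌉₊
  let b := ⌈2 * (1 / γ)⌉₊
  let d := ⌈1 / δ⌉₊
  let k := mUC (ε / 22) (ε / 22) 1
  let N := 4 * (k + 1) ^ 2 * a * b
  let m := 3 * d * (a ^ 2 * N ^ 4 + 3 * (k + 1) * a * b)
  let P : Params := ⟨ε / 22, γ, k, (k + 1) * a * b, N, 3 * (k + 1) * a * b * m, m,
    6 * d * ((k + 1) * a * b) ^ 2, 0⟩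
  { P with r := 2 * (a * b) ^ 2 * (⌈P.exponent d hCard gCard⌉₊ + 1) }

theorem polyBounded_size {mUC : ℝ → ℝ → ℕ → ℕ} {f : MvPolynomial (Fin 3) ℝ}
    (hf : ∀ ε ∈ Set.Ioo (0 : ℝ) 1, ∀ δ ∈ Set.Ioo (0 : ℝ) 1, ∀ k : ℕ,
      (mUC ε δ k : ℝ) ≤ f.eval ![1 / ε, 1 / δ, Real.log k]) :
    PolyBounded taskVars fun t =>
      ((Params.ofTask mUC t.1 t.2.1 t.2.2.1 t.2.2.2.1 t.2.2.2.2).size : ℝ) := by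
  have hv := fun j => PolyBounded.var (v := taskVars) j fun t => taskVars_nonneg t j
  have hc : ∀ n : ℕ, PolyBounded taskVars fun _ => (n : ℝ) := fun n =>
    .const (Nat.cast_nonneg n)
  have ha : PolyBounded taskVars fun t => (⌈22 * (1 / (t.1 : ℝ))⌉₊ : ℝ) := ((hc 22).mul (hv 0)).ceil
  have hb : PolyBounded taskVars fun t => (⌈2 * (1 / (t.2.2.1 : ℝ))⌉₊ : ℝ) :=
    ((hc 2).mul (hv 2)).ceil
  have hd : PolyBounded taskVars fun t => (⌈1 / (t.2.1 : ℝ)⌉₊ : ℝ) := (hv 1).ceil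
  have hk : PolyBounded taskVars fun t => (mUC ((t.1 : ℝ) / 22) ((t.1 : ℝ) / 22) 1 : ℝ) := by
    -- Accuracy and confidence are both `ε / 22`, giving `22 / ε` twice; the class is a singleton,
    -- and `log 1 = 0` gives the third argument.
    refine .of_eval f ![.C 22 * .X 0, .C 22 * .X 0, 0] (fun _ => Nat.cast_nonneg _) fun t => ?_
    have h1 := t.1.2
    have hm : (t.1 : ℝ) / 22 ∈ Set.Ioo (0 : ℝ) 1 := ⟨by linarith [h1.1], by linarith [h1.2]⟩
    refine (hf _ hm _ hm 1).trans (le_of_eq ?_)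
    have h0 := h1.1.ne'
    refine congrArg (fun w => MvPolynomial.eval w f) (funext fun j => ?_)
    fin_cases j <;> simp [taskVars, div_eq_mul_inv]
  have hG : PolyBounded taskVars fun t => Real.log (1 + t.2.2.2.2) :=
    ((hc 1).add (hv 4)).mono (fun t => log_one_add_nonneg _) fun t => by
      simpa [taskVars] using log_one_add_le t.2.2.2.2
  have hH : PolyBounded taskVars fun t => Real.log (1 + t.2.2.2.1) :=
    ((hc 1).add (hv 3)).mono (fun t => log_one_add_nonneg _) fun t => by
      simpa [taskVars] using log_one_add_le t.2.2.2.1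
  have hK := hk.add (hc 1)
  have hKab := (hK.mul ha).mul hb
  have hN := (((hc 4).mul (hK.pow 2)).mul ha).mul hb
  have hm := ((hc 3).mul hd).mul (((ha.pow 2).mul (hN.pow 4)).add ((((hc 3).mul hK).mul ha).mul hb))
  have hR := ((((hc 3).mul hK).mul ha).mul hb).mul hm
  have hT := ((hc 6).mul hd).mul (hKab.pow 2)
  have hexp := ((hc 6).mul hd).add (((hG.add hH).add (hc 1)).add ((hm.mul (hN.mul hR)).add
    (hT.mul (((hG.add hH).add ((hc 2).mul hK)).add (hc 2)))))
  have hr := ((hc 2).mul ((ha.mul hb).pow 2)).mul (hexp.ceil.add (hc 1))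
  have hblock := hK.mul (hKab.add (hc 1))
  have hsize := hm.add ((hT.mul hblock).add (hr.mul hblock))
  refine hsize.mono (fun _ => Nat.cast_nonneg _) fun t => le_of_eq ?_
  simp only [Params.size, Params.ofTask, Params.exponent]
  push_cast
  rfl

/-- The coins do not matter for an event that only depends on the sample. -/
theorem measure_fst_preimage_le {X : Type*} [MeasurableSpace X] {D : LabelledDist X} {m : ℕ}
    {E : Set (Fin m → X × Bool)} {c : ENNReal} (h : iidSample D m E ≤ c) :
    ((iidSample D m).prod fairCoins) (Prod.fst ⁻¹' E) ≤ c := by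
  have hprob : IsProbabilityMeasure fairCoins := by unfold fairCoins; infer_instance
  rw [← Set.prod_univ]
  refine le_trans (Measure.prod_prod_le _ _) ?_
  rwa [measure_univ, mul_one]

end MultiGroup

end

/-! ### Assembly of the learner. -/

theorem theorem4p1 {X : Type*} [Countable X] [MeasurableSpace X] [DiscreteMeasurableSpace X]
    (L : MultiGroup.Loss X) (hL : L ∈ MultiGroup.lossClass X)
    (hcompat : L.MultiPACCompatible) :
    L.MultiPACLearnable := by
  open MultiGroup in
  obtain ⟨mUC, hUC, f, hf⟩ := hL.2
  obtain ⟨enc, henc⟩ := exists_injective_nat X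
  refine ⟨fun ε δ γ H G m S _ =>
    (Params.ofTask mUC ε δ γ H.card G.card).learn L H G henc m S,
    fun ε δ γ k l => (Params.ofTask mUC ε δ γ k l).size, ?_, ?_⟩
  · intro ε hε δ hδ γ hγ H G D m hm
    have he : ε / 22 ∈ Set.Ioc (0 : ℝ) (1 / 2) := ⟨by linarith [hε.1], by linarith [hε.2]⟩
    have hvalid : (Params.ofTask mUC ε δ γ H.card G.card).Valid _ _ _ _ _ _ :=
      Params.valid (a := ⌈22 * (1 / ε)⌉₊) (b := ⌈2 * (1 / γ)⌉₊) (d := ⌈1 / δ⌉₊) H G he hγ.1 hδ.1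
        (le_trans (le_of_eq (by simp [Params.ofTask, div_eq_mul_inv])) (Nat.le_ceil _))
        (le_trans (le_of_eq (by simp [Params.ofTask, div_eq_mul_inv])) (Nat.le_ceil _))
        (Nat.le_ceil _) rfl rfl rfl rfl rfl rfl
    have hU : ∀ (D : LabelledDist X) (h : Predictor X),
        |avgRisk L h (mUC (ε / 22) (ε / 22) 1) D - L.risk D h| ≤ 2 * (ε / 22) := fun D h =>
      abs_avgRisk_sub_risk_le L h (hUC {h}) ⟨he.1, by linarith [he.2]⟩ (by simp) D
    have hfail := measure_learn_fails_le henc hvalid hcompat hU D hm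
    have hcoins := measure_fst_preimage_le hfail
    have he22 : 22 * (Params.ofTask mUC ε δ γ H.card G.card).e = ε :=
      mul_div_cancel₀ ε (by norm_num)
    rw [he22] at hcoins
    -- The three stages (coverage, descent, selection) fail with probability at most `δ / 3` each.
    refine hcoins.trans (le_of_eq ?_)
    have h3 := hδ.1
    rw [← ENNReal.ofReal_add (by positivity) (by positivity),
      ← ENNReal.ofReal_add (by positivity) (by positivity)]
    ring_nf
  · obtain ⟨q, hq⟩ := polyBounded_size hf
    exact ⟨q, fun ε hε δ hδ γ hγ k l => (hq (⟨ε, hε⟩, ⟨δ, hδ⟩, ⟨γ, hγ⟩, k, l)).2⟩
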